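/- Theorem 1 (Thermal Operator Representation). Consider a finite connected Feynman graph with $V$ vertices and $I$ oriented internal lines (multiple lines and self-loops allowed), each line being either scalar or a Dirac line, and let $L=I-V+1$. Line $i$ has kinematic energy $E_i>0$ (the $E_i$ are regarded as independent variables), mass $m_i$ and spatial momentum $\mathbf k_i$. Its propagator at Euclidean energy $k$ is $\Delta_i(k,E_i)=\frac{1}{k^2+E_i^2}$ for a scalar line and $\Delta_i(k,E_i)=\frac{m_i+ik\gamma^0-\mathbf k_i\cdot\boldsymbol\gamma}{k^2+E_i^2}$ for a Dirac line, where $\{\gamma^\mu,\gamma^\nu\}=2\eta^{\mu\nu}$ and $\eta=\mathrm{diag}(1,-1,-1,-1)$. All spinor indices of the product $\prod_i\Delta_i$ are contracted with an arbitrary tensor that depends neither on the energies $k_i,E_i$ nor on the temperature. For temperature $T>0$ let $k_i=2\pi T n_i$ (scalar) or $k_i=2\pi T(n_i+\tfrac12)$ (Dirac), $n_i\in\mathbb Z$, and let $p=(p_v)$ be external Euclidean energies with $\sum_v p_v=0$ and $p_v\in 2\pi T(\mathbb Z+f_v/2)$, where $f_v$ is the number of Dirac internal line ends at $v$. Put $$D(p,E,T)=\Big(\prod_{i=1}^I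 2E_i\Big)\,T^L\sum_{n\in\mathbb Z^I}\delta(p,k)\prod_{i=1}^I\Delta_i(k_i,E_i),$$ where $\delta(p,k)$ is $1$ if energy is conserved at every vertex and $0$ otherwise. For real $\omega=(\omega_v)$ with $\sum_v\omega_v=0$, let $D_0(\omega,E)$ be the corresponding zero-temperature integral, in which $k$ runs over the real solutions of the conservation equations with external energies $\omega$, and $T^L\sum$ is replaced by $\int\prod_l\frac{dk_l}{2\pi}$ over the energies $k_l$ of the $L$ lines outside any chosen spanning tree. Sums and integrals are limits over symmetric boxes. Then both limits exist, and the sum and integral converge absolutely if no Dirac line is a self-loop. For fixed $\omega$, $D_0(\omega,E)$ agrees for all $E>0$ with a rational function of $E$ that has no pole at positive $E$; this rational function is again denoted $D_0(\omega,E)$ and is used at energies of either sign. For all $p$, $T$ and $E>0$ as above, $$D(p,E,T)=\hat{\mathcal O}(E,T)\,D_0(\omega,E)\Big|_{\omega=p},\qquad \hat{\mathcal O}(E,T)=\sum_{A}\ \prod_{i\in A}N_i(E_i)\,(1+\hat{\mathcal S}_i),$$ where $A$ runs over the sets of at most $L$ internal lines (including $\emptyset$, which contributes $1$) whose removal leaves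 the graph connected. Here $N_i(E)=(e^{E/T}-1)^{-1}$ for a scalar line and $N_i(E)=-(e^{E/T}+1)^{-1}$ for a Dirac line, $\hat{\mathcal S}_i$ is the reflection $E_i\mapsto-E_i$, and in each term all the factors $N_i$ stand to the left of all the reflections. If some individual reflected terms have a pole at $E$, the right-hand side is understood as its limit from nearby energies $E'$ where none has. The same identity holds if the sum over one-element sets $A$ is extended to all single lines. The operator $\hat{\mathcal O}$ does not depend on $p$, nor on the masses, spatial momenta and spin structure; it depends only on $T$, the topology of the graph and the statistics of its lines. -/

import Mathlib

open Filter Topology MeasureTheory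

/-- The topology of a Feynman graph with vertex set `V` and set of internal lines `I`, together with
the statistics of the lines (`fermionic i`: a Dirac line; otherwise a scalar line). Multiple lines
and self-loops are allowed. The energy of the line `i` flows from `src i` to `tgt i`.
External lines are amputated: they only enter through the energies they inject at the vertices. -/
structure FeynmanGraph (V I : Type*) where
  src : I → V
  tgt : I → V
  fermionic : I → Prop

/-- Gamma matrices of Minkowski space, `{γ^μ, γ^ν} = 2 η^{μν}` with `η = diag(1,-1,-1,-1)`. -/
def IsDiracGamma (γ : Fin 4 → Matrix (Fin 4) (Fin 4) ℂ) : Prop :=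
  ∀ μ ν, γ μ * γ ν + γ ν * γ μ =
    (2 * (Matrix.diagonal ![1, -1, -1, -1] : Matrix (Fin 4) (Fin 4) ℂ) μ ν) • 1

noncomputable section

namespace FeynmanGraph

open scoped Classical

variable {V I : Type*} [Fintype V] [Fintype I]

/-! ### Topology -/

/-- What remains of the graph when the lines in `A` are snipped (all vertices are kept), as far as
connectivity is concerned. -/
def snip (G : FeynmanGraph V I) (A : Finset I) : SimpleGraph V :=
  SimpleGraph.fromRel fun u v => ∃ i, i ∉ A ∧ G.src i = u ∧ G.tgt i = v

/-- The graph is connected. -/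
def IsConnected (G : FeynmanGraph V I) : Prop := (G.snip ∅).Connected

/-- The number `L = I - V + 1` of independent loops (of a connected graph). -/
def loops (_G : FeynmanGraph V I) : ℕ := Fintype.card I + 1 - Fintype.card V

/-- `t` is (the set of lines of) a spanning tree: its lines connect all the vertices, and there
are `V - 1` of them. -/
def IsTree (G : FeynmanGraph V I) (t : Finset I) : Prop :=
  (G.snip tᶜ).Connected ∧ t.card + 1 = Fintype.card V

/-- Energy conservation at every vertex: the external energy entering plus the internal energies
entering equals the internal energies leaving. -/
def Conserves (G : FeynmanGraph V I) (p : V → ℝ) (k : I → ℝ) : Prop :=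
  ∀ v, p v + ∑ i with G.tgt i = v, k i = ∑ i with G.src i = v, k i

/-! ### Matsubara frequencies -/

/-- The Matsubara frequency `2πTn` of a scalar line, `2πT(n + 1/2)` of a fermionic line. -/
def freq (G : FeynmanGraph V I) (T : ℝ) (n : I → ℤ) (i : I) : ℝ :=
  if G.fermionic i then 2 * Real.pi * T * (n i + 1 / 2) else 2 * Real.pi * T * n i

/-- `p` is a family of external Euclidean energies at temperature `T`: total energy is conserved,
and the energy entering at a vertex is an integer or half-integer multiple of `2πT`, according
to the parity of the number of fermionic internal lines attached to the vertex (a self-loop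
counts twice), i.e. to the parity of the number of external fermions entering there. -/
def IsExternal (G : FeynmanGraph V I) (T : ℝ) (p : V → ℝ) : Prop :=
  ∑ v, p v = 0 ∧ ∀ v, ∃ q : ℤ, p v = 2 * Real.pi * T *
    (q + ((Finset.univ.filter fun i => G.fermionic i ∧ G.src i = v).card
        + (Finset.univ.filter fun i => G.fermionic i ∧ G.tgt i = v).card : ℝ) / 2)

/-! ### Spin structure and propagators -/

/-- A choice of the two spinor indices of the propagator on every fermionic line. -/
abbrev SpinIndex (G : FeynmanGraph V I) := {i : I // G.fermionic i} → Fin 4 × Fin 4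

/-- The data of the internal lines that do not depend on the energies: gamma matrices, masses
and spatial momenta, and the constant tensor `vert` with which the spinor indices of the
fermionic propagators are contracted (spin structure of the vertices, fixed values of the
external spin indices, traces and signs of fermion loops). -/
structure Spin (G : FeynmanGraph V I) where
  γ : Fin 4 → Matrix (Fin 4) (Fin 4) ℂ
  clifford : IsDiracGamma γ
  mass : I → ℝ
  mom : I → Fin 3 → ℝ
  vert : G.SpinIndex → ℂ

/-- The numerator `m + i k γ⁰ - 𝐤·𝛄` of the propagator of the fermionic line `i`. -/
def diracNumerator {G : FeynmanGraph V I} (s : G.Spin) (i : I) (k : ℝ) :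
    Matrix (Fin 4) (Fin 4) ℂ :=
  (s.mass i : ℂ) • 1 + (Complex.I * k) • s.γ 0 - ∑ j : Fin 3, (s.mom i j : ℂ) • s.γ j.succ

/-- The propagator of line `i` at energy `k`, with kinematic energy `E`: `1 / (k² + E²)` for a
scalar line, the entry of `(m + i k γ⁰ - 𝐤·𝛄) / (k² + E²)` selected by `σ` for a fermionic one. -/
def propagator {G : FeynmanGraph V I} (s : G.Spin) (σ : G.SpinIndex) (i : I) (k E : ℝ) : ℂ :=
  (if h : G.fermionic i then diracNumerator s i k (σ ⟨i, h⟩).1 (σ ⟨i, h⟩).2 else 1) /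
    ((k : ℂ) ^ 2 + (E : ℂ) ^ 2)

/-- The product of all propagators, with the spinor indices contracted, times
`γ_E = ∏ 2 E_i`. -/
def integrand {G : FeynmanGraph V I} (s : G.Spin) (k E : I → ℝ) : ℂ :=
  (∏ i, 2 * (E i : ℂ)) * ∑ σ : G.SpinIndex, s.vert σ * ∏ i, propagator s σ i (k i) (E i)

/-! ### The Matsubara sum `D(p, E, T)` -/

/-- One term of the normalized Matsubara sum, including the generalized Kronecker delta. -/
def matsubaraTerm {G : FeynmanGraph V I} (s : G.Spin) (p : V → ℝ) (E : I → ℝ) (T : ℝ)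
    (n : I → ℤ) : ℂ :=
  if G.Conserves p (G.freq T n) then (T : ℂ) ^ G.loops * integrand s (G.freq T n) E else 0

/-- The sum in which every `n_i` runs from `-M` to `M`. -/
def matsubaraPartial {G : FeynmanGraph V I} (s : G.Spin) (p : V → ℝ) (E : I → ℝ) (T : ℝ)
    (M : ℕ) : ℂ :=
  ∑ n ∈ Fintype.piFinset fun _ : I => Finset.Icc (-(M : ℤ)) M, matsubaraTerm s p E T n

/-- The normalized Matsubara sum `D(p, E, T)`, every `n_i` running from `-∞` to `∞`. -/
def D {G : FeynmanGraph V I} (s : G.Spin) (p : V → ℝ) (E : I → ℝ) (T : ℝ) : ℂ :=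
  limUnder atTop (matsubaraPartial s p E T)

/-! ### The zero-temperature energy integral `D₀(ω, E)` -/

/-- The line energies for external energies `ω` when the independent loop energies, those of the
lines outside the spanning tree `t`, are `x`: the solution (unique when `∑ ω = 0`) of the
conservation equations that extends `x`. -/
def lineEnergies (G : FeynmanGraph V I) (t : Finset I) (ω : V → ℝ) (x : {i // i ∉ t} → ℝ) :
    I → ℝ :=
  Classical.epsilon fun k => G.Conserves ω k ∧ ∀ l : {i // i ∉ t}, k l = x l

/-- The integrand of the zero-temperature graph: `T ∑_n` is replaced by `∫ dk / 2π` for each of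
the independent loop energies. -/
def zeroTempIntegrand {G : FeynmanGraph V I} (s : G.Spin) (t : Finset I) (ω : V → ℝ)
    (E : I → ℝ) (x : {i // i ∉ t} → ℝ) : ℂ :=
  (1 / (2 * (Real.pi : ℂ))) ^ G.loops * integrand s (G.lineEnergies t ω x) E

/-- The integral in which every independent loop energy runs from `-Λ` to `Λ`. -/
def zeroTempPartial {G : FeynmanGraph V I} (s : G.Spin) (t : Finset I) (ω : V → ℝ)
    (E : I → ℝ) (Λ : ℝ) : ℂ :=
  ∫ x in Set.Icc (fun _ : {i // i ∉ t} => -Λ) (fun _ => Λ), zeroTempIntegrand s t ω E x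

/-- The normalized zero-temperature Euclidean energy integral `D₀(ω, E)`, for `E > 0`. -/
def D₀ {G : FeynmanGraph V I} (s : G.Spin) (t : Finset I) (ω : V → ℝ) (E : I → ℝ) : ℂ :=
  limUnder atTop (zeroTempPartial s t ω E)

/-- Absolute convergence of the zero-temperature energy integral. -/
def ZeroTempIntegrable {G : FeynmanGraph V I} (s : G.Spin) (t : Finset I) (ω : V → ℝ)
    (E : I → ℝ) : Prop :=
  Integrable (zeroTempIntegrand s t ω E) volume

end FeynmanGraph

/-! ### Rational functions of the kinematic energies -/

/-- The function on `ℝ^I` given by the quotient `P / Q` (meaningful where `Q` does not vanish). -/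
def ratEval {I : Type*} (P Q : MvPolynomial I ℂ) (E : I → ℝ) : ℂ :=
  MvPolynomial.eval (fun i => (E i : ℂ)) P / MvPolynomial.eval (fun i => (E i : ℂ)) Q

/-- The rational function `P / Q` has no poles at positive `E`, and equals `f` there. As a rational
function it is then determined by `f`; it extends `f` to energies of either sign. -/
def IsRationalExtension {I : Type*} (f : (I → ℝ) → ℂ) (P Q : MvPolynomial I ℂ) : Prop :=
  ∀ E : I → ℝ, (∀ i, 0 < E i) →
    MvPolynomial.eval (fun i => (E i : ℂ)) Q ≠ 0 ∧ f E = ratEval P Q E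

open scoped Classical in
/-- The energies at which none of the functions obtained from `P / Q` by reflecting some of the
energies has a vanishing denominator. -/
def regularSet {I : Type*} (Q : MvPolynomial I ℂ) : Set (I → ℝ) :=
  {E | ∀ B : Finset I,
    MvPolynomial.eval (fun i => ((if i ∈ B then -E i else E i : ℝ) : ℂ)) Q ≠ 0}

/-! ### The thermal operator -/

open scoped Classical in
/-- The reflection operator `(S_i f)(E) = f(E_1, …, -E_i, …)`. -/
def reflection {I : Type*} (i : I) : Module.End ℂ ((I → ℝ) → ℂ) :=
  LinearMap.funLeft ℂ ℂ fun E => Function.update E i (-E i)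

theorem reflection_commute {I : Type*} (i j : I) :
    Commute (1 + reflection i) (1 + reflection j) := by
  have h : Commute (reflection i) (reflection j) := by
    classical
    refine LinearMap.ext fun f => funext fun E => ?_
    simp only [reflection, Module.End.mul_apply, LinearMap.funLeft_apply]
    congr 1
    funext l
    by_cases hij : i = j
    · subst hij; rfl
    · by_cases hi : l = i <;> by_cases hj : l = j <;>
        simp_all [Function.update_apply, eq_comm]
  exact ((Commute.one_left _).add_left ((Commute.one_right _).add_right h))

namespace FeynmanGraph

open scoped Classical

variable {V I : Type*} [Fintype V] [Fintype I]

/-- The signed thermal occupation factor `N_i` of line `i`: Bose-Einstein for a scalar line, minus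
Fermi-Dirac for a fermionic one (with `β = 1 / T`). -/
def occupation (G : FeynmanGraph V I) (T : ℝ) (i : I) (E : ℝ) : ℝ :=
  if G.fermionic i then -(1 / (Real.exp (E / T) + 1)) else 1 / (Real.exp (E / T) - 1)

/-- The operator `∏_{i ∈ A} N_i (1 + S_i)`, all the occupation factors `N_i = N(E_i)` standing to
the left of all the reflections. -/
def thermalTerm (G : FeynmanGraph V I) (T : ℝ) (A : Finset I) :
    Module.End ℂ ((I → ℝ) → ℂ) :=
  LinearMap.mulLeft ℂ (fun E : I → ℝ => ∏ i ∈ A, (G.occupation T i (E i) : ℂ)) *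
    A.noncommProd (fun i => 1 + reflection i) fun i _ j _ _ => reflection_commute i j

/-- The thermal operator: the sum over the sets of at most `L` internal lines that can be snipped
without disconnecting the graph (the empty set contributes `1`). -/
def thermalOperator (G : FeynmanGraph V I) (T : ℝ) : Module.End ℂ ((I → ℝ) → ℂ) :=
  ∑ A : Finset I with A.card ≤ G.loops ∧ (G.snip A).Connected, G.thermalTerm T A

/-- The variant of the thermal operator in which the sum over single lines is unrestricted, and
only the sums over sets of two and more lines are restricted. -/
def thermalOperator' (G : FeynmanGraph V I) (T : ℝ) : Module.End ℂ ((I → ℝ) → ℂ) :=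
  1 + ∑ i : I, G.thermalTerm T {i} +
    ∑ A : Finset I with 2 ≤ A.card ∧ A.card ≤ G.loops ∧ (G.snip A).Connected, G.thermalTerm T A

end FeynmanGraph

end

set_option linter.unusedSectionVars false

noncomputable section

namespace ThermalOperator

open scoped Classical

section

/-! ### Chain sums over orderings of the vertices -/

/-! Both sides are compared through old-fashioned (time-ordered) perturbation theory. Partial
fractions, `2E(a + ikb)/(k² + E²) = ∑_{ε=±1} ε(a + εbE)/(εE - ik)`, reduce everything to sums and
integrals over conserved `k` of a product of factors `1/z_i` with `z_i = ε_i E_i - i k_i`. For fixed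
signs the result is, up to powers of `T` or `2π`, a sum over orderings of the vertices. An ordering
contributes the product of the inverse vertex energies of its nonempty proper initial segments,
times one weight per line: `εx + 1/2` if the source precedes the target, `εx - 1/2` otherwise. The
temperature enters only through `x`, which is `1/2 + N_i(E_i)` at finite temperature and `1/2` at
zero temperature. So the two amplitudes are values of one function, `signedSum`.

This formula is proved line by line. On a spanning tree nothing is integrated, and the chain sum is
just the product of the `1/z_i` (`GrownTree.pairTop_eq`). A further line is added by
`integral_addLine`. The identity `pairTop_star` eliminates the vertices away from the line until
only its two ends remain; what is left is the integral of `1/(z(Y - z))`. It equals `τ Y⁻¹(χ(z) +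
χ(Y - z))`, with `χ = coth(·/2T)/2` for the Matsubara sum and half the sign of the real part for the
integral. To bring the result into the form of a chain sum with one more line, the weights of each
cut must satisfy the addition theorem of `χ` (`CutLaw`).

The operator then comes from algebra. In every ordering a line contributes exactly one of its two
weights, so the chain sum is multilinear in the pairs of weights. The pair for `ε(1/2 + N)` is the
pair for `ε/2` plus `N` times the difference of the pairs for `ε/2` and `-ε/2`, and exchanging these
two is, up to sign, the reflection of `E_i`. Multilinear expansion gives the thermal operator summed
over all sets `A` (`signedSum_half_add`). If removing `A` disconnects the graph, the lines joining
two parts all carry the difference pair `(ε, ε)`, which does not see the ordering; the chain sum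
then factorizes and vanishes by energy conservation (`sum_flip_eq_zero`). The bound by `L` is
automatic for the other `A`.

At `x = 1/2` one of the two orders of each line has weight zero, and the surviving denominators are
sums of the energies of the cut lines minus `i` times an external energy. Hence the zero-temperature
amplitude is rational without poles at positive energies (`signedSum_half`, `rationalOn_oldSum`).

All this is done at generic energies, where no combination with coefficients `0, ±1` vanishes;
density and dominated convergence give the rest. Absolute convergence over the lines that are not
self-loops follows by comparing spanning trees (`prod_le_sum_prod_rpow`). The energies of self-loops
are unconstrained and factor out of every box; for Dirac lines they converge only in the symmetric
sense. -/

/-- The sum, over all orderings of `U`, of the product of the inverses of `Y` at all nonempty initial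
segments and of the weights `w T v` of putting `v` right after the initial segment `T`. -/
def chain {V : Type*} (Y : Finset V → ℂ) (w : Finset V → V → ℂ) (U : Finset V) : ℂ :=
  if U = ∅ then 1 else (Y U)⁻¹ * ∑ v ∈ U.attach, chain Y w (U.erase v) * w (U.erase v) v
termination_by U.card
decreasing_by exact Finset.card_erase_lt_of_mem v.2

/-- The chain sum in which the inverse of `Y` at the total set is left out. -/
def topChain {V : Type*} (Y : Finset V → ℂ) (w : Finset V → V → ℂ) (U : Finset V) : ℂ :=
  ∑ v ∈ U, chain Y w (U.erase v) * w (U.erase v) v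

variable {V : Type*}

@[simp] lemma chain_empty (Y : Finset V → ℂ) (w : Finset V → V → ℂ) : chain Y w ∅ = 1 := by
  rw [chain]; simp

lemma chain_of_nonempty (Y : Finset V → ℂ) (w : Finset V → V → ℂ) {U : Finset V}
    (hU : U.Nonempty) : chain Y w U = (Y U)⁻¹ * topChain Y w U := by
  rw [chain, if_neg hU.ne_empty, topChain, ← Finset.sum_attach U]

lemma topChain_eq_mul_chain {Y : Finset V → ℂ} (w : Finset V → V → ℂ) {U : Finset V}
    (hU : U.Nonempty) (hY : Y U ≠ 0) : topChain Y w U = Y U * chain Y w U := by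
  rw [chain_of_nonempty _ _ hU, mul_inv_cancel_left₀ hY]

lemma chain_congr {Y Y' : Finset V → ℂ} {w w' : Finset V → V → ℂ} (U : Finset V)
    (hY : ∀ T ⊆ U, T.Nonempty → Y T = Y' T)
    (hw : ∀ T ⊆ U, ∀ v ∈ U, v ∉ T → w T v = w' T v) : chain Y w U = chain Y' w' U := by
  induction U using Finset.strongInduction with
  | H U ih =>
    rcases U.eq_empty_or_nonempty with rfl | hU
    · simp
    · rw [chain_of_nonempty _ _ hU, chain_of_nonempty _ _ hU, hY U subset_rfl hU, topChain, topChain]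
      congr 1
      refine Finset.sum_congr rfl fun v hv => ?_
      have hs : U.erase v ⊆ U := Finset.erase_subset _ _
      rw [ih _ (Finset.erase_ssubset hv) (fun T hT => hY T (hT.trans hs))
        (fun T hT u hu => hw T (hT.trans hs) u (hs hu)),
        hw _ hs v hv (Finset.notMem_erase _ _)]

lemma topChain_congr {Y Y' : Finset V → ℂ} {w w' : Finset V → V → ℂ} (U : Finset V)
    (hY : ∀ T ⊂ U, T.Nonempty → Y T = Y' T)
    (hw : ∀ T ⊆ U, ∀ v ∈ U, v ∉ T → w T v = w' T v) : topChain Y w U = topChain Y' w' U := by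
  refine Finset.sum_congr rfl fun v hv => ?_
  have hs : U.erase v ⊆ U := Finset.erase_subset _ _
  rw [chain_congr _ (fun T hT => hY T (hT.trans_ssubset (Finset.erase_ssubset hv)))
        (fun T hT u hu => hw T (hT.trans hs) u (hs hu)),
        hw _ hs v hv (Finset.notMem_erase _ _)]

/-! ### Additive vertex energies: elimination of a vertex and factorization. -/

/-- The sum of the vertex energies over a set of vertices. -/
def total (y : V → ℂ) (U : Finset V) : ℂ := ∑ v ∈ U, y v

/-- The weight of putting `v` after all of `U`, for the weight `φ u v` of putting `v` after `u`. -/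
def pairWeight (φ : V → V → ℂ) (U : Finset V) (v : V) : ℂ := ∏ u ∈ U, φ u v

/-- The vertex energies after contracting `v` into `u`. -/
def contractEnergy (y : V → ℂ) (v u : V) : V → ℂ := Function.update y u (y u + y v)

/-- The pair weights after contracting `v` into `u`. -/
def contractWeight (φ : V → V → ℂ) (v u p q : V) : ℂ :=
  if p = u then φ u q * φ v q else if q = u then φ p u * φ p v else φ p q

lemma total_contract_of_mem (y : V → ℂ) {v u : V} {T : Finset V} (hu : u ∈ T) (hv : v ∉ T) :
    total (contractEnergy y v u) T = total y (insert v T) := by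
  rw [total, total, Finset.sum_insert hv, contractEnergy, Finset.sum_update_of_mem hu,
    ← Finset.add_sum_erase T y hu, Finset.sdiff_singleton_eq_erase]
  ring

lemma total_contract_of_notMem (y : V → ℂ) {v u : V} {T : Finset V} (hu : u ∉ T) :
    total (contractEnergy y v u) T = total y T := by
  refine Finset.sum_congr rfl fun x hx => ?_
  rw [contractEnergy, Function.update_of_ne]
  rintro rfl; exact hu hx

lemma pairWeight_contract_self (φ : V → V → ℂ) {v u : V} {T : Finset V} (hu : u ∉ T) :
    pairWeight (contractWeight φ v u) T u = pairWeight φ T u * pairWeight φ T v := by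
  simp only [pairWeight, ← Finset.prod_mul_distrib]
  refine Finset.prod_congr rfl fun p hp => ?_
  have : p ≠ u := by rintro rfl; exact hu hp
  simp [contractWeight, this]

lemma pairWeight_contract_of_mem (φ : V → V → ℂ) {v u q : V} {T : Finset V} (hu : u ∈ T)
    (hq : q ≠ u) :
    pairWeight (contractWeight φ v u) T q = pairWeight φ T q * φ v q := by
  simp only [pairWeight]
  rw [← Finset.mul_prod_erase T _ hu, ← Finset.mul_prod_erase T (fun x => φ x q) hu]
  have : ∏ x ∈ T.erase u, contractWeight φ v u x q = ∏ x ∈ T.erase u, φ x q := by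
    refine Finset.prod_congr rfl fun p hp => ?_
    simp [contractWeight, Finset.ne_of_mem_erase hp, hq]
  rw [this]
  simp [contractWeight]; ring

lemma pairWeight_contract_of_notMem (φ : V → V → ℂ) {v u q : V} {T : Finset V} (hu : u ∉ T)
    (hq : q ≠ u) :
    pairWeight (contractWeight φ v u) T q = pairWeight φ T q := by
  refine Finset.prod_congr rfl fun p hp => ?_
  have : p ≠ u := by rintro rfl; exact hu hp
  simp [contractWeight, this, hq]

/-- The chain sum for additive energies and pair weights. -/
abbrev pairChain (y : V → ℂ) (φ : V → V → ℂ) : Finset V → ℂ := chain (total y) (pairWeight φ)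

/-- The chain sum for additive energies and pair weights, without the total energy. -/
abbrev pairTop (y : V → ℂ) (φ : V → V → ℂ) : Finset V → ℂ := topChain (total y) (pairWeight φ)

lemma pairTop_congr {y y' : V → ℂ} {φ φ' : V → V → ℂ} {U : Finset V}
    (hy : ∀ v ∈ U, y v = y' v) (hφ : ∀ u ∈ U, ∀ v ∈ U, u ≠ v → φ u v = φ' u v) :
    pairTop y φ U = pairTop y' φ' U := by
  refine topChain_congr U (fun T hT _ => ?_) (fun T hT v hv hvT => ?_)
  · exact Finset.sum_congr rfl fun v hv => hy v (hT.1 hv)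
  · refine Finset.prod_congr rfl fun u hu => hφ u (hT hu) v hv ?_
    rintro rfl; exact hvT hu

lemma pairChain_contract_of_notMem (y : V → ℂ) (φ : V → V → ℂ) {v u : V} {U : Finset V}
    (hu : u ∉ U) :
    pairChain (contractEnergy y v u) (contractWeight φ v u) U = pairChain y φ U := by
  refine chain_congr U (fun T hT _ => total_contract_of_notMem y fun h => hu (hT h))
    (fun T hT q hq _ => pairWeight_contract_of_notMem φ (fun h => hu (hT h)) ?_)
  rintro rfl; exact hu hq

/-- Both sides are split by the vertex that comes last. On the left, either `v` is last, or some `u`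
is and `ih` eliminates `v` from what precedes it. On the right, the merged vertex is last or not.
The terms in which it is not match after an exchange of summations; the others match after writing
`φ v u = (φ v u - φ u v) + φ u v`. -/
lemma star_step (y : V → ℂ) (φ : V → V → ℂ) (v : V) (U : Finset V) (hv : v ∉ U)
    (ih : ∀ u ∈ U, y v * pairChain y φ (insert v (U.erase u)) =
      ∑ x ∈ U.erase u, (φ v x - φ x v) *
          pairChain (contractEnergy y v x) (contractWeight φ v x) (U.erase u) +
        pairWeight φ (U.erase u) v * pairChain y φ (U.erase u)) :
    y v * pairTop y φ (insert v U) =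
      ∑ u ∈ U, (φ v u - φ u v) * pairTop (contractEnergy y v u) (contractWeight φ v u) U +
        pairWeight φ U v * (pairTop y φ U + y v * pairChain y φ U) := by
  have h1 : ∀ u ∈ U, pairTop (contractEnergy y v u) (contractWeight φ v u) U =
      pairChain y φ (U.erase u) * (pairWeight φ (U.erase u) u * pairWeight φ (U.erase u) v) +
      ∑ x ∈ U.erase u, pairChain (contractEnergy y v u) (contractWeight φ v u) (U.erase x) *
        (pairWeight φ (U.erase x) x * φ v x) := by
    intro u hu
    rw [pairTop, topChain, ← Finset.add_sum_erase U _ hu,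
      pairWeight_contract_self φ (Finset.notMem_erase u U)]
    rw [← pairChain, pairChain_contract_of_notMem y φ (Finset.notMem_erase u U)]
    congr 1
    refine Finset.sum_congr rfl fun x hx => ?_
    rw [pairWeight_contract_of_mem φ (Finset.mem_erase.2 ⟨(Finset.ne_of_mem_erase hx).symm, hu⟩)
      (Finset.ne_of_mem_erase hx)]
  have h2 : ∀ u ∈ U, y v * (pairChain y φ ((insert v U).erase u) *
      pairWeight φ ((insert v U).erase u) u) =
      (∑ x ∈ U.erase u, (φ v x - φ x v) *
          pairChain (contractEnergy y v x) (contractWeight φ v x) (U.erase u) *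
            (pairWeight φ (U.erase u) u * φ v u)) +
        pairWeight φ (U.erase u) v * pairChain y φ (U.erase u) *
          (pairWeight φ (U.erase u) u * φ v u) := by
    intro u hu
    have hne : v ≠ u := by rintro rfl; exact hv hu
    have hvu : v ∉ U.erase u := fun h => hv (Finset.mem_of_mem_erase h)
    have hW : pairWeight φ (insert v (U.erase u)) u = φ v u * pairWeight φ (U.erase u) u :=
      Finset.prod_insert hvu
    rw [Finset.erase_insert_of_ne hne, ← mul_assoc, ih u hu, hW, add_mul, Finset.sum_mul]
    congr 1
    · exact Finset.sum_congr rfl fun x _ => by ring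
    · ring
  have h3 : ∀ u ∈ U, pairWeight φ U v = φ u v * pairWeight φ (U.erase u) v := fun u hu =>
    (Finset.mul_prod_erase U (fun x => φ x v) hu).symm
  have h4 : ∑ u ∈ U, ∑ x ∈ U.erase u, (φ v x - φ x v) *
          pairChain (contractEnergy y v x) (contractWeight φ v x) (U.erase u) *
            (pairWeight φ (U.erase u) u * φ v u) =
      ∑ u ∈ U, ∑ x ∈ U.erase u, (φ v u - φ u v) *
          pairChain (contractEnergy y v u) (contractWeight φ v u) (U.erase x) *
            (pairWeight φ (U.erase x) x * φ v x) := by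
    refine Finset.sum_comm' fun a b => ?_
    simp only [Finset.mem_erase]
    tauto
  have h5 : pairWeight φ U v * pairTop y φ U =
      ∑ u ∈ U, φ u v * pairWeight φ (U.erase u) v * (pairChain y φ (U.erase u) *
        pairWeight φ (U.erase u) u) := by
    rw [pairTop, topChain, Finset.mul_sum]
    exact Finset.sum_congr rfl fun u hu => by rw [h3 u hu]
  have h6 : ∑ u ∈ U, pairWeight φ (U.erase u) v * pairChain y φ (U.erase u) *
          (pairWeight φ (U.erase u) u * φ v u) =
      ∑ u ∈ U, (φ v u - φ u v) * (pairChain y φ (U.erase u) *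
        (pairWeight φ (U.erase u) u * pairWeight φ (U.erase u) v)) +
      ∑ u ∈ U, φ u v * pairWeight φ (U.erase u) v * (pairChain y φ (U.erase u) *
        pairWeight φ (U.erase u) u) := by
    rw [← Finset.sum_add_distrib]
    exact Finset.sum_congr rfl fun u _ => by ring
  have h7 : ∑ u ∈ U, (φ v u - φ u v) * pairTop (contractEnergy y v u) (contractWeight φ v u) U =
      ∑ u ∈ U, (φ v u - φ u v) * (pairChain y φ (U.erase u) *
        (pairWeight φ (U.erase u) u * pairWeight φ (U.erase u) v)) +
      ∑ u ∈ U, ∑ x ∈ U.erase u, (φ v u - φ u v) *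
          pairChain (contractEnergy y v u) (contractWeight φ v u) (U.erase x) *
            (pairWeight φ (U.erase x) x * φ v x) := by
    rw [← Finset.sum_add_distrib]
    refine Finset.sum_congr rfl fun u hu => ?_
    rw [h1 u hu, mul_add, Finset.mul_sum]
    congr 1
    exact Finset.sum_congr rfl fun x _ => by ring
  have h8 : y v * pairTop y φ (insert v U) = y v * (pairChain y φ U * pairWeight φ U v) +
      ∑ u ∈ U, y v * (pairChain y φ ((insert v U).erase u) *
        pairWeight φ ((insert v U).erase u) u) := by
    rw [pairTop, topChain, Finset.sum_insert hv, Finset.erase_insert hv, mul_add, Finset.mul_sum]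
  rw [mul_add, h5, h7, h8, Finset.sum_congr rfl h2, Finset.sum_add_distrib, h4, h6]
  ring

/-- This is `star_step` divided by the total energy of `insert v U`: contraction preserves that
total, and the two leftover terms combine because it equals `y v + total y U`. -/
lemma chain_star (y : V → ℂ) (φ : V → V → ℂ) (v : V) (U : Finset V) (hv : v ∉ U)
    (hY : ∀ T ⊆ insert v U, T.Nonempty → total y T ≠ 0) :
    y v * pairChain y φ (insert v U) =
      ∑ u ∈ U, (φ v u - φ u v) * pairChain (contractEnergy y v u) (contractWeight φ v u) U +
        pairWeight φ U v * pairChain y φ U := by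
  induction U using Finset.strongInduction with
  | H U ih =>
    have hstep := star_step y φ v U hv fun u hu => ih _ (Finset.erase_ssubset hu)
      (fun h => hv (Finset.mem_of_mem_erase h)) (fun T hT => hY T
        (hT.trans (Finset.insert_subset_insert _ (Finset.erase_subset _ _))))
    have hne : (insert v U).Nonempty := Finset.insert_nonempty _ _
    have hY0 := hY _ subset_rfl hne
    have htot : total y (insert v U) = y v + total y U := Finset.sum_insert hv
    rcases U.eq_empty_or_nonempty with rfl | hU
    · have : y v ≠ 0 := by simpa [total] using hY0
      rw [pairChain, chain_of_nonempty _ _ hne]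
      simp [topChain, total, pairWeight, this]
    · have e1 : pairTop y φ (insert v U) = _ := topChain_eq_mul_chain _ hne hY0
      have e2 : pairTop y φ U = _ :=
        topChain_eq_mul_chain _ hU (hY U (Finset.subset_insert _ _) hU)
      rw [e1, e2] at hstep
      have h1 : ∀ u ∈ U, pairTop (contractEnergy y v u) (contractWeight φ v u) U =
          total y (insert v U) * pairChain (contractEnergy y v u) (contractWeight φ v u) U := by
        intro u hu
        have := total_contract_of_mem y hu hv
        rw [← this, pairTop, topChain_eq_mul_chain _ hU (by rwa [this])]
      rw [Finset.sum_congr rfl fun u hu => by rw [h1 u hu]] at hstep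
      apply mul_left_cancel₀ hY0
      rw [mul_add, Finset.mul_sum]
      rw [mul_left_comm, hstep, htot]
      congr 1
      · exact Finset.sum_congr rfl fun u _ => by ring
      · rw [pairChain]; ring

/-- Elimination of the vertex `v` by contracting it into each of the other vertices. -/
lemma pairTop_star (y : V → ℂ) (φ : V → V → ℂ) (v : V) (U : Finset V) (hv : v ∉ U)
    (hU : U.Nonempty) (hY : ∀ T ⊂ insert v U, T.Nonempty → total y T ≠ 0)
    (h0 : total y (insert v U) = 0) :
    y v * pairTop y φ (insert v U) =
      ∑ u ∈ U, (φ v u - φ u v) * pairTop (contractEnergy y v u) (contractWeight φ v u) U := by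
  rw [star_step y φ v U hv fun u hu => chain_star y φ v _ (fun h => hv (Finset.mem_of_mem_erase h))
    fun T hT => hY T (hT.trans_ssubset ?_)]
  -- The leftover term of `star_step` carries the factor `total y U + y v`, which is the vanishing
  -- total energy.
  · rw [pairTop, topChain_eq_mul_chain _ hU (hY U (Finset.ssubset_insert hv) hU),
      ← pairChain]
    have htot : total y (insert v U) = y v + total y U := Finset.sum_insert hv
    rw [h0] at htot
    rw [← add_mul, add_comm (total y U), ← htot]
    simp
  · refine Finset.ssubset_iff_subset_ne.2
      ⟨Finset.insert_subset_insert _ (Finset.erase_subset _ _), fun h => ?_⟩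
    have : u ∈ insert v (U.erase u) := h ▸ Finset.mem_insert_of_mem hu
    rcases Finset.mem_insert.1 this with rfl | h'
    · exact hv hu
    · exact Finset.notMem_erase _ _ h'

/-- A Leibniz rule: the last vertex belongs to `A` or to `B`, and since `φ` is symmetric between the
two sets, the pairs joining them give the same factor however the two orderings are shuffled. -/
lemma union_step (y : V → ℂ) (φ : V → V → ℂ) (A B : Finset V) (hAB : Disjoint A B)
    (hφ : ∀ a ∈ A, ∀ b ∈ B, φ a b = φ b a)
    (ihA : ∀ v ∈ A, pairChain y φ (A.erase v ∪ B) =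
      pairChain y φ (A.erase v) * pairChain y φ B * ∏ a ∈ A.erase v, ∏ b ∈ B, φ a b)
    (ihB : ∀ v ∈ B, pairChain y φ (A ∪ B.erase v) =
      pairChain y φ A * pairChain y φ (B.erase v) * ∏ a ∈ A, ∏ b ∈ B.erase v, φ a b) :
    pairTop y φ (A ∪ B) = (pairTop y φ A * pairChain y φ B + pairChain y φ A * pairTop y φ B) *
      ∏ a ∈ A, ∏ b ∈ B, φ a b := by
  have hA : ∑ v ∈ A, pairChain y φ ((A ∪ B).erase v) * pairWeight φ ((A ∪ B).erase v) v =
      pairTop y φ A * pairChain y φ B * ∏ a ∈ A, ∏ b ∈ B, φ a b := by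
    rw [pairTop, topChain, Finset.sum_mul, Finset.sum_mul]
    refine Finset.sum_congr rfl fun v hv => ?_
    have hvB : v ∉ B := Finset.disjoint_left.1 hAB hv
    have e : (A ∪ B).erase v = A.erase v ∪ B := by
      rw [Finset.erase_union_distrib, Finset.erase_eq_of_notMem hvB]
    have hW : pairWeight φ (A.erase v ∪ B) v = pairWeight φ (A.erase v) v * ∏ b ∈ B, φ v b := by
      rw [pairWeight, Finset.prod_union (hAB.mono_left (Finset.erase_subset _ _)), pairWeight,
        Finset.prod_congr rfl fun b hb => (hφ v hv b hb).symm]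
    rw [e, ihA v hv, hW, ← Finset.mul_prod_erase A _ hv]
    ring
  have hB : ∑ v ∈ B, pairChain y φ ((A ∪ B).erase v) * pairWeight φ ((A ∪ B).erase v) v =
      pairChain y φ A * pairTop y φ B * ∏ a ∈ A, ∏ b ∈ B, φ a b := by
    rw [pairTop, topChain, Finset.mul_sum, Finset.sum_mul]
    refine Finset.sum_congr rfl fun v hv => ?_
    have hvA : v ∉ A := Finset.disjoint_right.1 hAB hv
    have e : (A ∪ B).erase v = A ∪ B.erase v := by
      rw [Finset.erase_union_distrib, Finset.erase_eq_of_notMem hvA]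
    have hW : pairWeight φ (A ∪ B.erase v) v = (∏ a ∈ A, φ a v) * pairWeight φ (B.erase v) v := by
      rw [pairWeight, Finset.prod_union (hAB.mono_right (Finset.erase_subset _ _)), pairWeight]
    have hP : ∏ a ∈ A, ∏ b ∈ B, φ a b = (∏ a ∈ A, φ a v) * ∏ a ∈ A, ∏ b ∈ B.erase v, φ a b := by
      rw [← Finset.prod_mul_distrib]
      exact Finset.prod_congr rfl fun a _ => (Finset.mul_prod_erase B _ hv).symm
    rw [e, ihB v hv, hW, hP]
    ring
  rw [pairTop, topChain, Finset.sum_union hAB, hA, hB, ← add_mul]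

/-- Chain sums factorize over sets between which the weights are symmetric. -/
lemma chain_union (y : V → ℂ) (φ : V → V → ℂ) (n : ℕ) : ∀ A B : Finset V, A.card + B.card = n →
    Disjoint A B → (∀ a ∈ A, ∀ b ∈ B, φ a b = φ b a) →
    (∀ T ⊆ A ∪ B, T.Nonempty → total y T ≠ 0) →
    pairChain y φ (A ∪ B) = pairChain y φ A * pairChain y φ B * ∏ a ∈ A, ∏ b ∈ B, φ a b := by
  induction n with
  | zero =>
    intro A B h _ _ _
    obtain rfl : A = ∅ := Finset.card_eq_zero.1 (by omega)
    obtain rfl : B = ∅ := Finset.card_eq_zero.1 (by omega)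
    simp
  | succ n ih =>
    intro A B hn hAB hφ hY
    rcases A.eq_empty_or_nonempty with rfl | hA
    · simp
    rcases B.eq_empty_or_nonempty with rfl | hB
    · simp
    have h := union_step y φ A B hAB hφ
      (fun v hv => ih _ _ (by have := Finset.card_erase_add_one hv; omega)
        (hAB.mono_left (Finset.erase_subset _ _))
        (fun a ha => hφ a (Finset.mem_of_mem_erase ha))
        (fun T hT => hY T (hT.trans (Finset.union_subset_union_left (Finset.erase_subset _ _)))))
      (fun v hv => ih _ _ (by have := Finset.card_erase_add_one hv; omega)
        (hAB.mono_right (Finset.erase_subset _ _))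
        (fun a ha b hb => hφ a ha b (Finset.mem_of_mem_erase hb))
        (fun T hT => hY T (hT.trans (Finset.union_subset_union_right (Finset.erase_subset _ _)))))
    have hU : (A ∪ B).Nonempty := hA.mono Finset.subset_union_left
    have hY0 := hY _ subset_rfl hU
    have e : pairTop y φ (A ∪ B) = _ := topChain_eq_mul_chain _ hU hY0
    have eA : pairTop y φ A = _ := topChain_eq_mul_chain _ hA (hY A Finset.subset_union_left hA)
    have eB : pairTop y φ B = _ := topChain_eq_mul_chain _ hB (hY B Finset.subset_union_right hB)
    -- The two Leibniz terms add up to the total energy of `A ∪ B` times the product, and this total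
    -- cancels the outermost denominator.
    have ht : total y (A ∪ B) = total y A + total y B := Finset.sum_union hAB
    rw [e, eA, eB] at h
    apply mul_left_cancel₀ hY0
    rw [pairChain, h, ht]
    ring

/-- Every proper subset factorizes, so `union_step` leaves the factor `total y A + total y B`, which
is zero. This removes the disconnecting sets of lines from the thermal operator. -/
lemma pairTop_union_eq_zero (y : V → ℂ) (φ : V → V → ℂ) (A B : Finset V) (hAB : Disjoint A B)
    (hA : A.Nonempty) (hB : B.Nonempty)
    (hφ : ∀ a ∈ A, ∀ b ∈ B, φ a b = φ b a)
    (hY : ∀ T ⊂ A ∪ B, T.Nonempty → total y T ≠ 0) (h0 : total y (A ∪ B) = 0) :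
    pairTop y φ (A ∪ B) = 0 := by
  have sA : ∀ v ∈ A, A.erase v ∪ B ⊂ A ∪ B := fun v hv => by
    rw [← Finset.erase_eq_of_notMem (Finset.disjoint_left.1 hAB hv),
      ← Finset.erase_union_distrib, Finset.erase_eq_of_notMem (Finset.disjoint_left.1 hAB hv)]
    exact Finset.erase_ssubset (Finset.mem_union_left _ hv)
  have sB : ∀ v ∈ B, A ∪ B.erase v ⊂ A ∪ B := fun v hv => by
    rw [← Finset.erase_eq_of_notMem (Finset.disjoint_right.1 hAB hv),
      ← Finset.erase_union_distrib, Finset.erase_eq_of_notMem (Finset.disjoint_right.1 hAB hv)]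
    exact Finset.erase_ssubset (Finset.mem_union_right _ hv)
  have h := union_step y φ A B hAB hφ
      (fun v hv => chain_union y φ _ _ _ rfl (hAB.mono_left (Finset.erase_subset _ _))
        (fun a ha => hφ a (Finset.mem_of_mem_erase ha))
        (fun T hT => hY T (hT.trans_ssubset (sA v hv))))
      (fun v hv => chain_union y φ _ _ _ rfl (hAB.mono_right (Finset.erase_subset _ _))
        (fun a ha b hb => hφ a ha b (Finset.mem_of_mem_erase hb))
        (fun T hT => hY T (hT.trans_ssubset (sB v hv))))
  have eA : pairTop y φ A = _ := topChain_eq_mul_chain _ hA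
    (hY A (Finset.ssubset_iff_subset_ne.2 ⟨Finset.subset_union_left, fun h => ?_⟩) hA)
  have eB : pairTop y φ B = _ := topChain_eq_mul_chain _ hB
    (hY B (Finset.ssubset_iff_subset_ne.2 ⟨Finset.subset_union_right, fun h => ?_⟩) hB)
  · have ht : total y (A ∪ B) = total y A + total y B := Finset.sum_union hAB
    rw [h, eA, eB, show total y A * chain (total y) (pairWeight φ) A * pairChain y φ B +
      pairChain y φ A * (total y B * chain (total y) (pairWeight φ) B) =
      (total y A + total y B) * (pairChain y φ A * pairChain y φ B) by rw [pairChain]; ring,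
      ← ht, h0]
    simp
  · obtain ⟨a, ha⟩ := hA
    exact Finset.disjoint_left.1 hAB ha (h ▸ Finset.mem_union_left _ ha)
  · obtain ⟨b, hb⟩ := hB
    exact Finset.disjoint_right.1 hAB hb (h ▸ Finset.mem_union_right _ hb)

end

section

variable {V : Type*}

/-! ### Adding a line -/

/-- The change of the vertex energies caused by a line from `a` to `b` of unit energy. -/
def lineDir (a b : V) : V → ℂ := Pi.single a 1 - Pi.single b 1

/-- The pair weight of a single line from `a` to `b`. -/
def lineWeight (x : ℂ) (a b : V) (u w : V) : ℂ :=
  if u = a ∧ w = b then x + 1 / 2 else if u = b ∧ w = a then x - 1 / 2 else 1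

/-- The weight of putting all of `A` before all of `B`. -/
def cutWeight (φ : V → V → ℂ) (A B : Finset V) : ℂ := ∏ q ∈ B, pairWeight φ A q

lemma cutWeight_contract_left (φ : V → V → ℂ) {v u : V} {A B : Finset V} (hA : u ∈ A) (hB : u ∉ B)
    (hv : v ∉ A) : cutWeight (contractWeight φ v u) A B = cutWeight φ (insert v A) B := by
  refine Finset.prod_congr rfl fun q hq => ?_
  have hqu : q ≠ u := by rintro rfl; exact hB hq
  rw [pairWeight_contract_of_mem φ hA hqu, pairWeight, pairWeight, Finset.prod_insert hv, mul_comm]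

lemma cutWeight_contract_right (φ : V → V → ℂ) {v u : V} {A B : Finset V} (hA : u ∉ A) (hB : u ∈ B)
    (hv : v ∉ B) : cutWeight (contractWeight φ v u) A B = cutWeight φ A (insert v B) := by
  rw [cutWeight, cutWeight, Finset.prod_insert hv, ← Finset.mul_prod_erase B _ hB,
    ← Finset.mul_prod_erase B (pairWeight φ A) hB, pairWeight_contract_self φ hA,
    Finset.prod_congr rfl fun q hq =>
      pairWeight_contract_of_notMem φ hA (Finset.ne_of_mem_erase hq)]
  ring

lemma total_sub_smul (y d : V → ℂ) (z : ℂ) (T : Finset V) :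
    total (y - z • d) T = total y T - z * total d T := by
  simp [total, Finset.mul_sum]

lemma total_lineDir (a b : V) (T : Finset V) :
    total (lineDir a b) T = (if a ∈ T then 1 else 0) - (if b ∈ T then 1 else 0) := by
  simp [total, lineDir, Pi.single_apply]

lemma pairTop_pair (y : V → ℂ) (φ : V → V → ℂ) {a b : V} (hab : a ≠ b) (h0 : total y {a, b} = 0) :
    pairTop y φ {a, b} = (y a)⁻¹ * (φ a b - φ b a) := by
  have hb : y b = - y a := by
    rw [total, Finset.sum_pair hab] at h0
    linear_combination h0
  have e1 : ({a, b} : Finset V).erase a = {b} := by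
    ext v; simp only [Finset.mem_erase, Finset.mem_insert, Finset.mem_singleton]; grind
  have e2 : ({a, b} : Finset V).erase b = {a} := by
    ext v; simp only [Finset.mem_erase, Finset.mem_insert, Finset.mem_singleton]; grind
  rw [pairTop, topChain, Finset.sum_pair hab, e1, e2,
    chain_of_nonempty _ _ (Finset.singleton_nonempty a),
    chain_of_nonempty _ _ (Finset.singleton_nonempty b)]
  simp [topChain, total, pairWeight, hb]
  ring

lemma contractEnergy_sub_lineDir (y : V → ℂ) (z : ℂ) {a b v : V} (hva : v ≠ a) (hvb : v ≠ b)
    (u : V) : contractEnergy (y - z • lineDir a b) v u = contractEnergy y v u - z • lineDir a b := by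
  funext p
  by_cases hp : p = u
  · subst hp
    simp [contractEnergy, lineDir, hva, hvb]; ring
  · simp [contractEnergy, hp]

lemma lineWeight_of_ne_left (x : ℂ) {a b v : V} (hva : v ≠ a) (hvb : v ≠ b) (u : V) :
    lineWeight x a b v u = 1 := by simp [lineWeight, hva, hvb]

lemma lineWeight_of_ne_right (x : ℂ) {a b v : V} (hva : v ≠ a) (hvb : v ≠ b) (u : V) :
    lineWeight x a b u v = 1 := by simp [lineWeight, hva, hvb]

lemma contractWeight_mul_lineWeight (φ : V → V → ℂ) (x : ℂ) {a b v : V} (hva : v ≠ a)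
    (hvb : v ≠ b) (u : V) :
    contractWeight (φ * lineWeight x a b) v u = contractWeight φ v u * lineWeight x a b := by
  funext p q
  simp only [contractWeight, Pi.mul_apply, lineWeight_of_ne_left x hva hvb,
    lineWeight_of_ne_right x hva hvb]
  split_ifs with h1 h2
  · subst h1; ring
  · subst h2; ring
  · rfl

variable {X : Type*} [MeasurableSpace X]

/-- Integration over the energy of a line from `a` to `b`, assuming the corresponding statement for
all the cuts that separate `a` from `b`. -/
lemma integral_addLine (ν : Measure X) (z : X → ℂ) (τ x₁ : ℂ) {a b : V} (hab : a ≠ b) (n : ℕ) :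
    ∀ (W : Finset V) (y : V → ℂ) (φ : V → V → ℂ), W.card = n → a ∈ W → b ∈ W →
    total y W = 0 → (∀ T ⊂ W, T.Nonempty → total y T ≠ 0) →
    (∀ T ⊂ W, a ∈ T → b ∉ T → ∀ x, total y T ≠ z x) →
    (∀ T ⊂ W, a ∈ T → b ∉ T → Integrable (fun x => (z x * (total y T - z x))⁻¹) ν ∧
      (cutWeight φ T (W \ T) - cutWeight φ (W \ T) T) * ∫ x, (z x * (total y T - z x))⁻¹ ∂ν =
        τ * ((total y T)⁻¹ * (x₁ * (cutWeight φ T (W \ T) - cutWeight φ (W \ T) T) +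
          1 / 2 * (cutWeight φ T (W \ T) + cutWeight φ (W \ T) T)))) →
    Integrable (fun x => (z x)⁻¹ * pairTop (y - z x • lineDir a b) φ W) ν ∧
      ∫ x, (z x)⁻¹ * pairTop (y - z x • lineDir a b) φ W ∂ν =
        τ * pairTop y (φ * lineWeight x₁ a b) W := by
  induction n with
  | zero =>
    intro W y φ hW ha
    rw [Finset.card_eq_zero.1 hW] at ha
    simp at ha
  | succ n ih =>
    intro W y φ hW ha hb h0 h1 h2 h3
    have htot0 : ∀ x, total (y - z x • lineDir a b) W = 0 := fun x => by
      rw [total_sub_smul, total_lineDir, h0]; simp [ha, hb]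
    -- The line does not touch a vertex other than `a` and `b`, so eliminating such a vertex with
    -- `pairTop_star` commutes with inserting the line and with the integration.
    by_cases hex : ∃ v ∈ W, v ≠ a ∧ v ≠ b
    · obtain ⟨v, hvW, hva, hvb⟩ := hex
      obtain ⟨U, hvU, rfl⟩ : ∃ U, v ∉ U ∧ W = insert v U :=
        ⟨W.erase v, Finset.notMem_erase _ _, (Finset.insert_erase hvW).symm⟩
      have haU : a ∈ U := (Finset.mem_insert.1 ha).resolve_left hva.symm
      have hbU : b ∈ U := (Finset.mem_insert.1 hb).resolve_left hvb.symm
      have hU : U.Nonempty := ⟨a, haU⟩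
      have hyv : y v ≠ 0 := by
        have := h1 {v} (Finset.ssubset_iff_subset_ne.2 ⟨by simp, fun h => ?_⟩) (by simp)
        · simpa [total] using this
        · have : a ∈ ({v} : Finset V) := h ▸ ha
          exact hva (Finset.mem_singleton.1 this).symm
      have hssub : ∀ T ⊂ U, T ⊂ insert v U := fun T hT => hT.trans (Finset.ssubset_insert hvU)
      have hinsert : ∀ T ⊂ U, insert v T ⊂ insert v U := fun T hT => by
        obtain ⟨u, hu, huT⟩ := Finset.exists_of_ssubset hT
        refine (Finset.ssubset_iff_of_subset (Finset.insert_subset_insert _ hT.1)).2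
          ⟨u, Finset.mem_insert_of_mem hu, ?_⟩
        simp only [Finset.mem_insert, not_or]
        exact ⟨by rintro rfl; exact hvU hu, huT⟩
      -- the hypotheses for the contracted data
      have key : ∀ u ∈ U, Integrable (fun x => (z x)⁻¹ * pairTop
            (contractEnergy y v u - z x • lineDir a b) (contractWeight φ v u) U) ν ∧
          ∫ x, (z x)⁻¹ * pairTop (contractEnergy y v u - z x • lineDir a b)
            (contractWeight φ v u) U ∂ν =
          τ * pairTop (contractEnergy y v u) (contractWeight φ v u * lineWeight x₁ a b) U := by
        intro u hu
        -- Cuts of the contracted vertex set are the cuts of the original one that keep `v` on the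
        -- side of `u`, with the same total energies and weights. So the hypotheses on cuts are
        -- inherited.
        have hcase : ∀ T ⊂ U, ∃ T' ⊂ insert v U, total (contractEnergy y v u) T = total y T' ∧
            (a ∈ T' ↔ a ∈ T) ∧ (b ∈ T' ↔ b ∈ T) ∧ (T.Nonempty → T'.Nonempty) ∧
            cutWeight (contractWeight φ v u) T (U \ T) = cutWeight φ T' (insert v U \ T') ∧
            cutWeight (contractWeight φ v u) (U \ T) T = cutWeight φ (insert v U \ T') T' := by
          intro T hT
          have hvT : v ∉ T := fun h => hvU (hT.1 h)
          have hvUT : v ∉ U \ T := fun h => hvU (Finset.mem_sdiff.1 h).1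
          by_cases huT : u ∈ T
          · have hu' : u ∉ U \ T := fun h => (Finset.mem_sdiff.1 h).2 huT
            have e : insert v U \ insert v T = U \ T := by
              ext p; simp only [Finset.mem_sdiff, Finset.mem_insert]; grind
            refine ⟨insert v T, hinsert T hT, total_contract_of_mem y huT hvT,
              by simp [hva.symm], by simp [hvb.symm], fun _ => Finset.insert_nonempty _ _, ?_, ?_⟩
            · rw [cutWeight_contract_left φ huT hu' hvT, e]
            · rw [cutWeight_contract_right φ hu' huT hvT, e]
          · have hu' : u ∈ U \ T := Finset.mem_sdiff.2 ⟨hu, huT⟩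
            have e : insert v U \ T = insert v (U \ T) := by
              ext p; simp only [Finset.mem_sdiff, Finset.mem_insert]; grind
            refine ⟨T, hssub T hT, total_contract_of_notMem y huT, Iff.rfl, Iff.rfl, id, ?_, ?_⟩
            · rw [cutWeight_contract_right φ huT hu' hvUT, e]
            · rw [cutWeight_contract_left φ hu' huT hvUT, e]
        apply ih U _ _ (by rw [Finset.card_insert_of_notMem hvU] at hW; omega) haU hbU
        · rw [total_contract_of_mem y hu hvU, h0]
        · intro T hT hTn
          obtain ⟨T', hT', e, -, -, hn, -, -⟩ := hcase T hT
          rw [e]; exact h1 T' hT' (hn hTn)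
        · intro T hT haT hbT
          obtain ⟨T', hT', e, ea, eb, -, -, -⟩ := hcase T hT
          rw [e]; exact h2 T' hT' (ea.2 haT) (fun h => hbT (eb.1 h))
        · intro T hT haT hbT
          obtain ⟨T', hT', e, ea, eb, -, e1, e2⟩ := hcase T hT
          rw [e, e1, e2]; exact h3 T' hT' (ea.2 haT) (fun h => hbT (eb.1 h))
      have hstar : ∀ x, (z x)⁻¹ * pairTop (y - z x • lineDir a b) φ (insert v U) =
          ∑ u ∈ U, ((y v)⁻¹ * (φ v u - φ u v)) * ((z x)⁻¹ * pairTop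
            (contractEnergy y v u - z x • lineDir a b) (contractWeight φ v u) U) := by
        intro x
        have hyv' : (y - z x • lineDir a b) v = y v := by simp [lineDir, hva, hvb]
        have h := pairTop_star (y - z x • lineDir a b) φ v U hvU hU (fun T hT hTn => ?_) (htot0 x)
        · rw [hyv'] at h
          rw [(eq_inv_mul_iff_mul_eq₀ hyv).2 h, Finset.mul_sum, Finset.mul_sum]
          refine Finset.sum_congr rfl fun u _ => ?_
          rw [contractEnergy_sub_lineDir y (z x) hva hvb]
          ring
        · rw [total_sub_smul, total_lineDir]
          by_cases haT : a ∈ T <;> by_cases hbT : b ∈ T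
          · simpa [haT, hbT] using h1 T hT hTn
          · simpa [haT, hbT, sub_eq_zero] using h2 T hT haT hbT x
          -- The hypothesis only speaks of cuts with `a` inside; the complement has the opposite
          -- energy, because the total is zero.
          · have hc := h2 (insert v U \ T) ?_ (Finset.mem_sdiff.2 ⟨ha, haT⟩)
              (fun h => (Finset.mem_sdiff.1 h).2 hbT) x
            · have hs : total y (insert v U \ T) + total y T = total y (insert v U) :=
                Finset.sum_sdiff hT.1
              rw [h0] at hs
              intro h
              simp only [haT, hbT, if_true, if_false] at h
              exact hc (by linear_combination hs - h)
            · exact Finset.sdiff_ssubset hT.1 hTn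
          · simpa [haT, hbT] using h1 T hT hTn
      have hR := pairTop_star y (φ * lineWeight x₁ a b) v U hvU hU h1 h0
      simp only [hstar]
      refine ⟨integrable_finsetSum _ fun u hu => (key u hu).1.const_mul _, ?_⟩
      rw [integral_finsetSum _ fun u hu => (key u hu).1.const_mul _,
        (eq_inv_mul_iff_mul_eq₀ hyv).2 hR, Finset.mul_sum, Finset.mul_sum]
      refine Finset.sum_congr rfl fun u hu => ?_
      rw [integral_const_mul, (key u hu).2, contractWeight_mul_lineWeight φ x₁ hva hvb]
      simp only [Pi.mul_apply, lineWeight_of_ne_left x₁ hva hvb, lineWeight_of_ne_right x₁ hva hvb]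
      ring
    -- With only `a` and `b` left, the chain sum is `(y a)⁻¹ (φ a b - φ b a)`, and the claim is the
    -- hypothesis for the cut `{a}`.
    · push Not at hex
      obtain rfl : W = {a, b} := by
        ext v
        simp only [Finset.mem_insert, Finset.mem_singleton]
        refine ⟨fun hv => ?_, ?_⟩
        · by_cases h : v = a
          · exact Or.inl h
          · exact Or.inr (hex v hv h)
        · rintro (rfl | rfl) <;> assumption
      have hs : ({a} : Finset V) ⊂ {a, b} := by
        refine (Finset.ssubset_iff_of_subset (by simp)).2 ⟨b, by simp, by simpa using hab.symm⟩
      obtain ⟨hi, he⟩ := h3 {a} hs (by simp) (by simpa using hab.symm)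
      have e1 : ({a, b} : Finset V) \ {a} = {b} := by
        ext v; simp only [Finset.mem_sdiff, Finset.mem_insert, Finset.mem_singleton]; grind
      have e2 : total y {a} = y a := by simp [total]
      rw [e1, e2] at he
      rw [e2] at hi
      have hf : ∀ x, (z x)⁻¹ * pairTop (y - z x • lineDir a b) φ {a, b} =
          (φ a b - φ b a) * (z x * (y a - z x))⁻¹ := by
        intro x
        rw [pairTop_pair _ φ hab (htot0 x)]
        have : (y - z x • lineDir a b) a = y a - z x := by simp [lineDir, hab]
        rw [this, mul_inv]; ring
      simp only [hf]
      refine ⟨hi.const_mul _, ?_⟩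
      simp only [cutWeight, pairWeight, Finset.prod_singleton] at he
      rw [integral_const_mul, he, pairTop_pair _ _ hab h0]
      have l1 : lineWeight x₁ a b a b = x₁ + 1 / 2 := by simp [lineWeight]
      have l2 : lineWeight x₁ a b b a = x₁ - 1 / 2 := by simp [lineWeight, hab]
      rw [Pi.mul_apply, Pi.mul_apply, Pi.mul_apply, Pi.mul_apply, l1, l2]
      ring

end

section

variable {V I : Type*}

/-! ### Spanning trees -/

/-- The trees in a graph that are obtained from a single vertex by successively attaching leaves;
`W` is the set of vertices, `S` the set of lines. -/
inductive GrownTree (G : FeynmanGraph V I) : Finset V → Finset I → Prop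
  | single (v : V) : GrownTree G {v} ∅
  | attach {W : Finset V} {S : Finset I} (h : GrownTree G W S) (i : I) (w v : V) (hw : w ∈ W)
      (hv : v ∉ W) (hi : (G.src i = w ∧ G.tgt i = v) ∨ (G.src i = v ∧ G.tgt i = w)) :
      GrownTree G (insert v W) (insert i S)

/-- The line `i` has exactly one end in `U`. -/
def Crosses (G : FeynmanGraph V I) (U : Finset V) (i : I) : Prop :=
  (G.src i ∈ U ∧ G.tgt i ∉ U) ∨ (G.src i ∉ U ∧ G.tgt i ∈ U)

/-- The vertex energies caused by the energies `z` of the lines in `S`. -/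
def bdry (G : FeynmanGraph V I) (S : Finset I) (z : I → ℂ) : V → ℂ :=
  ∑ i ∈ S, z i • lineDir (G.src i) (G.tgt i)

/-- The pair weight of the lines in `S`. -/
def linesWeight (G : FeynmanGraph V I) (S : Finset I) (x : I → ℂ) : V → V → ℂ :=
  ∏ i ∈ S, lineWeight (x i) (G.src i) (G.tgt i)

lemma total_bdry (G : FeynmanGraph V I) (S : Finset I) (z : I → ℂ) (T : Finset V) :
    total (bdry G S z) T = ∑ i ∈ S, z i *
      ((if G.src i ∈ T then 1 else 0) - (if G.tgt i ∈ T then 1 else 0)) := by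
  simp only [← total_lineDir]
  simp only [total, bdry, Finset.sum_apply, Pi.smul_apply, smul_eq_mul, Finset.mul_sum]
  exact Finset.sum_comm

lemma linesWeight_apply (G : FeynmanGraph V I) (S : Finset I) (x : I → ℂ) (u w : V) :
    linesWeight G S x u w = ∏ i ∈ S, lineWeight (x i) (G.src i) (G.tgt i) u w := by
  simp [linesWeight, Finset.prod_apply]

namespace GrownTree

variable {G : FeynmanGraph V I} {W : Finset V} {S : Finset I}

lemma mem (h : GrownTree G W S) : ∀ i ∈ S, G.src i ∈ W ∧ G.tgt i ∈ W := by
  induction h with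
  | single v => simp
  | attach h i w v hw hv hi ih =>
    intro j hj
    rcases Finset.mem_insert.1 hj with rfl | hj
    · rcases hi with ⟨h1, h2⟩ | ⟨h1, h2⟩ <;> simp [h1, h2, hw]
    · exact ⟨Finset.mem_insert_of_mem (ih j hj).1, Finset.mem_insert_of_mem (ih j hj).2⟩

lemma src_ne_tgt (h : GrownTree G W S) : ∀ i ∈ S, G.src i ≠ G.tgt i := by
  induction h with
  | single v => simp
  | attach h i w v hw hv hi ih =>
    intro j hj
    rcases Finset.mem_insert.1 hj with rfl | hj
    · rcases hi with ⟨h1, h2⟩ | ⟨h1, h2⟩ <;> rw [h1, h2] <;> rintro rfl <;> exact hv hw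
    · exact ih j hj

lemma nonempty (h : GrownTree G W S) : W.Nonempty := by
  cases h <;> simp

lemma notMem_of_attach (h : GrownTree G W S) {i : I} {w v : V} (hv : v ∉ W)
    (hi : (G.src i = w ∧ G.tgt i = v) ∨ (G.src i = v ∧ G.tgt i = w)) : i ∉ S := by
  intro hS
  have := h.mem i hS
  rcases hi with ⟨h1, h2⟩ | ⟨h1, h2⟩
  · exact hv (h2 ▸ this.2)
  · exact hv (h1 ▸ this.1)

lemma card (h : GrownTree G W S) : S.card + 1 = W.card := by
  induction h with
  | single v => simp
  | attach h i w v hw hv hi ih =>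
    rw [Finset.card_insert_of_notMem hv, Finset.card_insert_of_notMem (h.notMem_of_attach hv hi), ih]

/-- On a tree, the energies of the lines are the sums of the vertex energies over the two parts. -/
lemma exists_cut (h : GrownTree G W S) : ∀ i ∈ S, ∃ U : Finset V, G.src i ∈ U ∧ G.tgt i ∉ U ∧
    ∀ j ∈ S, j ≠ i → (G.src j ∈ U ↔ G.tgt j ∈ U) := by
  induction h with
  | single v => simp
  | @attach W S h i w v hw hv hi ih =>
    have hvw : v ≠ w := by rintro rfl; exact hv hw
    intro j hj
    by_cases hji : j = i
    · subst hji
      rcases hi with ⟨h1, h2⟩ | ⟨h1, h2⟩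
      · refine ⟨W, by rw [h1]; exact hw, by rw [h2]; exact hv, fun l hl hlj => ?_⟩
        have := h.mem l ((Finset.mem_insert.1 hl).resolve_left hlj)
        simp [this]
      · refine ⟨{v}, by simp [h1], by simp [h2, hvw.symm], fun l hl hlj => ?_⟩
        have := h.mem l ((Finset.mem_insert.1 hl).resolve_left hlj)
        have e1 : G.src l ≠ v := fun e => hv (e ▸ this.1)
        have e2 : G.tgt l ≠ v := fun e => hv (e ▸ this.2)
        simp [e1, e2]
    · have hjS := (Finset.mem_insert.1 hj).resolve_left hji
      obtain ⟨U, hs, ht, hU⟩ := ih j hjS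
      -- The cut of the smaller tree, with the new leaf `v` moved to the side of its neighbour `w`
      -- so that the new line does not cross it.
      refine ⟨if w ∈ U then insert v U else U.erase v, ?_⟩
      have key : ∀ l ∈ S, ∀ u, (u = G.src l ∨ u = G.tgt l) →
          (u ∈ (if w ∈ U then insert v U else U.erase v) ↔ u ∈ U) := by
        intro l hl u hu
        have huv : u ≠ v := by
          rintro rfl
          rcases hu with e | e
          · exact hv (e ▸ (h.mem l hl).1)
          · exact hv (e ▸ (h.mem l hl).2)
        split_ifs <;> simp [huv]
      refine ⟨(key j hjS _ (Or.inl rfl)).2 hs, fun h' => ht ((key j hjS _ (Or.inr rfl)).1 h'),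
        fun l hl hlj => ?_⟩
      rcases Finset.mem_insert.1 hl with rfl | hl
      · rcases hi with ⟨h1, h2⟩ | ⟨h1, h2⟩ <;> rw [h1, h2] <;> split_ifs with hwU <;>
          simp [hwU, hvw.symm]
      · rw [key l hl _ (Or.inl rfl), key l hl _ (Or.inr rfl)]
        exact hU l hl hlj

lemma exists_crosses (h : GrownTree G W S) : ∀ T : Finset V, (∃ u ∈ W, u ∈ T) →
    (∃ u ∈ W, u ∉ T) → ∃ i ∈ S, Crosses G T i := by
  induction h with
  | single v =>
    rintro T ⟨u, hu, huT⟩ ⟨u', hu', huT'⟩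
    rw [Finset.mem_singleton.1 hu] at huT
    rw [Finset.mem_singleton.1 hu'] at huT'
    exact absurd huT huT'
  | @attach W S h i w v hw hv hi ih =>
    rintro T ⟨u, hu, huT⟩ ⟨u', hu', huT'⟩
    by_cases hvw : (v ∈ T ↔ w ∈ T)
    · have e1 : ∃ u ∈ W, u ∈ T := by
        rcases Finset.mem_insert.1 hu with rfl | hu
        · exact ⟨w, hw, hvw.1 huT⟩
        · exact ⟨u, hu, huT⟩
      have e2 : ∃ u ∈ W, u ∉ T := by
        rcases Finset.mem_insert.1 hu' with rfl | hu'
        · exact ⟨w, hw, fun h => huT' (hvw.2 h)⟩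
        · exact ⟨u', hu', huT'⟩
      obtain ⟨j, hj, hc⟩ := ih T e1 e2
      exact ⟨j, Finset.mem_insert_of_mem hj, hc⟩
    · refine ⟨i, Finset.mem_insert_self _ _, ?_⟩
      rcases hi with ⟨h1, h2⟩ | ⟨h1, h2⟩ <;> unfold Crosses <;> rw [h1, h2] <;> tauto

/-- The chain sum of a tree is the product of the propagators of its lines. -/
lemma pairTop_eq (h : GrownTree G W S) (x z : I → ℂ) :
    (∀ T ⊂ W, T.Nonempty → total (bdry G S z) T ≠ 0) →
    pairTop (bdry G S z) (linesWeight G S x) W = ∏ i ∈ S, (z i)⁻¹ := by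
  induction h with
  | single v => intro _; simp [pairTop, topChain, pairWeight]
  | @attach W S h i w v hw hv hi ih =>
    intro hT
    have hiS := h.notMem_of_attach hv hi
    have hvw : v ≠ w := by rintro rfl; exact hv hw
    have hy : bdry G (insert i S) z = z i • lineDir (G.src i) (G.tgt i) + bdry G S z :=
      Finset.sum_insert hiS
    have hφ : linesWeight G (insert i S) x =
      lineWeight (x i) (G.src i) (G.tgt i) * linesWeight G S x := Finset.prod_insert hiS
    have hbv : bdry G S z v = 0 := by
      rw [bdry, Finset.sum_apply]
      refine Finset.sum_eq_zero fun j hj => ?_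
      have := h.mem j hj
      have e1 : G.src j ≠ v := fun e => hv (e ▸ this.1)
      have e2 : G.tgt j ≠ v := fun e => hv (e ▸ this.2)
      simp [lineDir, e1.symm, e2.symm]
    have hLv : ∀ u, linesWeight G S x v u = 1 ∧ linesWeight G S x u v = 1 := by
      intro u
      rw [linesWeight_apply, linesWeight_apply]
      constructor <;> refine Finset.prod_eq_one fun j hj => ?_ <;>
      · have := h.mem j hj
        have e1 : G.src j ≠ v := fun e => hv (e ▸ this.1)
        have e2 : G.tgt j ≠ v := fun e => hv (e ▸ this.2)
        simp [lineWeight, e1.symm, e2.symm]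
    have hcon : ∀ p ∈ W, contractEnergy (bdry G (insert i S) z) v w p = bdry G S z p := by
      intro p hp
      have hpv : p ≠ v := by rintro rfl; exact hv hp
      by_cases hpw : p = w
      · subst hpw
        rcases hi with ⟨h1, h2⟩ | ⟨h1, h2⟩ <;>
          simp [contractEnergy, hy, hbv, h1, h2, lineDir, hvw, hvw.symm]
      · rcases hi with ⟨h1, h2⟩ | ⟨h1, h2⟩ <;>
          simp [contractEnergy, hy, h1, h2, lineDir, hpw, hpv]
    have htotW : ∀ T ⊆ W, total (contractEnergy (bdry G (insert i S) z) v w) T =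
        total (bdry G S z) T := fun T hT' => Finset.sum_congr rfl fun p hp => hcon p (hT' hp)
    have hsub : ∀ T ⊂ W, T.Nonempty → total (bdry G S z) T ≠ 0 := by
      intro T hTW hTn
      have hvT : v ∉ T := fun h' => hv (hTW.1 h')
      rw [← htotW T hTW.1]
      by_cases hwT : w ∈ T
      · rw [total_contract_of_mem _ hwT hvT]
        refine hT _ ?_ (Finset.insert_nonempty _ _)
        obtain ⟨u, hu, huT⟩ := Finset.exists_of_ssubset hTW
        refine (Finset.ssubset_iff_of_subset (Finset.insert_subset_insert _ hTW.1)).2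
          ⟨u, Finset.mem_insert_of_mem hu, ?_⟩
        simp only [Finset.mem_insert, not_or]
        exact ⟨by rintro rfl; exact hv hu, huT⟩
      · rw [total_contract_of_notMem _ hwT]
        exact hT T (hTW.trans (Finset.ssubset_insert hv)) hTn
    have h0 : total (bdry G (insert i S) z) (insert v W) = 0 := by
      rw [total_bdry]
      refine Finset.sum_eq_zero fun j hj => ?_
      have := (h.attach i w v hw hv hi).mem j hj
      simp [this.1, this.2]
    -- The new leaf is eliminated. Only its neighbour contributes, with weight difference `±((x +
    -- 1/2) - (x - 1/2)) = ±1`; this is why the result does not depend on `x`. The energy of the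
    -- leaf is `±z i` with the same sign.
    have hstar := pairTop_star (bdry G (insert i S) z) (linesWeight G (insert i S) x) v W hv
      h.nonempty hT h0
    rw [Finset.sum_eq_single_of_mem w hw] at hstar
    · have hcong : pairTop (contractEnergy (bdry G (insert i S) z) v w)
          (contractWeight (linesWeight G (insert i S) x) v w) W =
          pairTop (bdry G S z) (linesWeight G S x) W := by
        refine pairTop_congr hcon fun p hp q hq hpq => ?_
        have hpv : p ≠ v := by rintro rfl; exact hv hp
        have hqv : q ≠ v := by rintro rfl; exact hv hq
        have hl : lineWeight (x i) (G.src i) (G.tgt i) p q = 1 := by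
          rcases hi with ⟨h1, h2⟩ | ⟨h1, h2⟩ <;> simp [lineWeight, h1, h2, hpv, hqv]
        have hl1 : p = w → lineWeight (x i) (G.src i) (G.tgt i) v q = 1 := by
          rintro rfl
          rcases hi with ⟨h1, h2⟩ | ⟨h1, h2⟩ <;> simp [lineWeight, h1, h2, hvw, hpq.symm]
        have hl2 : q = w → lineWeight (x i) (G.src i) (G.tgt i) p v = 1 := by
          rintro rfl
          rcases hi with ⟨h1, h2⟩ | ⟨h1, h2⟩ <;> simp [lineWeight, h1, h2, hvw, hpq]
        simp only [contractWeight, hφ, Pi.mul_apply]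
        split_ifs with hpw hqw
        · subst hpw; rw [hl, hl1 rfl, (hLv q).1]; ring
        · subst hqw; rw [hl, hl2 rfl, (hLv p).2]; ring
        · rw [hl, one_mul]
      have hyv : bdry G (insert i S) z v ≠ 0 := by
        have := hT {v} (Finset.ssubset_iff_of_subset (by simp) |>.2 ⟨w, by simp [hw], by simp [hvw.symm]⟩)
          (by simp)
        simpa [total] using this
      rw [hcong, ih hsub] at hstar
      rw [Finset.prod_insert hiS]
      apply mul_left_cancel₀ hyv
      rw [hstar, hφ]
      rcases hi with ⟨h1, h2⟩ | ⟨h1, h2⟩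
      · have e : bdry G (insert i S) z v = - z i := by simp [hy, hbv, h1, h2, lineDir, hvw]
        have hz : z i ≠ 0 := by rw [e] at hyv; exact neg_ne_zero.1 hyv
        have e1 : lineWeight (x i) w v v w = x i - 1 / 2 := by simp [lineWeight, hvw]
        have e2 : lineWeight (x i) w v w v = x i + 1 / 2 := by simp [lineWeight]
        rw [e, Pi.mul_apply, Pi.mul_apply, Pi.mul_apply, Pi.mul_apply, (hLv w).1, (hLv w).2, h1, h2,
          e1, e2]
        field_simp
        ring
      · have e : bdry G (insert i S) z v = z i := by simp [hy, hbv, h1, h2, lineDir, hvw]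
        have hz : z i ≠ 0 := by rwa [e] at hyv
        have e1 : lineWeight (x i) v w w v = x i - 1 / 2 := by simp [lineWeight, hvw.symm]
        have e2 : lineWeight (x i) v w v w = x i + 1 / 2 := by simp [lineWeight]
        rw [e, Pi.mul_apply, Pi.mul_apply, Pi.mul_apply, Pi.mul_apply, (hLv w).1, (hLv w).2, h1, h2,
          e1, e2]
        field_simp
        ring
    · intro u hu huw
      have huv : u ≠ v := by rintro rfl; exact hv hu
      have : linesWeight G (insert i S) x v u = linesWeight G (insert i S) x u v := by
        rw [hφ, Pi.mul_apply, Pi.mul_apply, Pi.mul_apply, Pi.mul_apply, (hLv u).1, (hLv u).2]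
        rcases hi with ⟨h1, h2⟩ | ⟨h1, h2⟩ <;> simp [lineWeight, h1, h2, huw, hvw, huv]
      rw [this, sub_self, zero_mul]

end GrownTree

/-! ### Connectivity -/

lemma exists_crosses_of_connected {G : FeynmanGraph V I} {A : Finset I}
    (h : (G.snip A).Connected) (T : Finset V) (h1 : ∃ u, u ∈ T) (h2 : ∃ u, u ∉ T) :
    ∃ i, i ∉ A ∧ Crosses G T i := by
  obtain ⟨u, hu⟩ := h1
  obtain ⟨w, hw⟩ := h2
  obtain ⟨p⟩ := h.preconnected u w
  obtain ⟨d, -, hd1, hd2⟩ := p.exists_boundary_dart (T : Set V) hu hw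
  rcases ((SimpleGraph.fromRel_adj _ _ _).1 d.adj).2 with ⟨i, hi, hs, ht⟩ | ⟨i, hi, hs, ht⟩
  · exact ⟨i, hi, Or.inl ⟨hs ▸ hd1, ht ▸ hd2⟩⟩
  · exact ⟨i, hi, Or.inr ⟨hs ▸ hd2, ht ▸ hd1⟩⟩

lemma exists_cut_of_not_connected [Fintype V] [Nonempty V] {G : FeynmanGraph V I} {A : Finset I}
    (h : ¬ (G.snip A).Connected) : ∃ T : Finset V, T.Nonempty ∧ (∃ u, u ∉ T) ∧
      ∀ i, Crosses G T i → i ∈ A := by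
  have hp : ¬ (G.snip A).Preconnected := fun hp => h ⟨hp⟩
  simp only [SimpleGraph.Preconnected, not_forall] at hp
  obtain ⟨u, w, huw⟩ := hp
  refine ⟨Finset.univ.filter fun v => (G.snip A).Reachable u v, ⟨u, by simp⟩, ⟨w, by simpa⟩, ?_⟩
  intro i hi
  by_contra hA
  have hne : G.src i ≠ G.tgt i := by
    intro e; rw [Crosses, e] at hi; tauto
  have hadj : (G.snip A).Adj (G.src i) (G.tgt i) := by
    rw [FeynmanGraph.snip, SimpleGraph.fromRel_adj]
    exact ⟨hne, Or.inl ⟨i, hA, rfl, rfl⟩⟩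
  simp only [Crosses, Finset.mem_filter, Finset.mem_univ, true_and] at hi
  rcases hi with ⟨h1, h2⟩ | ⟨h1, h2⟩
  · exact h2 (h1.trans hadj.reachable)
  · exact h1 (h2.trans hadj.symm.reachable)

/-- As long as vertices are missing, connectivity provides a line outside `A` that leaves `W`, and
it is attached. Starting from an arbitrary tree allows a line to be prescribed. -/
lemma GrownTree.exists_spanning [Fintype V] {G : FeynmanGraph V I} {A : Finset I}
    (hc : (G.snip A).Connected) (n : ℕ) : ∀ (W : Finset V) (S : Finset I), Wᶜ.card = n →
    GrownTree G W S → Disjoint S A → ∃ S', S ⊆ S' ∧ Disjoint S' A ∧ GrownTree G Finset.univ S' := by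
  induction n with
  | zero =>
    intro W S hW h hd
    rw [Finset.card_eq_zero, Finset.compl_eq_empty_iff] at hW
    subst hW
    exact ⟨S, subset_rfl, hd, h⟩
  | succ n ih =>
    intro W S hW h hd
    have hne : ∃ u, u ∉ W := by
      obtain ⟨u, hu⟩ := Finset.card_pos.1 (by omega : 0 < Wᶜ.card)
      exact ⟨u, Finset.mem_compl.1 hu⟩
    obtain ⟨i, hi, hcr⟩ := exists_crosses_of_connected hc W h.nonempty hne
    have hcard : ∀ v ∉ W, (insert v W)ᶜ.card = n := by
      intro v hv
      rw [Finset.compl_insert, Finset.card_erase_of_mem (Finset.mem_compl.2 hv), hW]; rfl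
    have hd' : Disjoint (insert i S) A := Finset.disjoint_insert_left.2 ⟨hi, hd⟩
    rcases hcr with ⟨h1, h2⟩ | ⟨h1, h2⟩
    · obtain ⟨S', hS, h'⟩ := ih _ _ (hcard _ h2) (h.attach i _ _ h1 h2 (Or.inl ⟨rfl, rfl⟩)) hd'
      exact ⟨S', (Finset.subset_insert _ _).trans hS, h'⟩
    · obtain ⟨S', hS, h'⟩ := ih _ _ (hcard _ h1) (h.attach i _ _ h2 h1 (Or.inr ⟨rfl, rfl⟩)) hd'
      exact ⟨S', (Finset.subset_insert _ _).trans hS, h'⟩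

variable [Fintype V] [Fintype I]

/-- A spanning tree grown inside `t` has `V - 1` lines, as many as `t`, and therefore is `t`. The
inductive form makes leaf-by-leaf arguments available. -/
lemma grownTree_of_isTree {G : FeynmanGraph V I} {t : Finset I} (ht : G.IsTree t) :
    GrownTree G Finset.univ t := by
  obtain ⟨v⟩ := ht.1.nonempty
  obtain ⟨S, -, hd, hS⟩ := GrownTree.exists_spanning ht.1 _ {v} ∅ rfl (.single v) (by simp)
  have hsub : S ⊆ t := by
    intro i hi
    by_contra h
    exact Finset.disjoint_left.1 hd hi (Finset.mem_compl.2 h)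
  have hc := hS.card
  rw [Finset.card_univ, ← ht.2] at hc
  rwa [← Finset.eq_of_subset_of_card_le hsub (by omega)]

lemma exists_grownTree_mem {G : FeynmanGraph V I} (hG : G.IsConnected) (i : I)
    (hi : G.src i ≠ G.tgt i) : ∃ S, i ∈ S ∧ GrownTree G Finset.univ S := by
  obtain ⟨S, hs, -, hS⟩ := GrownTree.exists_spanning hG _ _ _ rfl
    ((GrownTree.single (G.src i)).attach i (G.src i) (G.tgt i) (by simp) (by simpa using hi.symm)
      (Or.inl ⟨rfl, rfl⟩)) (by simp)
  exact ⟨S, hs (by simp), hS⟩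

/-- A spanning tree that avoids `A` uses `V - 1` lines and leaves at most `L` for `A`. -/
lemma card_le_loops {G : FeynmanGraph V I} {A : Finset I} (h : (G.snip A).Connected) :
    A.card ≤ G.loops := by
  obtain ⟨v⟩ := h.nonempty
  obtain ⟨S, -, hd, hS⟩ := GrownTree.exists_spanning h _ {v} ∅ rfl (.single v) (by simp)
  have hc := hS.card
  rw [Finset.card_univ] at hc
  have := Finset.card_le_univ (S ∪ A)
  rw [Finset.card_union_of_disjoint hd] at this
  unfold FeynmanGraph.loops
  omega

/-! ### Conservation of energy -/

section Flow

variable {M : Type*} [AddCommGroup M]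

/-- The energy leaving the vertex `v` through the lines minus the energy entering. -/
def divergence (G : FeynmanGraph V I) (k : I → M) (v : V) : M :=
  ∑ i, ((if G.src i = v then k i else 0) - (if G.tgt i = v then k i else 0))

lemma sum_divergence (G : FeynmanGraph V I) (k : I → M) (U : Finset V) :
    ∑ v ∈ U, divergence G k v =
      ∑ i, ((if G.src i ∈ U then k i else 0) - (if G.tgt i ∈ U then k i else 0)) := by
  unfold divergence
  rw [Finset.sum_comm]
  refine Finset.sum_congr rfl fun i _ => ?_
  rw [Finset.sum_sub_distrib, Finset.sum_ite_eq, Finset.sum_ite_eq]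

lemma divergence_add (G : FeynmanGraph V I) (k l : I → M) (v : V) :
    divergence G (k + l) v = divergence G k v + divergence G l v := by
  unfold divergence
  rw [← Finset.sum_add_distrib]
  refine Finset.sum_congr rfl fun i _ => ?_
  simp only [Pi.add_apply]
  split_ifs <;> abel

lemma divergence_single (G : FeynmanGraph V I) (i : I) (c : M) (v : V) :
    divergence G (Pi.single i c) v =
      (if G.src i = v then c else 0) - (if G.tgt i = v then c else 0) := by
  unfold divergence
  rw [Finset.sum_eq_single i]
  · simp
  · intro j _ hj
    simp [hj]
  · simp

/-- What a leaf requires must be carried by its own line, so the requirement is passed on to the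
neighbour and the smaller tree is solved. -/
lemma GrownTree.exists_flow {G : FeynmanGraph V I} {W : Finset V} {S : Finset I}
    (h : GrownTree G W S) : ∀ c : V → M, ∑ v ∈ W, c v = 0 →
      ∃ k : I → M, (∀ i ∉ S, k i = 0) ∧ ∀ v ∈ W, divergence G k v = c v := by
  induction h with
  | single v =>
    intro c hc
    refine ⟨0, by simp, fun u hu => ?_⟩
    rw [Finset.mem_singleton.1 hu]
    simp only [Finset.sum_singleton] at hc
    simp [divergence, hc]
  | @attach W S h i w v hw hv hi ih =>
    intro c hc
    have hvw : v ≠ w := by rintro rfl; exact hv hw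
    obtain ⟨k, hk, hd⟩ := ih (Function.update c w (c w + c v)) (by
      rw [Finset.sum_update_of_mem hw, Finset.sdiff_singleton_eq_erase, add_right_comm,
        Finset.add_sum_erase W c hw, add_comm, ← Finset.sum_insert hv, hc])
    have hkv : divergence G k v = 0 := by
      refine Finset.sum_eq_zero fun j _ => ?_
      by_cases hj : j ∈ S
      · have := h.mem j hj
        have e1 : G.src j ≠ v := fun e => hv (e ▸ this.1)
        have e2 : G.tgt j ≠ v := fun e => hv (e ▸ this.2)
        simp [e1, e2]
      · simp [hk j hj]
    refine ⟨k + Pi.single i (if G.src i = v then c v else - c v), fun j hj => ?_, fun u hu => ?_⟩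
    · simp only [Finset.mem_insert, not_or] at hj
      simp [hk j hj.2, hj.1]
    · rw [divergence_add, divergence_single]
      rcases Finset.mem_insert.1 hu with huv | hu
      · rw [huv]
        rcases hi with ⟨h1, h2⟩ | ⟨h1, h2⟩ <;> simp [hkv, h1, h2, hvw.symm]
      · have huv : u ≠ v := fun e => hv (e ▸ hu)
        rw [hd u hu]
        by_cases huw : u = w
        · subst huw
          rcases hi with ⟨h1, h2⟩ | ⟨h1, h2⟩ <;> simp [h1, h2, hvw, hvw.symm]
        · rcases hi with ⟨h1, h2⟩ | ⟨h1, h2⟩ <;>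
            simp [h1, h2, huw, Ne.symm huw, Ne.symm huv]

/-- The energies of the lines of a spanning tree in terms of those of the other lines. -/
lemma eq_of_divergence_eq {G : FeynmanGraph V I} {t : Finset I} {i : I} (hi : i ∈ t) {U : Finset V}
    (h1 : G.src i ∈ U) (h2 : G.tgt i ∉ U) (hU : ∀ j ∈ t, j ≠ i → (G.src j ∈ U ↔ G.tgt j ∈ U))
    (k : I → M) : k i = ∑ v ∈ U, divergence G k v -
      ∑ j ∈ tᶜ, ((if G.src j ∈ U then k j else 0) - (if G.tgt j ∈ U then k j else 0)) := by
  rw [sum_divergence, ← Finset.sum_add_sum_compl t, add_sub_cancel_right,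
    Finset.sum_eq_single_of_mem i hi]
  · simp [h1, h2]
  · intro j hj hji
    simp [hU j hj hji]

lemma GrownTree.flow_unique {G : FeynmanGraph V I} {t : Finset I} (h : GrownTree G Finset.univ t)
    {k l : I → M} (h1 : ∀ i ∉ t, k i = l i) (h2 : ∀ v, divergence G k v = divergence G l v) :
    k = l := by
  funext i
  by_cases hi : i ∈ t
  · obtain ⟨U, hs, ht, hU⟩ := h.exists_cut i hi
    rw [eq_of_divergence_eq hi hs ht hU k, eq_of_divergence_eq hi hs ht hU l]
    congr 1
    · exact Finset.sum_congr rfl fun v _ => h2 v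
    · exact Finset.sum_congr rfl fun j hj => by rw [h1 j (Finset.mem_compl.1 hj)]
  · exact h1 i hi

/-- Arbitrary energies of the lines outside a spanning tree extend to a conserved flow. -/
lemma GrownTree.exists_flow_extending {G : FeynmanGraph V I} {t : Finset I}
    (h : GrownTree G Finset.univ t) (c : V → M) (hc : ∑ v, c v = 0) (x : I → M) :
    ∃ k : I → M, (∀ i ∉ t, k i = x i) ∧ ∀ v, divergence G k v = c v := by
  obtain ⟨k, hk, hd⟩ := h.exists_flow (fun v => c v - divergence G x v) (by
    rw [Finset.sum_sub_distrib, hc, sum_divergence]; simp)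
  refine ⟨k + x, fun i hi => by simp [hk i hi], fun v => ?_⟩
  rw [divergence_add, hd v (Finset.mem_univ v)]; simp

end Flow

end

section

variable {V I X : Type*} [Fintype V] [Fintype I] [MeasurableSpace X]

/-! ### Integration over the independent energies -/

/-- What is needed of integration over the energy of a line: `χ` is periodic with respect to a group
`Γ` of imaginary numbers, the values `z i x` of `E - i k` on line `i` are congruent to `z₀ i`
modulo `Γ`, and integrals of products of two propagators are expressed by `χ`. -/
structure EnergyIntegral (ν : Measure X) (τ : ℂ) (χ : ℂ → ℂ) (Γ : AddSubgroup ℂ) (z₀ : I → ℂ)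
    (J : Set I) (z : I → X → ℂ) : Prop where
  re_eq_zero : ∀ γ ∈ Γ, γ.re = 0
  periodic : ∀ γ ∈ Γ, ∀ w, χ (w + γ) = χ w
  re_ne_zero : ∀ i ∈ J, (z₀ i).re ≠ 0
  sub_mem : ∀ i ∈ J, ∀ x, z i x - z₀ i ∈ Γ
  integral_eq : ∀ i ∈ J, ∀ Y : ℂ, Y.re ≠ 0 → Y.re ≠ (z₀ i).re →
    Integrable (fun x => (z i x * (Y - z i x))⁻¹) ν ∧
      ∫ x, (z i x * (Y - z i x))⁻¹ ∂ν = τ * (Y⁻¹ * (χ (z₀ i) + χ (Y - z₀ i)))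

/-- The addition law for `χ`, for the cuts of the graphs whose set of lines contains `t`. -/
def CutLaw (G : FeynmanGraph V I) (t N : Finset I) (χ : ℂ → ℂ) (z₀ : I → ℂ) : Prop :=
  ∀ S : Finset I, t ⊆ S → S ⊆ N → ∀ T : Finset V, T.Nonempty → T ≠ Finset.univ →
    (total (bdry G S z₀) T).re ≠ 0 ∧
    (cutWeight (linesWeight G S (χ ∘ z₀)) T Tᶜ - cutWeight (linesWeight G S (χ ∘ z₀)) Tᶜ T) *
        χ (total (bdry G S z₀) T) =
      1 / 2 * (cutWeight (linesWeight G S (χ ∘ z₀)) T Tᶜ +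
        cutWeight (linesWeight G S (χ ∘ z₀)) Tᶜ T)

variable {ν : Measure X} [SigmaFinite ν] {τ : ℂ} {χ : ℂ → ℂ} {Γ : AddSubgroup ℂ}
  {z₀ : I → ℂ} {z : I → X → ℂ} {N : Finset I}

lemma total_congr_mod {Γ : AddSubgroup ℂ} {y y' : V → ℂ} (h : ∀ v, y v - y' v ∈ Γ) (T : Finset V) :
    total y T - total y' T ∈ Γ := by
  rw [total, total, ← Finset.sum_sub_distrib]
  exact Γ.sum_mem fun v _ => h v

/-- Induction on the number of integrated lines: Fubini integrates all but the first by the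
induction hypothesis, and `integral_addLine` handles the first. Energies are controlled only modulo
`Γ`. This suffices, since elements of `Γ` are imaginary, so that the real parts that must not vanish
are unaffected, and they are periods of `χ`. -/
lemma integral_independent_energies {G : FeynmanGraph V I} {t : Finset I}
    (hN : ∀ i ∈ N, G.src i ≠ G.tgt i) (hlaw : CutLaw G t N χ z₀) (htN : t ⊆ N)
    (hE : EnergyIntegral ν τ χ Γ z₀ {i | i ∈ N ∧ i ∉ t} z) (n : ℕ) :
    ∀ (l : Fin n → I), Function.Injective l → (∀ j, l j ∈ N ∧ l j ∉ t) → ∀ y : V → ℂ,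
    total y Finset.univ = 0 → (∀ v, y v - bdry G (t ∪ Finset.univ.image l) z₀ v ∈ Γ) →
    Integrable (fun x : Fin n → X => (∏ j, (z (l j) (x j))⁻¹) * pairTop
      (y - ∑ j, z (l j) (x j) • lineDir (G.src (l j)) (G.tgt (l j)))
        (linesWeight G t (χ ∘ z₀)) Finset.univ) (Measure.pi fun _ => ν) →
    ∫ x : Fin n → X, (∏ j, (z (l j) (x j))⁻¹) * pairTop
      (y - ∑ j, z (l j) (x j) • lineDir (G.src (l j)) (G.tgt (l j)))
        (linesWeight G t (χ ∘ z₀)) Finset.univ ∂(Measure.pi fun _ => ν) =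
      τ ^ n * pairTop y (linesWeight G (t ∪ Finset.univ.image l) (χ ∘ z₀)) Finset.univ := by
  induction n with
  | zero =>
    intro l _ _ y _ _ _
    rw [Measure.pi_of_empty (fun _ => ν), integral_dirac]
    simp
  | succ n ih =>
    intro l hl hlt y h0 hy hint
    set l' : Fin n → I := fun j => l j.succ with hl'
    set S' := t ∪ Finset.univ.image l' with hS'
    have h0S' : l 0 ∉ S' := by
      simp only [hS', Finset.mem_union, Finset.mem_image, Finset.mem_univ, true_and, not_or,
        not_exists]
      exact ⟨(hlt 0).2, fun j hj => (Fin.succ_ne_zero j) (hl hj)⟩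
    have hS : t ∪ Finset.univ.image l = insert (l 0) S' := by
      ext i
      simp only [hS', Finset.mem_union, Finset.mem_image, Finset.mem_univ, true_and,
        Finset.mem_insert, Fin.exists_fin_succ, eq_comm (a := i)]
      tauto
    have hS'N : S' ⊆ N := by
      intro i hi
      simp only [hS', Finset.mem_union, Finset.mem_image, Finset.mem_univ, true_and] at hi
      rcases hi with hi | ⟨j, rfl⟩
      · exact htN hi
      · exact (hlt _).1
    rw [hS] at hy ⊢
    have hb : bdry G (insert (l 0) S') z₀ =
        z₀ (l 0) • lineDir (G.src (l 0)) (G.tgt (l 0)) + bdry G S' z₀ := Finset.sum_insert h0S'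
    have hw : linesWeight G (insert (l 0) S') (χ ∘ z₀) = linesWeight G S' (χ ∘ z₀) *
        lineWeight (χ (z₀ (l 0))) (G.src (l 0)) (G.tgt (l 0)) := by
      rw [mul_comm]; exact Finset.prod_insert h0S'
    have hmp := (measurePreserving_piFinSuccAbove (fun _ : Fin (n + 1) => ν) 0).symm
    have hz0 : ∀ x, z (l 0) x ≠ 0 := by
      intro x hx
      have h1 := hE.re_ne_zero (l 0) (hlt 0)
      have h2 := hE.re_eq_zero _ (hE.sub_mem (l 0) (hlt 0) x)
      rw [hx] at h2
      simp at h2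
      exact h1 h2
    set f : (Fin (n + 1) → X) → ℂ := fun x => (∏ j, (z (l j) (x j))⁻¹) * pairTop
      (y - ∑ j, z (l j) (x j) • lineDir (G.src (l j)) (G.tgt (l j)))
        (linesWeight G t (χ ∘ z₀)) Finset.univ with hf
    have hfe : ∀ p : X × (Fin n → X), f ((MeasurableEquiv.piFinSuccAbove (fun _ => X) 0).symm p) =
        (z (l 0) p.1)⁻¹ * ((∏ j, (z (l' j) (p.2 j))⁻¹) * pairTop
          ((y - z (l 0) p.1 • lineDir (G.src (l 0)) (G.tgt (l 0))) -
            ∑ j, z (l' j) (p.2 j) • lineDir (G.src (l' j)) (G.tgt (l' j)))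
          (linesWeight G t (χ ∘ z₀)) Finset.univ) := by
      rintro ⟨x, x'⟩
      simp only [hf, Fin.prod_univ_succ, Fin.sum_univ_succ, hl', sub_sub]
      simp [MeasurableEquiv.piFinSuccAbove, mul_assoc]
    have hint' : Integrable (fun p => f ((MeasurableEquiv.piFinSuccAbove (fun _ => X) 0).symm p))
        (ν.prod (Measure.pi fun _ : Fin n => ν)) := (hmp.integrable_comp_emb (MeasurableEquiv.measurableEmbedding _)).2 hint
    rw [← hmp.integral_comp' f, integral_prod _ hint']
    have hmem : ∀ x, ∀ v, (y - z (l 0) x • lineDir (G.src (l 0)) (G.tgt (l 0))) v -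
        bdry G S' z₀ v ∈ Γ := by
      intro x v
      have h1 := hy v
      have h2 := hE.sub_mem (l 0) (hlt 0) x
      have h3 : (z (l 0) x - z₀ (l 0)) * lineDir (G.src (l 0)) (G.tgt (l 0)) v ∈ Γ := by
        simp only [lineDir, Pi.sub_apply, Pi.single_apply, mul_sub (z (l 0) x - z₀ (l 0))]
        refine Γ.sub_mem ?_ ?_ <;> split_ifs <;> simp [h2, Γ.zero_mem]
      have h4 := Γ.sub_mem h1 h3
      rw [hb] at h4
      convert h4 using 1
      simp
      ring
    have hinner : ∀ᵐ x ∂ν, ∫ x' : Fin n → X,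
        f ((MeasurableEquiv.piFinSuccAbove (fun _ => X) 0).symm (x, x')) ∂(Measure.pi fun _ => ν) =
        τ ^ n * ((z (l 0) x)⁻¹ * pairTop (y - z (l 0) x • lineDir (G.src (l 0)) (G.tgt (l 0)))
          (linesWeight G S' (χ ∘ z₀)) Finset.univ) := by
      filter_upwards [hint'.prod_right_ae] with x hx
      simp only [hfe] at hx
      simp only [hfe]
      rw [integral_const_mul, ih l' (fun a b h => Fin.succ_injective _ (hl h)) (fun j => hlt _)
        _ _ (hmem x) ?_]
      · ring
      · rw [total_sub_smul, h0, total_lineDir]; simp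
      -- Fubini yields integrability of almost every slice including the factor `1/z`, which is
      -- removed again because `z` has nonzero real part.
      · exact (hx.const_mul (z (l 0) x)).congr
          (ae_of_all _ fun x' => mul_inv_cancel_left₀ (hz0 x) _)
    rw [integral_congr_ae hinner, integral_const_mul]
    have hadd := (integral_addLine ν (z (l 0)) τ (χ (z₀ (l 0))) (hN _ (hlt 0).1) _ Finset.univ y
      (linesWeight G S' (χ ∘ z₀)) rfl (Finset.mem_univ _) (Finset.mem_univ _) h0 ?_ ?_ ?_).2
    · rw [hadd, hw]; ring
    · intro T hT hTn h
      have h1 := (hlaw (insert (l 0) S') (Finset.subset_union_left.trans (Finset.subset_insert _ _))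
        (Finset.insert_subset (hlt 0).1 hS'N) T hTn hT.ne).1
      have h2 := hE.re_eq_zero _ (total_congr_mod hy T)
      rw [h] at h2
      simp at h2
      exact h1 h2
    · intro T hT ha hb' x h
      have h1 := (hlaw S' Finset.subset_union_left hS'N T ⟨_, ha⟩ hT.ne).1
      have h2 := hE.re_eq_zero _ (total_congr_mod (hmem x) T)
      rw [total_sub_smul, h, total_lineDir] at h2
      simp [ha, hb'] at h2
      exact h1 h2
    · intro T hT ha hb'
      have h1 := (hlaw (insert (l 0) S') (Finset.subset_union_left.trans (Finset.subset_insert _ _))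
        (Finset.insert_subset (hlt 0).1 hS'N) T ⟨_, ha⟩ hT.ne).1
      have h2 := hE.re_eq_zero _ (total_congr_mod hy T)
      obtain ⟨h3, h4⟩ := hlaw S' Finset.subset_union_left hS'N T ⟨_, ha⟩ hT.ne
      have h5 : total (bdry G (insert (l 0) S') z₀) T = z₀ (l 0) + total (bdry G S' z₀) T := by
        rw [hb, total, total]
        simp only [Pi.add_apply, Pi.smul_apply, smul_eq_mul, Finset.sum_add_distrib,
          ← Finset.mul_sum]
        have := total_lineDir (G.src (l 0)) (G.tgt (l 0)) T
        rw [total] at this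
        rw [this]; simp [ha, hb']
      have hYre : (total y T).re = (z₀ (l 0)).re + (total (bdry G S' z₀) T).re := by
        rw [Complex.sub_re, h5, Complex.add_re] at h2; linarith
      obtain ⟨hi, he⟩ := hE.integral_eq (l 0) (hlt 0) (total y T)
        (by rw [hYre, ← Complex.add_re, ← h5]; exact h1) (by rw [hYre]; intro h; apply h3; linarith)
      refine ⟨hi, ?_⟩
      -- By periodicity the argument of `χ` may be replaced by the energy of the cut in the smaller
      -- graph, to which `CutLaw` applies.
      have h6 : χ (total y T - z₀ (l 0)) = χ (total (bdry G S' z₀) T) := by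
        have := hE.periodic _ (total_congr_mod hy T) (total (bdry G S' z₀) T)
        rw [← this, h5]; congr 1; ring
      rw [he, h6, ← Finset.compl_eq_univ_sdiff]
      linear_combination (τ * (total y T)⁻¹) * h4

end

section

/-! ### Integrals and sums over the energy of a single line -/

lemma one_add_abs_im_le {w : ℂ} (hw : w.re ≠ 0) : 1 + |w.im| ≤ (1 + |w.re|⁻¹) * ‖w‖ := by
  have h1 := Complex.abs_re_le_norm w
  have h2 := Complex.abs_im_le_norm w
  have h3 : 0 < |w.re| := abs_pos.2 hw
  have h4 : 1 ≤ |w.re|⁻¹ * ‖w‖ := by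
    rw [inv_mul_eq_div, le_div_iff₀ h3]; linarith
  linarith [add_mul 1 |w.re|⁻¹ ‖w‖]

lemma norm_inv_le {w : ℂ} (hw : w.re ≠ 0) :
    ‖w⁻¹‖ ≤ (1 + |w.re|⁻¹) * (1 + |w.im|)⁻¹ := by
  have h3 : 0 < |w.re| := abs_pos.2 hw
  have h0 : 0 < ‖w‖ := lt_of_lt_of_le h3 (Complex.abs_re_le_norm w)
  have h := one_add_abs_im_le hw
  rw [norm_inv, ← div_eq_mul_inv, le_div_iff₀ (by positivity), inv_mul_eq_div, div_le_iff₀ h0]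
  exact h

/-- The product of two decaying factors is bounded by the sum of their squares, each a shifted
integrable function of one variable. -/
lemma norm_inv_mul_le {w w' : ℂ} (hw : w.re ≠ 0) (hw' : w'.re ≠ 0) :
    ‖(w * w')⁻¹‖ ≤ (1 + |w.re|⁻¹) * (1 + |w'.re|⁻¹) *
      ((1 + |w.im|) ^ (-2 : ℝ) + (1 + |w'.im|) ^ (-2 : ℝ)) := by
  have e : ∀ k : ℝ, (1 + |k|) ^ (-2 : ℝ) = (1 + |k|)⁻¹ ^ 2 := fun k => by
    rw [Real.rpow_neg (by positivity), inv_pow]; norm_num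
  rw [mul_inv, norm_mul, e, e]
  calc ‖w⁻¹‖ * ‖w'⁻¹‖ ≤ ((1 + |w.re|⁻¹) * (1 + |w.im|)⁻¹) * ((1 + |w'.re|⁻¹) * (1 + |w'.im|)⁻¹) :=
        mul_le_mul (norm_inv_le hw) (norm_inv_le hw') (norm_nonneg _) (by positivity)
    _ = (1 + |w.re|⁻¹) * (1 + |w'.re|⁻¹) * ((1 + |w.im|)⁻¹ * (1 + |w'.im|)⁻¹) := by ring
    _ ≤ _ := by
      gcongr
      nlinarith [sq_nonneg ((1 + |w.im|)⁻¹ - (1 + |w'.im|)⁻¹), sq_nonneg ((1 + |w.im|)⁻¹),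
        sq_nonneg ((1 + |w'.im|)⁻¹)]

lemma integrable_decay {q : ℝ} (hq : 1 < q) (b : ℝ) :
    Integrable (fun k : ℝ => (1 + |k + b|) ^ (-q)) := by
  have := integrable_one_add_norm (E := ℝ) (μ := volume) (r := q) (by simpa using hq)
  exact (this.comp_add_right b)

lemma summable_decay {q : ℝ} (hq : 1 < q) {a : ℝ} (ha : a ≠ 0) (b : ℝ) :
    Summable (fun n : ℤ => (1 + |a * n + b|) ^ (-q)) := by
  have h := ((Real.summable_one_div_int_add_rpow (b / a) q).2 hq).mul_left (|a| ^ (-q))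
  refine Summable.of_norm_bounded_eventually h ?_
  -- At the at most one integer where `n + b / a = 0` the comparison series has the default value `1
  -- / 0 = 0`, so the comparison is only eventual.
  have hfin : {n : ℤ | ¬ ((n : ℝ) + b / a ≠ 0)}.Finite := by
    refine Set.Subsingleton.finite fun m hm n hn => ?_
    replace hm := not_not.1 hm
    replace hn := not_not.1 hn
    exact_mod_cast (by linarith : (m : ℝ) = n)
  filter_upwards [hfin.compl_mem_cofinite] with n hn
  have hn : (n : ℝ) + b / a ≠ 0 := by
    by_contra h
    exact hn (not_not.2 h)
  have e : a * n + b = a * (n + b / a) := by field_simp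
  have hpos : 0 < |a * (n + b / a)| := abs_pos.2 (mul_ne_zero ha hn)
  rw [Real.norm_of_nonneg (by positivity), e, one_div, ← Real.rpow_neg (abs_nonneg _),
    ← Real.mul_rpow (abs_nonneg _) (abs_nonneg _), ← abs_mul]
  exact Real.rpow_le_rpow_of_nonpos hpos (by linarith) (by linarith)

/-- The zero-temperature limit of `coth (z / 2T) / 2`. -/
def halfSign (w : ℂ) : ℂ := if 0 < w.re then 1 / 2 else -(1 / 2)

/-- The group of imaginary numbers. -/
def imaginary : AddSubgroup ℂ := Complex.reAddGroupHom.ker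

lemma mem_imaginary {w : ℂ} : w ∈ imaginary ↔ w.re = 0 := Iff.rfl

lemma tendsto_log_ratio (a u v : ℝ) (ha : a ≠ 0) (hu : u ≠ 0) :
    Tendsto (fun k : ℝ => Real.log (a ^ 2 + k ^ 2) - Real.log (u ^ 2 + (k + v) ^ 2))
      (Bornology.cobounded ℝ) (𝓝 0) := by
  have hpos : ∀ k : ℝ, 0 < a ^ 2 + k ^ 2 := fun k => by positivity
  have hpos' : ∀ k : ℝ, 0 < u ^ 2 + (k + v) ^ 2 := fun k => by positivity
  have hinv : Tendsto (fun k : ℝ => k⁻¹) (Bornology.cobounded ℝ) (𝓝 0) :=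
    tendsto_inv₀_cobounded
  have h1 : Tendsto (fun k : ℝ => (a ^ 2 * (k⁻¹) ^ 2 + 1) / (u ^ 2 * (k⁻¹) ^ 2 + (1 + v * k⁻¹) ^ 2))
      (Bornology.cobounded ℝ) (𝓝 ((a ^ 2 * 0 ^ 2 + 1) / (u ^ 2 * 0 ^ 2 + (1 + v * 0) ^ 2))) := by
    refine Tendsto.div ?_ ?_ (by norm_num)
    · exact ((hinv.pow 2).const_mul _).add_const _
    · exact ((hinv.pow 2).const_mul _).add (((hinv.const_mul v).const_add 1).pow 2)
  have h2 := (Real.continuousAt_log (x := 1) one_ne_zero).tendsto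
  rw [Real.log_one] at h2
  have h3 : ((a ^ 2 * 0 ^ 2 + 1) / (u ^ 2 * 0 ^ 2 + (1 + v * 0) ^ 2) : ℝ) = 1 := by norm_num
  rw [h3] at h1
  refine (h2.comp h1).congr' ?_
  filter_upwards [Bornology.eventually_ne_cobounded (0 : ℝ)] with k hk
  rw [Function.comp_apply, ← Real.log_div (hpos k).ne' (hpos' k).ne']
  congr 1
  have : u ^ 2 * k⁻¹ ^ 2 + (1 + v * k⁻¹) ^ 2 = (u ^ 2 + (k + v) ^ 2) * (k⁻¹) ^ 2 := by
    field_simp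
  rw [this, show a ^ 2 * k⁻¹ ^ 2 + 1 = (a ^ 2 + k ^ 2) * (k⁻¹) ^ 2 by field_simp]
  exact mul_div_mul_right _ _ (by positivity)

lemma tendsto_arctan_atTop (u v : ℝ) (hu : u ≠ 0) :
    Tendsto (fun k : ℝ => Real.arctan ((k + v) / u)) atTop
      (𝓝 (if 0 < u then Real.pi / 2 else -(Real.pi / 2))) := by
  split_ifs with h
  · exact (Real.tendsto_arctan_atTop.mono_right nhdsWithin_le_nhds).comp
      ((tendsto_atTop_add_const_right _ v tendsto_id).atTop_div_const h)
  · exact (Real.tendsto_arctan_atBot.mono_right nhdsWithin_le_nhds).comp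
      ((tendsto_atTop_add_const_right _ v tendsto_id).atTop_div_const_of_neg
        (lt_of_le_of_ne (not_lt.1 h) hu))

lemma tendsto_arctan_atBot (u v : ℝ) (hu : u ≠ 0) :
    Tendsto (fun k : ℝ => Real.arctan ((k + v) / u)) atBot
      (𝓝 (-(if 0 < u then Real.pi / 2 else -(Real.pi / 2)))) := by
  have h := (tendsto_arctan_atTop u (-v) hu).neg.comp tendsto_neg_atBot_atTop
  refine h.congr fun k => ?_
  simp only [Function.comp_apply, ← Real.arctan_neg]
  congr 1
  ring

/-- By partial fractions `1/(z(Y - z)) = Y⁻¹(1/z + 1/(Y - z))`. Each part has an antiderivative made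
of an arctangent and a logarithm; at `±∞` the logarithms cancel, and each arctangent contributes `π`
times the sign of a real part. -/
lemma integral_mul_propagators (a : ℝ) (ha : a ≠ 0) (Y : ℂ) (hY : Y.re ≠ 0) (hYa : Y.re ≠ a) :
    Integrable (fun k : ℝ => (((a : ℂ) - Complex.I * k) * (Y - (a - Complex.I * k)))⁻¹) ∧
    ∫ k : ℝ, (((a : ℂ) - Complex.I * k) * (Y - (a - Complex.I * k)))⁻¹ =
      2 * Real.pi * (Y⁻¹ * (halfSign a + halfSign (Y - a))) := by
  set u : ℝ := Y.re - a with hu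
  set v : ℝ := Y.im with hv
  have hu0 : u ≠ 0 := sub_ne_zero.2 hYa
  have hre1 : ∀ k : ℝ, ((a : ℂ) - Complex.I * k).re = a := fun k => by simp
  have him1 : ∀ k : ℝ, ((a : ℂ) - Complex.I * k).im = -k := fun k => by simp
  have hre2 : ∀ k : ℝ, (Y - ((a : ℂ) - Complex.I * k)).re = u := fun k => by simp [hu]
  have him2 : ∀ k : ℝ, (Y - ((a : ℂ) - Complex.I * k)).im = k + v := fun k => by simp [hv, add_comm]
  have hz1 : ∀ k : ℝ, (a : ℂ) - Complex.I * k ≠ 0 := fun k h => ha (by rw [← hre1 k, h]; rfl)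
  have hz2 : ∀ k : ℝ, Y - ((a : ℂ) - Complex.I * k) ≠ 0 := fun k h => hu0 (by rw [← hre2 k, h]; rfl)
  have hYne : Y ≠ 0 := fun h => hY (by rw [h]; rfl)
  have hint : Integrable
      (fun k : ℝ => (((a : ℂ) - Complex.I * k) * (Y - (a - Complex.I * k)))⁻¹) := by
    have hb := ((integrable_decay one_lt_two 0).add (integrable_decay one_lt_two v)).const_mul
      ((1 + |a|⁻¹) * (1 + |u|⁻¹))
    refine hb.mono' ?_ (ae_of_all _ fun k => ?_)
    · refine Continuous.aestronglyMeasurable (Continuous.inv₀ (by fun_prop) fun k => ?_)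
      exact mul_ne_zero (hz1 k) (hz2 k)
    · have := norm_inv_mul_le (w := (a : ℂ) - Complex.I * k) (w' := Y - (a - Complex.I * k))
        (by rw [hre1]; exact ha) (by rw [hre2]; exact hu0)
      rw [hre1, hre2, him1, him2, abs_neg] at this
      simpa using this
  refine ⟨hint, ?_⟩
  have hpa : ∀ k : ℝ, 0 < a ^ 2 + k ^ 2 := fun k => by positivity
  have hpu : ∀ k : ℝ, 0 < u ^ 2 + (k + v) ^ 2 := fun k => by positivity
  -- The antiderivative, written with real functions so that no branch of the complex logarithm has
  -- to be followed. The summand `0` gives both arctangents the same shape.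
  set F : ℝ → ℂ := fun k => Y⁻¹ * (((Real.arctan ((k + 0) / a) + Real.arctan ((k + v) / u) : ℝ) : ℂ) +
    Complex.I / 2 * ((Real.log (a ^ 2 + k ^ 2) - Real.log (u ^ 2 + (k + v) ^ 2) : ℝ) : ℂ)) with hF
  have hderiv : ∀ k : ℝ, HasDerivAt F
      ((((a : ℂ) - Complex.I * k) * (Y - (a - Complex.I * k)))⁻¹) k := by
    intro k
    have d1 : HasDerivAt (fun k : ℝ => Real.arctan ((k + 0) / a)) (a / (a ^ 2 + k ^ 2)) k := by
      have := (((hasDerivAt_id' k).add_const 0).div_const a).arctan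
      convert this using 1
      have := hpa k
      field_simp
      ring
    have d2 : HasDerivAt (fun k : ℝ => Real.arctan ((k + v) / u)) (u / (u ^ 2 + (k + v) ^ 2)) k := by
      have := (((hasDerivAt_id' k).add_const v).div_const u).arctan
      convert this using 1
      have := hpu k
      field_simp
    have d3 : HasDerivAt (fun k : ℝ => Real.log (a ^ 2 + k ^ 2)) (2 * k / (a ^ 2 + k ^ 2)) k := by
      have := (((hasDerivAt_id' k).pow 2).const_add (a ^ 2)).log (hpa k).ne'
      simpa using this
    have d4 : HasDerivAt (fun k : ℝ => Real.log (u ^ 2 + (k + v) ^ 2))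
        (2 * (k + v) / (u ^ 2 + (k + v) ^ 2)) k := by
      have := ((((hasDerivAt_id' k).add_const v).pow 2).const_add (u ^ 2)).log (hpu k).ne'
      simpa using this
    have d := (((d1.add d2).ofReal_comp).add (((d3.sub d4).ofReal_comp).const_mul
      (Complex.I / 2))).const_mul Y⁻¹
    refine d.congr_deriv ?_
    have hYe : Y = (u + a : ℝ) + v * Complex.I := by
      apply Complex.ext <;> simp [hu, hv]
    have p1 : ((a : ℂ) ^ 2 + k ^ 2) = (a - Complex.I * k) * (a + Complex.I * k) := by
      ring_nf; rw [Complex.I_sq]; ring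
    have p2 : ((u : ℂ) ^ 2 + (k + v) ^ 2) = (u + Complex.I * (k + v)) * (u - Complex.I * (k + v)) := by
      ring_nf; rw [Complex.I_sq]; ring
    have p3 : Y - (a - Complex.I * k) = u + Complex.I * (k + v) := by rw [hYe]; push_cast; ring
    have n1 := hz1 k
    have n2 : (u : ℂ) + Complex.I * (k + v) ≠ 0 := p3 ▸ hz2 k
    have n3 : (a : ℂ) + Complex.I * k ≠ 0 := fun h => ha (by simpa using congrArg Complex.re h)
    have n4 : (u : ℂ) - Complex.I * (k + v) ≠ 0 := fun h => hu0 (by simpa using congrArg Complex.re h)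
    have q1 : (a : ℂ) / (a ^ 2 + k ^ 2) + Complex.I / 2 * (2 * k / (a ^ 2 + k ^ 2)) =
        (a - Complex.I * k)⁻¹ := by
      rw [p1]; field_simp
    have q2 : (u : ℂ) / (u ^ 2 + (k + v) ^ 2) - Complex.I / 2 * (2 * (k + v) / (u ^ 2 + (k + v) ^ 2)) =
        (u + Complex.I * (k + v))⁻¹ := by
      rw [p2]; field_simp
    have q3 : (a - Complex.I * k)⁻¹ + (u + Complex.I * (k + v))⁻¹ =
        Y * ((a - Complex.I * k) * (u + Complex.I * (k + v)))⁻¹ := by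
      have : Y = (u + Complex.I * (k + v)) + (a - Complex.I * k) := by rw [← p3]; ring
      rw [this]; field_simp
    rw [p3]
    apply mul_left_cancel₀ hYne
    rw [mul_inv_cancel_left₀ hYne, ← q3, ← q1, ← q2]
    push_cast
    ring
  have hsum : ∀ s s' : ℝ, (((s + s' : ℝ) : ℂ) + Complex.I / 2 * ((0 : ℝ) : ℂ)) = s + s' := by
    intro s s'; push_cast; ring
  have htop := integral_of_hasDerivAt_of_tendsto hderiv hint
    (m := Y⁻¹ * (((-(if 0 < a then Real.pi / 2 else -(Real.pi / 2)) +
      -(if 0 < u then Real.pi / 2 else -(Real.pi / 2)) : ℝ) : ℂ) + Complex.I / 2 * ((0 : ℝ) : ℂ)))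
    (n := Y⁻¹ * ((((if 0 < a then Real.pi / 2 else -(Real.pi / 2)) +
      (if 0 < u then Real.pi / 2 else -(Real.pi / 2)) : ℝ) : ℂ) + Complex.I / 2 * ((0 : ℝ) : ℂ)))
    ?_ ?_
  · rw [htop, hsum, hsum]
    have e1 : halfSign a = if 0 < a then 1 / 2 else -(1 / 2) := by simp [halfSign]
    have e2 : halfSign (Y - a) = if 0 < u then 1 / 2 else -(1 / 2) := by simp [halfSign, hu]
    rw [e1, e2]
    split_ifs <;> push_cast <;> ring
  · have hl := (tendsto_log_ratio a u v ha hu0).mono_left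
      (by rw [IsOrderBornology.cobounded_eq]; exact le_sup_left :
        (atBot : Filter ℝ) ≤ Bornology.cobounded ℝ)
    exact (((Complex.continuous_ofReal.tendsto _).comp ((tendsto_arctan_atBot a 0 ha).add
      (tendsto_arctan_atBot u v hu0))).add (((Complex.continuous_ofReal.tendsto _).comp
        hl).const_mul _)).const_mul _
  · have hl := (tendsto_log_ratio a u v ha hu0).mono_left
      (by rw [IsOrderBornology.cobounded_eq]; exact le_sup_right :
        (atTop : Filter ℝ) ≤ Bornology.cobounded ℝ)
    exact (((Complex.continuous_ofReal.tendsto _).comp ((tendsto_arctan_atTop a 0 ha).add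
      (tendsto_arctan_atTop u v hu0))).add (((Complex.continuous_ofReal.tendsto _).comp
        hl).const_mul _)).const_mul _

end

/-! ### The hyperbolic cotangent and the sum over Matsubara frequencies. -/

section

/-- `coth (w / 2T) / 2`. -/
def halfCoth (T : ℝ) (w : ℂ) : ℂ :=
  1 / 2 * ((1 + Complex.exp (-(w / T))) / (1 - Complex.exp (-(w / T))))

/-- The group of the Matsubara frequencies of scalar lines, times `i`. -/
def matsubaraGroup (T : ℝ) : AddSubgroup ℂ := AddSubgroup.zmultiples (2 * Real.pi * T * Complex.I)

lemma mem_matsubaraGroup {T : ℝ} {w : ℂ} :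
    w ∈ matsubaraGroup T ↔ ∃ n : ℤ, w = Complex.I * (2 * Real.pi * T * n) := by
  rw [matsubaraGroup, AddSubgroup.mem_zmultiples_iff]
  constructor
  · rintro ⟨n, rfl⟩; exact ⟨n, by simp; ring⟩
  · rintro ⟨n, rfl⟩; exact ⟨n, by simp; ring⟩

lemma exp_ne_one_of_re_ne_zero {w : ℂ} (hw : w.re ≠ 0) : Complex.exp w ≠ 1 := by
  intro h
  have h1 := congrArg norm h
  rw [Complex.norm_exp, norm_one, Real.exp_eq_one_iff] at h1
  exact hw h1

lemma re_div_real {T : ℝ} (hT : T ≠ 0) {w : ℂ} (hw : w.re ≠ 0) : (-(w / T)).re ≠ 0 := by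
  rw [Complex.neg_re, Complex.div_ofReal_re]
  exact neg_ne_zero.2 (div_ne_zero hw hT)

lemma sum_Icc_neg (f : ℤ → ℂ) (M : ℕ) : ∑ n ∈ Finset.Icc (-(M : ℤ)) M, f n =
    f 0 + ∑ j ∈ Finset.range M, (f (j + 1) + f (-(j + 1))) := by
  induction M with
  | zero => simp
  | succ M ih =>
    have h : Finset.Icc (-((M + 1 : ℕ) : ℤ)) ((M + 1 : ℕ) : ℤ) =
        insert ((M : ℤ) + 1) (insert (-((M : ℤ) + 1)) (Finset.Icc (-(M : ℤ)) M)) := by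
      ext n
      simp only [Finset.mem_insert, Finset.mem_Icc]
      omega
    rw [h, Finset.sum_insert, Finset.sum_insert, ih, Finset.sum_range_succ]
    · ring
    · simp only [Finset.mem_Icc]; omega
    · simp only [Finset.mem_insert, Finset.mem_Icc]; omega

/-- Euler's partial fraction expansion of the cotangent. The series is not absolutely convergent;
pairing `n` with `-n` yields the terms of that expansion. -/
lemma tendsto_sum_inv_add {ζ : ℂ} (hζ : ζ ∈ Complex.integerComplement) :
    Tendsto (fun M : ℕ => ∑ n ∈ Finset.Icc (-(M : ℤ)) M, ((n : ℂ) + ζ)⁻¹) atTop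
      (𝓝 (Real.pi * Complex.cot (Real.pi * ζ))) := by
  have h := (tendsto_logDeriv_euler_cot_sub hζ).const_add (1 / ζ)
  rw [add_sub_cancel] at h
  refine h.congr fun M => ?_
  rw [sum_Icc_neg]
  congr 1
  · simp
  · refine Finset.sum_congr rfl fun j _ => ?_
    rw [cotTerm, one_div, one_div, add_comm]
    push_cast
    congr 2
    · ring
    · ring

/-- The substitution `ζ = iw / 2πT` turns the cotangent into `coth(w / 2T)`; a nonzero real part of
`w` keeps `ζ` away from the integers. -/
lemma tendsto_sum_inv_sub_freq {T : ℝ} (hT : 0 < T) {w : ℂ} (hw : w.re ≠ 0) :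
    Tendsto (fun M : ℕ => ∑ n ∈ Finset.Icc (-(M : ℤ)) M,
      (w - Complex.I * (2 * Real.pi * T * n))⁻¹) atTop (𝓝 ((T : ℂ)⁻¹ * halfCoth T w)) := by
  have hπ : (Real.pi : ℂ) ≠ 0 := by exact_mod_cast Real.pi_ne_zero
  have hT0 : (T : ℂ) ≠ 0 := by exact_mod_cast hT.ne'
  set ζ : ℂ := Complex.I * w / (2 * Real.pi * T) with hζ
  have hζm : ζ ∈ Complex.integerComplement := by
    rintro ⟨n, hn⟩
    apply hw
    have : w = -Complex.I * (2 * Real.pi * T * n) := by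
      rw [hn, hζ]; field_simp; rw [Complex.I_sq]; ring
    rw [this]
    simp
  have h := (tendsto_sum_inv_add hζm).const_mul (Complex.I / (2 * Real.pi * T))
  have e : Complex.I / (2 * Real.pi * T) * (Real.pi * Complex.cot (Real.pi * ζ)) =
      (T : ℂ)⁻¹ * halfCoth T w := by
    rw [Complex.cot_pi_eq_exp_ratio, halfCoth]
    have : 2 * Real.pi * Complex.I * ζ = -(w / T) := by
      rw [hζ]; field_simp; rw [Complex.I_sq]; ring
    rw [this]
    have h1 := exp_ne_one_of_re_ne_zero (re_div_real hT.ne' hw)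
    have h2 : 1 - Complex.exp (-(w / T)) ≠ 0 := sub_ne_zero.2 h1.symm
    field_simp
    ring
  rw [e] at h
  refine h.congr fun M => ?_
  rw [Finset.mul_sum]
  refine Finset.sum_congr rfl fun n _ => ?_
  have : w - Complex.I * (2 * Real.pi * T * n) = -Complex.I * (2 * Real.pi * T) * (n + ζ) := by
    rw [hζ]; field_simp; ring_nf; rw [Complex.I_sq]; ring
  rw [this, mul_inv, mul_inv, inv_neg, Complex.inv_I]
  ring

lemma tendsto_sum_inv_add_freq {T : ℝ} (hT : 0 < T) {w : ℂ} (hw : w.re ≠ 0) :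
    Tendsto (fun M : ℕ => ∑ n ∈ Finset.Icc (-(M : ℤ)) M,
      (w + Complex.I * (2 * Real.pi * T * n))⁻¹) atTop (𝓝 ((T : ℂ)⁻¹ * halfCoth T w)) := by
  refine (tendsto_sum_inv_sub_freq hT hw).congr fun M => ?_
  refine Finset.sum_nbij' (fun n => -n) (fun n => -n) ?_ ?_ (by simp) (by simp) ?_
  · intro n hn; simp only [Finset.mem_Icc] at hn ⊢; omega
  · intro n hn; simp only [Finset.mem_Icc] at hn ⊢; omega
  · intro n _; push_cast; congr 1; ring

/-- The discrete counterpart of `integral_mul_propagators`. The sum converges absolutely, so it may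
be computed over symmetric intervals, where the two halves of the partial fraction converge
separately. -/
lemma hasSum_mul_propagators {T : ℝ} (hT : 0 < T) {w Y : ℂ} (hw : w.re ≠ 0) (hY : Y.re ≠ 0)
    (hYw : Y.re ≠ w.re) :
    HasSum (fun n : ℤ => ((w - Complex.I * (2 * Real.pi * T * n)) *
      (Y - (w - Complex.I * (2 * Real.pi * T * n))))⁻¹)
      ((T : ℂ)⁻¹ * (Y⁻¹ * (halfCoth T w + halfCoth T (Y - w)))) ∧
    Summable (fun n : ℤ => ‖((w - Complex.I * (2 * Real.pi * T * n)) *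
      (Y - (w - Complex.I * (2 * Real.pi * T * n))))⁻¹‖) := by
  have hre1 : ∀ n : ℤ, (w - Complex.I * (2 * Real.pi * T * n)).re = w.re := fun n => by simp
  have him1 : ∀ n : ℤ, (w - Complex.I * (2 * Real.pi * T * n)).im =
      -(2 * Real.pi * T * n + -w.im) := fun n => by simp; ring
  have hre2 : ∀ n : ℤ, (Y - (w - Complex.I * (2 * Real.pi * T * n))).re = Y.re - w.re :=
    fun n => by simp
  have him2 : ∀ n : ℤ, (Y - (w - Complex.I * (2 * Real.pi * T * n))).im =
      2 * Real.pi * T * n + (Y.im - w.im) := fun n => by simp; ring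
  have hu0 : Y.re - w.re ≠ 0 := sub_ne_zero.2 hYw
  have ha : 2 * Real.pi * T ≠ 0 := by positivity
  have hs : Summable (fun n : ℤ => ‖((w - Complex.I * (2 * Real.pi * T * n)) *
      (Y - (w - Complex.I * (2 * Real.pi * T * n))))⁻¹‖) := by
    refine Summable.of_nonneg_of_le (fun _ => norm_nonneg _) (fun n => ?_)
      (((summable_decay one_lt_two ha (-w.im)).add (summable_decay one_lt_two ha
        (Y.im - w.im))).mul_left ((1 + |w.re|⁻¹) * (1 + |Y.re - w.re|⁻¹)))
    have := norm_inv_mul_le (w := w - Complex.I * (2 * Real.pi * T * n))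
      (w' := Y - (w - Complex.I * (2 * Real.pi * T * n)))
      (by rw [hre1]; exact hw) (by rw [hre2]; exact hu0)
    rwa [hre1, hre2, him1, him2, abs_neg] at this
  refine ⟨?_, hs⟩
  have h1 := hs.of_norm.hasSum
  have h2 : Tendsto (fun M : ℕ => ∑ n ∈ Finset.Icc (-(M : ℤ)) M,
      ((w - Complex.I * (2 * Real.pi * T * n)) * (Y - (w - Complex.I * (2 * Real.pi * T * n))))⁻¹)
      atTop (𝓝 _) := h1.comp Finset.tendsto_Icc_neg
  have h3 := ((tendsto_sum_inv_sub_freq hT hw).add (tendsto_sum_inv_add_freq (w := Y - w) hT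
    (by simpa using hu0))).const_mul Y⁻¹
  have hYne : Y ≠ 0 := fun h => hY (by rw [h]; rfl)
  have h4 := tendsto_nhds_unique h2 (h3.congr fun M => by
    rw [← Finset.sum_add_distrib, Finset.mul_sum]
    refine Finset.sum_congr rfl fun n _ => ?_
    have hz1 : w - Complex.I * (2 * Real.pi * T * n) ≠ 0 := fun h => hw (by rw [← hre1 n, h]; rfl)
    have hz2 : Y - (w - Complex.I * (2 * Real.pi * T * n)) ≠ 0 :=
      fun h => hu0 (by rw [← hre2 n, h]; rfl)
    have e : Y - w + Complex.I * (2 * Real.pi * T * n) =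
      Y - (w - Complex.I * (2 * Real.pi * T * n)) := by ring
    rw [e]
    generalize w - Complex.I * (2 * Real.pi * T * n) = a at hz1 hz2
    rw [inv_add_inv hz1 hz2, mul_inv, add_sub_cancel, div_eq_mul_inv, mul_inv,
      inv_mul_cancel_left₀ hYne])
  rw [h4, ← mul_add, mul_left_comm] at h1
  exact h1

lemma halfCoth_add {T : ℝ} (hT : T ≠ 0) {γ : ℂ} (hγ : γ ∈ matsubaraGroup T) (w : ℂ) :
    halfCoth T (w + γ) = halfCoth T w := by
  obtain ⟨n, rfl⟩ := mem_matsubaraGroup.1 hγ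
  have hT0 : (T : ℂ) ≠ 0 := by exact_mod_cast hT
  have : -((w + Complex.I * (2 * Real.pi * T * n)) / T) = -(w / T) + (-n : ℤ) * (2 * Real.pi * Complex.I) := by
    push_cast; field_simp; ring
  rw [halfCoth, halfCoth, this, Complex.exp_add, Complex.exp_int_mul_two_pi_mul_I, mul_one]

lemma halfSign_add {γ : ℂ} (hγ : γ ∈ imaginary) (w : ℂ) : halfSign (w + γ) = halfSign w := by
  rw [mem_imaginary] at hγ
  simp [halfSign, hγ]

variable {V I : Type*} [Fintype V] [Fintype I]

lemma energyIntegral_count {T : ℝ} (hT : 0 < T) {z₀ : I → ℂ} (J : Set I)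
    (h : ∀ i ∈ J, (z₀ i).re ≠ 0) :
    EnergyIntegral (Measure.count : Measure ℤ) (T : ℂ)⁻¹ (halfCoth T) (matsubaraGroup T) z₀ J
      (fun i n => z₀ i - Complex.I * (2 * Real.pi * T * n)) where
  re_eq_zero γ hγ := by
    obtain ⟨n, rfl⟩ := mem_matsubaraGroup.1 hγ
    simp
  periodic γ hγ w := halfCoth_add hT.ne' hγ w
  re_ne_zero := h
  sub_mem i _ n := mem_matsubaraGroup.2 ⟨-n, by push_cast; ring⟩
  integral_eq i hi Y hY hYw := by
    obtain ⟨h1, h2⟩ := hasSum_mul_propagators hT (h i hi) hY hYw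
    have h3 := integrable_count_iff.2 h2
    refine ⟨h3, ?_⟩
    rw [integral_countable h3, ← h1.tsum_eq]
    simp [Measure.real]

lemma energyIntegral_volume {s : I → ℝ} (J : Set I) (h : ∀ i ∈ J, s i ≠ 0) :
    EnergyIntegral (volume : Measure ℝ) (2 * Real.pi) halfSign imaginary (fun i => (s i : ℂ)) J
      (fun i k => s i - Complex.I * k) where
  re_eq_zero γ hγ := mem_imaginary.1 hγ
  periodic γ hγ w := halfSign_add hγ w
  re_ne_zero i hi := by simpa using h i hi
  sub_mem i _ k := by rw [mem_imaginary]; simp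
  integral_eq i hi Y hY hYw := integral_mul_propagators _ (h i hi) Y hY (by simpa using hYw)

/-! ### The addition law on the cuts -/

/-- The sign with which the line `i` crosses the boundary of `T`. -/
def crossSign (G : FeynmanGraph V I) (T : Finset V) (i : I) : ℤ :=
  (if G.src i ∈ T then 1 else 0) - (if G.tgt i ∈ T then 1 else 0)

/-- No nontrivial combination with coefficients `0, ±1` of the numbers `s i` vanishes. -/
def GenericEnergies (s : I → ℝ) : Prop :=
  ∀ c : I → ℤ, (∀ i, |c i| ≤ 1) → c ≠ 0 → ∑ i, c i * s i ≠ 0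

lemma cutWeight_lineWeight (x : ℂ) {a b : V} (hab : a ≠ b) (T : Finset V) :
    cutWeight (lineWeight x a b) T Tᶜ =
      if a ∈ T ∧ b ∉ T then x + 1 / 2 else if a ∉ T ∧ b ∈ T then x - 1 / 2 else 1 := by
  have h1 : ∀ p q, lineWeight x a b p q = (if p = a then (if q = b then x + 1 / 2 else 1) else 1) *
      (if p = b then (if q = a then x - 1 / 2 else 1) else 1) := by
    intro p q
    unfold lineWeight
    by_cases hpa : p = a
    · have hpb : p ≠ b := fun h => hab (hpa.symm.trans h)
      simp [hpa, hab]
    · simp [hpa, ← ite_and]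
  simp only [cutWeight, pairWeight, h1, Finset.prod_mul_distrib, Finset.prod_ite_eq']
  by_cases ha : a ∈ T <;> by_cases hb : b ∈ T <;> simp [ha, hb, Finset.prod_ite_eq']

lemma cutWeight_linesWeight (G : FeynmanGraph V I) {S : Finset I} (x : I → ℂ)
    (hS : ∀ i ∈ S, G.src i ≠ G.tgt i) (T : Finset V) :
    cutWeight (linesWeight G S x) T Tᶜ = ∏ i ∈ S,
      if G.src i ∈ T ∧ G.tgt i ∉ T then x i + 1 / 2
      else if G.src i ∉ T ∧ G.tgt i ∈ T then x i - 1 / 2 else 1 := by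
  have : cutWeight (linesWeight G S x) T Tᶜ =
      ∏ i ∈ S, cutWeight (lineWeight (x i) (G.src i) (G.tgt i)) T Tᶜ := by
    simp only [cutWeight, pairWeight, linesWeight_apply]
    rw [Finset.prod_comm (s := S)]
    refine Finset.prod_congr rfl fun q _ => ?_
    rw [Finset.prod_comm]
  rw [this]
  exact Finset.prod_congr rfl fun i hi => cutWeight_lineWeight _ (hS i hi) T

lemma cutWeight_linesWeight' (G : FeynmanGraph V I) {S : Finset I} (x : I → ℂ)
    (hS : ∀ i ∈ S, G.src i ≠ G.tgt i) (T : Finset V) :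
    cutWeight (linesWeight G S x) Tᶜ T = ∏ i ∈ S,
      if G.src i ∈ T ∧ G.tgt i ∉ T then x i - 1 / 2
      else if G.src i ∉ T ∧ G.tgt i ∈ T then x i + 1 / 2 else 1 := by
  have := cutWeight_linesWeight G x hS Tᶜ
  rw [compl_compl] at this
  rw [this]
  refine Finset.prod_congr rfl fun i _ => ?_
  simp only [Finset.mem_compl, not_not]
  split_ifs <;> simp_all

lemma total_bdry_re (G : FeynmanGraph V I) (S : Finset I) (z : I → ℂ) (T : Finset V) :
    (total (bdry G S z) T).re = ∑ i ∈ S, crossSign G T i * (z i).re := by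
  rw [total_bdry, Complex.re_sum]
  refine Finset.sum_congr rfl fun i _ => ?_
  unfold crossSign
  split_ifs <;> simp

/-- The real part is a combination of the line energies with coefficients `0, ±1`, nontrivial
because some line crosses the cut. Genericity is tailored to this. -/
lemma total_bdry_re_ne_zero {G : FeynmanGraph V I} {S : Finset I} {z : I → ℂ}
    (hz : GenericEnergies fun i => (z i).re) {T : Finset V} (hT : ∃ i ∈ S, Crosses G T i) :
    (total (bdry G S z) T).re ≠ 0 := by
  rw [total_bdry_re]
  have h := hz (fun i => if i ∈ S then crossSign G T i else 0) ?_ ?_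
  · convert h using 1
    simp [apply_ite (Int.cast : ℤ → ℝ), ite_mul, Finset.sum_ite_mem]
  · intro i
    unfold crossSign
    split_ifs <;> simp
  · obtain ⟨i, hi, hc⟩ := hT
    intro h0
    have := congrFun h0 i
    simp only [hi, if_true, Pi.zero_apply, crossSign] at this
    rcases hc with hc | hc <;> simp [hc] at this

/-- For `x = coth(z / 2T) / 2` the ratio `(x - 1/2) / (x + 1/2)` equals `exp(-z / T)`. Over a cut
the exponentials multiply to `exp(-Z / T)` for the total energy `Z`, and the law becomes the
definition of `coth(Z / 2T)`. -/
lemma cutLaw_halfCoth {G : FeynmanGraph V I} {T : ℝ} (hT : 0 < T) {t N : Finset I}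
    (hN : ∀ i ∈ N, G.src i ≠ G.tgt i)
    (ht : ∀ U : Finset V, U.Nonempty → U ≠ Finset.univ → ∃ i ∈ t, Crosses G U i)
    {z₀ : I → ℂ} (h0 : GenericEnergies fun i => (z₀ i).re) (hz : ∀ i, (z₀ i).re ≠ 0) :
    CutLaw G t N (halfCoth T) z₀ := by
  intro S htS hSN U hU hU'
  have hre : (total (bdry G S z₀) U).re ≠ 0 := by
    obtain ⟨i, hi, hc⟩ := ht U hU hU'
    exact total_bdry_re_ne_zero h0 ⟨i, htS hi, hc⟩
  refine ⟨hre, ?_⟩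
  set Z := total (bdry G S z₀) U with hZ
  have key : cutWeight (linesWeight G S (halfCoth T ∘ z₀)) Uᶜ U =
      cutWeight (linesWeight G S (halfCoth T ∘ z₀)) U Uᶜ * Complex.exp (-(Z / T)) := by
    have e : Complex.exp (-(Z / T)) = ∏ i ∈ S, Complex.exp (-(z₀ i *
        ((if G.src i ∈ U then 1 else 0) - (if G.tgt i ∈ U then 1 else 0)) / T)) := by
      rw [← Complex.exp_sum, hZ, total_bdry, Finset.sum_div, Finset.sum_neg_distrib]
    rw [cutWeight_linesWeight' G _ (fun i hi => hN i (hSN hi)),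
      cutWeight_linesWeight G _ (fun i hi => hN i (hSN hi)), e, ← Finset.prod_mul_distrib]
    refine Finset.prod_congr rfl fun i _ => ?_
    have h1 := exp_ne_one_of_re_ne_zero (re_div_real hT.ne' (hz i))
    have h2 : 1 - Complex.exp (-(z₀ i / T)) ≠ 0 := sub_ne_zero.2 h1.symm
    have h3 := Complex.exp_ne_zero (-(z₀ i / T))
    by_cases ha : G.src i ∈ U <;> by_cases hb : G.tgt i ∈ U
    · simp [ha, hb]
    · simp only [ha, hb, Function.comp, halfCoth]
      simp
      field_simp
      ring
    · simp only [ha, hb, Function.comp, halfCoth]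
      simp
      have : Complex.exp (z₀ i / T) = (Complex.exp (-(z₀ i / T)))⁻¹ := by
        rw [← Complex.exp_neg, neg_neg]
      rw [neg_div, neg_neg, this]
      field_simp
      ring
    · simp [ha, hb]
  rw [key]
  have h1 := exp_ne_one_of_re_ne_zero (re_div_real hT.ne' hre)
  have h2 : 1 - Complex.exp (-(Z / T)) ≠ 0 := sub_ne_zero.2 h1.symm
  rw [halfCoth]
  field_simp

/-- A factor `χ ± 1/2` of a crossing line vanishes unless its energy crosses in the matching
direction. If both directions occur, both cut weights vanish; if only one occurs, it is also the
sign of the total energy and one weight vanishes. -/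
lemma cutLaw_halfSign {G : FeynmanGraph V I} {t N : Finset I}
    (hN : ∀ i ∈ N, G.src i ≠ G.tgt i)
    (ht : ∀ U : Finset V, U.Nonempty → U ≠ Finset.univ → ∃ i ∈ t, Crosses G U i)
    {z₀ : I → ℂ} (h0 : GenericEnergies fun i => (z₀ i).re) :
    CutLaw G t N halfSign z₀ := by
  intro S htS hSN U hU hU'
  obtain ⟨j, hj, hc⟩ := ht U hU hU'
  have hjS := htS hj
  have hre := total_bdry_re_ne_zero h0 ⟨j, hjS, hc⟩
  refine ⟨hre, ?_⟩
  rw [cutWeight_linesWeight' G _ (fun i hi => hN i (hSN hi)),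
    cutWeight_linesWeight G _ (fun i hi => hN i (hSN hi))]
  rw [total_bdry_re] at hre
  have hZ : halfSign (total (bdry G S z₀) U) =
      if 0 < ∑ i ∈ S, crossSign G U i * (z₀ i).re then 1 / 2 else -(1 / 2) := by
    rw [halfSign, total_bdry_re]
  rw [hZ]
  set P : I → ℂ := fun i => if G.src i ∈ U ∧ G.tgt i ∉ U then (halfSign ∘ z₀) i + 1 / 2
      else if G.src i ∉ U ∧ G.tgt i ∈ U then (halfSign ∘ z₀) i - 1 / 2 else 1 with hP
  set Q : I → ℂ := fun i => if G.src i ∈ U ∧ G.tgt i ∉ U then (halfSign ∘ z₀) i - 1 / 2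
      else if G.src i ∉ U ∧ G.tgt i ∈ U then (halfSign ∘ z₀) i + 1 / 2 else 1 with hQ
  have hP0 : ∀ i, crossSign G U i * (z₀ i).re < 0 → P i = 0 := by
    intro i hi
    simp only [hP, Function.comp, halfSign]
    unfold crossSign at hi
    by_cases ha : G.src i ∈ U <;> by_cases hb : G.tgt i ∈ U <;> simp [ha, hb] at hi ⊢ <;>
      simp [hi, not_lt.2 hi.le]
  have hQ0 : ∀ i, 0 < crossSign G U i * (z₀ i).re → Q i = 0 := by
    intro i hi
    simp only [hQ, Function.comp, halfSign]
    unfold crossSign at hi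
    by_cases ha : G.src i ∈ U <;> by_cases hb : G.tgt i ∈ U <;> simp [ha, hb] at hi ⊢ <;>
      simp [hi, not_lt.2 hi.le]
  by_cases hneg : ∃ i ∈ S, crossSign G U i * (z₀ i).re < 0
  · obtain ⟨i, hi, hi0⟩ := hneg
    rw [Finset.prod_eq_zero (f := P) hi (hP0 i hi0)]
    by_cases hpos : ∃ i ∈ S, 0 < crossSign G U i * (z₀ i).re
    · obtain ⟨i', hi', hi0'⟩ := hpos
      rw [Finset.prod_eq_zero (f := Q) hi' (hQ0 i' hi0')]
      simp
    · push Not at hpos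
      rw [if_neg (not_lt.2 (Finset.sum_nonpos hpos))]
      ring
  · push Not at hneg
    have hpos : 0 < ∑ i ∈ S, crossSign G U i * (z₀ i).re :=
      lt_of_le_of_ne (Finset.sum_nonneg hneg) hre.symm
    obtain ⟨i, hi, hi0⟩ : ∃ i ∈ S, 0 < crossSign G U i * (z₀ i).re := by
      by_contra h
      push Not at h
      exact absurd (Finset.sum_nonpos h) (not_le.2 hpos)
    rw [Finset.prod_eq_zero (f := Q) hi (hQ0 i hi0), if_pos hpos]
    ring

end

section

variable {V I M : Type*} [Fintype V] [Fintype I] [AddCommGroup M]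

/-! ### Flows parametrised by the independent energies -/

/-- The flow with divergence `d` that takes the values `x` outside the spanning tree `t`. -/
def treeFlow (G : FeynmanGraph V I) (t : Finset I) (d : V → M) (x : I → M) : I → M :=
  Classical.epsilon fun k => (∀ i ∉ t, k i = x i) ∧ ∀ v, divergence G k v = d v

/-- The lines that are not self-loops. -/
def nonLoops (G : FeynmanGraph V I) : Finset I := Finset.univ.filter fun i => G.src i ≠ G.tgt i

lemma mem_nonLoops {G : FeynmanGraph V I} {i : I} : i ∈ nonLoops G ↔ G.src i ≠ G.tgt i := by
  simp [nonLoops]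

variable {G : FeynmanGraph V I} {t : Finset I}

lemma GrownTree.treeFlow_spec (ht : GrownTree G Finset.univ t) {d : V → M} (hd : ∑ v, d v = 0)
    (x : I → M) : (∀ i ∉ t, treeFlow G t d x i = x i) ∧
      ∀ v, divergence G (treeFlow G t d x) v = d v :=
  Classical.epsilon_spec (ht.exists_flow_extending d hd x)

lemma divergence_congr {k l : I → M} (h : ∀ i ∈ nonLoops G, k i = l i) (v : V) :
    divergence G k v = divergence G l v := by
  unfold divergence
  refine Finset.sum_congr rfl fun i _ => ?_
  by_cases hi : G.src i = G.tgt i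
  · simp [hi]
  · rw [h i (mem_nonLoops.2 hi)]

lemma GrownTree.flow_unique_nonLoops (ht : GrownTree G Finset.univ t) {k l : I → M}
    (h1 : ∀ i ∈ nonLoops G, i ∉ t → k i = l i)
    (h2 : ∀ v, divergence G k v = divergence G l v) : ∀ i ∈ nonLoops G, k i = l i := by
  have h := ht.flow_unique (k := k) (l := fun i => if i ∈ nonLoops G then l i else k i)
    (fun i hi => by
      split_ifs with h
      · exact h1 i h hi
      · rfl)
    (fun v => (h2 v).trans (divergence_congr (fun i hi => by simp [hi]) v))
  intro i hi
  have := congrFun h i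
  simpa [hi] using this

lemma GrownTree.subset_nonLoops {W : Finset V} (ht : GrownTree G W t) : t ⊆ nonLoops G :=
  fun i hi => mem_nonLoops.2 (ht.src_ne_tgt i hi)

variable {κ : Type*} [Fintype κ]

/-- `c` enumerates the lines outside `t` that are not self-loops. -/
structure Enumerates (G : FeynmanGraph V I) (t : Finset I) (c : κ → I) : Prop where
  injective : Function.Injective c
  range : ∀ i, (∃ j, c j = i) ↔ i ∈ nonLoops G ∧ i ∉ t

/-- The flow for given values of the independent energies. -/
def coordFlow (G : FeynmanGraph V I) (t : Finset I) (d : V → M) (c : κ → I) (x : κ → M) : I → M :=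
  treeFlow G t d (Function.extend c x 0)

section coord

variable {c : κ → I} (ht : GrownTree G Finset.univ t) (hc : Enumerates G t c) {d : V → M}
  (hd : ∑ v, d v = 0)

include ht hc hd

lemma coordFlow_coord (x : κ → M) (j : κ) : coordFlow G t d c x (c j) = x j := by
  rw [coordFlow, (ht.treeFlow_spec hd _).1 _ ((hc.range _).1 ⟨j, rfl⟩).2, hc.injective.extend_apply]

lemma divergence_coordFlow (x : κ → M) (v : V) : divergence G (coordFlow G t d c x) v = d v :=
  (ht.treeFlow_spec hd _).2 v

lemma coordFlow_eq_on_nonLoops {x : κ → M} {k : I → M} (h1 : ∀ j, k (c j) = x j)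
    (h2 : ∀ v, divergence G k v = d v) : ∀ i ∈ nonLoops G, coordFlow G t d c x i = k i := by
  refine ht.flow_unique_nonLoops (fun i hi hit => ?_) fun v => ?_
  · obtain ⟨j, rfl⟩ := (hc.range i).2 ⟨hi, hit⟩
    rw [coordFlow_coord ht hc hd, h1]
  · rw [divergence_coordFlow ht hc hd, h2]

/-- The lines outside any other spanning tree also determine the flow, so they can serve as
coordinates in place of those outside `t`. -/
lemma coordFlow_injective_on {t' : Finset I} (ht' : GrownTree G Finset.univ t') {x x' : κ → M}
    (h : ∀ i ∈ nonLoops G, i ∉ t' → coordFlow G t d c x i = coordFlow G t d c x' i) : x = x' := by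
  have := ht'.flow_unique_nonLoops h fun v => by
    rw [divergence_coordFlow ht hc hd, divergence_coordFlow ht hc hd]
  funext j
  rw [← coordFlow_coord ht hc hd x j, ← coordFlow_coord ht hc hd x' j]
  exact this _ ((hc.range _).1 ⟨j, rfl⟩).1

end coord

lemma Enumerates.card {c : κ → I} (hc : Enumerates G t c) :
    Fintype.card κ = (nonLoops G \ t).card := by
  rw [← Finset.card_univ, ← Finset.card_image_of_injective _ hc.injective]
  congr 1
  ext i
  simp [hc.range]

lemma enumerates_subtype (G : FeynmanGraph V I) (t : Finset I) :
    Enumerates G t (fun i : {i // i ∈ nonLoops G \ t} => i.1) where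
  injective := Subtype.val_injective
  range i := by simp

lemma GrownTree.card_nonLoops_sdiff {t' : Finset I} (ht : GrownTree G Finset.univ t)
    (ht' : GrownTree G Finset.univ t') : (nonLoops G \ t).card = (nonLoops G \ t').card := by
  rw [Finset.card_sdiff_of_subset ht.subset_nonLoops, Finset.card_sdiff_of_subset ht'.subset_nonLoops]
  have h1 := ht.card
  have h2 := ht'.card
  omega

/-! ### Absolute convergence -/

lemma prod_coe_sort_nonLoops (t : Finset I) (f : I → ℝ) :
    ∏ i : {i // i ∈ nonLoops G \ t}, f i = ∏ i ∈ nonLoops G \ t, f i :=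
  Finset.prod_coe_sort _ _

/-- In the coordinates outside `t'` the function is a product of integrable functions of one
variable. The passage to these coordinates is affine and invertible: its linear part is the flow
without sources, its translation the flow at `0`. -/
lemma GrownTree.integrable_decay_sdiff {c : κ → I} (ht : GrownTree G Finset.univ t)
    (hc : Enumerates G t c) {d : V → ℝ} (hd : ∑ v, d v = 0) {t' : Finset I}
    (ht' : GrownTree G Finset.univ t') {q : ℝ} (hq : 1 < q) :
    Integrable (fun x : κ → ℝ => ∏ i ∈ nonLoops G \ t', (1 + |coordFlow G t d c x i|) ^ (-q)) := by
  have h0 : ∑ v : V, (0 : V → ℝ) v = 0 := by simp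
  let A : (κ → ℝ) →ₗ[ℝ] ({i // i ∈ nonLoops G \ t'} → ℝ) :=
    { toFun := fun x i => coordFlow G t 0 c x i
      map_add' := fun x y => by
        funext i
        exact coordFlow_eq_on_nonLoops ht hc h0 (k := coordFlow G t 0 c x + coordFlow G t 0 c y)
          (fun j => by simp [coordFlow_coord ht hc h0])
          (fun v => by rw [divergence_add]; simp [divergence_coordFlow ht hc h0]) i
          (Finset.mem_sdiff.1 i.2).1
      map_smul' := fun a x => by
        funext i
        exact coordFlow_eq_on_nonLoops ht hc h0 (k := a • coordFlow G t 0 c x)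
          (fun j => by simp [coordFlow_coord ht hc h0])
          (fun v => by
            have : divergence G (a • coordFlow G t 0 c x) v =
                a * divergence G (coordFlow G t 0 c x) v := by
              simp only [divergence, Finset.mul_sum, Pi.smul_apply, smul_eq_mul]
              exact Finset.sum_congr rfl fun i _ => by split_ifs <;> ring
            rw [this, divergence_coordFlow ht hc h0]; simp) i
          (Finset.mem_sdiff.1 i.2).1 }
  have hA : ∀ x i, A x i = coordFlow G t 0 c x i := fun x i => rfl
  have hinj : Function.Injective A := fun x x' h =>
    coordFlow_injective_on ht hc h0 ht' fun i hi hit => by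
      have := congrFun h ⟨i, by simp [hi, hit]⟩
      simpa [hA] using this
  have hrank : Module.finrank ℝ (κ → ℝ) = Module.finrank ℝ ({i // i ∈ nonLoops G \ t'} → ℝ) := by
    rw [Module.finrank_fintype_fun_eq_card, Module.finrank_fintype_fun_eq_card, hc.card,
      ht.card_nonLoops_sdiff ht', Fintype.card_coe]
  let e := (LinearMap.linearEquivOfInjective A hinj hrank).toContinuousLinearEquiv
  have he : ∀ x, e x = A x := fun x => rfl
  have hf : Integrable (fun y : {i // i ∈ nonLoops G \ t'} → ℝ =>
      ∏ i, (1 + |y i + coordFlow G t d c 0 i|) ^ (-q)) :=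
    Integrable.fintype_prod (f := fun (i : {i // i ∈ nonLoops G \ t'}) (y : ℝ) => (1 + |y + coordFlow G t d c 0 i|) ^ (-q))
      fun i => integrable_decay hq _
  -- By uniqueness of Haar measure the image of Lebesgue measure is a multiple of it, so no
  -- determinant is needed.
  have hmap := e.isAddHaarMeasure_map (volume : Measure (κ → ℝ))
  have hsmul := Measure.isAddLeftInvariant_eq_smul (Measure.map e (volume : Measure (κ → ℝ)))
    (volume : Measure ({i // i ∈ nonLoops G \ t'} → ℝ))
  have h1 : Integrable (fun y : {i // i ∈ nonLoops G \ t'} → ℝ =>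
      ∏ i, (1 + |y i + coordFlow G t d c 0 i|) ^ (-q))
      (Measure.map e (volume : Measure (κ → ℝ))) := by
    rw [hsmul]
    exact hf.smul_measure_nnreal
  have h2 := (integrable_map_equiv e.toHomeomorph.toMeasurableEquiv _).1 h1
  refine h2.congr (ae_of_all _ fun x => ?_)
  dsimp only [Function.comp]
  rw [← prod_coe_sort_nonLoops]
  refine Finset.prod_congr rfl fun i _ => ?_
  have hx : coordFlow G t d c x i = coordFlow G t 0 c x i + coordFlow G t d c 0 i :=
    coordFlow_eq_on_nonLoops ht hc hd (k := coordFlow G t 0 c x + coordFlow G t d c 0)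
      (fun j => by simp [coordFlow_coord ht hc h0, coordFlow_coord ht hc hd])
      (fun v => by
        rw [divergence_add]; simp [divergence_coordFlow ht hc h0, divergence_coordFlow ht hc hd]) i
      (Finset.mem_sdiff.1 i.2).1
  rw [hx]
  rfl

lemma pi_count [Countable M] [MeasurableSpace M] [MeasurableSingletonClass M] :
    Measure.pi (fun _ : κ => (Measure.count : Measure M)) = Measure.count := by
  refine Measure.ext_of_singleton fun a => ?_
  rw [Measure.pi_singleton, Measure.count_singleton]
  simp

/-- Over the integers injectivity of the change of coordinates is enough: the family is part of a
summable product family. -/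
lemma GrownTree.summable_decay_sdiff {c : κ → I} (ht : GrownTree G Finset.univ t)
    (hc : Enumerates G t c) {d : V → ℤ} (hd : ∑ v, d v = 0) {t' : Finset I}
    (ht' : GrownTree G Finset.univ t') {q : ℝ} (hq : 1 < q) {a : ℝ} (ha : a ≠ 0) (b : I → ℝ) :
    Summable (fun x : κ → ℤ => ∏ i ∈ nonLoops G \ t', (1 + |a * coordFlow G t d c x i + b i|) ^ (-q)) := by
  have hf : Integrable (fun y : {i // i ∈ nonLoops G \ t'} → ℤ =>
      ∏ i, (1 + |a * y i + b i|) ^ (-q)) (Measure.pi fun _ => Measure.count) :=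
    Integrable.fintype_prod (f := fun (i : {i // i ∈ nonLoops G \ t'}) (y : ℤ) => (1 + |a * y + b i|) ^ (-q))
      fun i => integrable_count_iff.2 (summable_decay hq ha _).norm
  rw [pi_count] at hf
  have h1 := (integrable_count_iff.1 hf).of_norm
  have hinj : Function.Injective (fun (x : κ → ℤ) (i : {i // i ∈ nonLoops G \ t'}) =>
      coordFlow G t d c x i) := fun x x' h =>
    coordFlow_injective_on ht hc hd ht' fun i hi hit => congrFun h ⟨i, by simp [hi, hit]⟩
  refine (h1.comp_injective hinj).congr fun x => ?_
  exact prod_coe_sort_nonLoops t' fun i => (1 + |a * coordFlow G t d c x i + b i|) ^ (-q)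

/-- Every line that is not a self-loop lies in some spanning tree. The two additional indices
guarantee at least two members, as the exponent `m / (m - 1)` requires. -/
lemma exists_treeFamily (hG : G.IsConnected) : ∃ S : Option (Option I) → Finset I,
    (∀ a, GrownTree G Finset.univ (S a)) ∧ ∀ i ∈ nonLoops G, ∃ a, i ∈ S a := by
  obtain ⟨v⟩ := hG.nonempty
  obtain ⟨t₀, -, -, ht₀⟩ := GrownTree.exists_spanning hG _ {v} ∅ rfl (.single v) (by simp)
  have : ∀ a : Option (Option I), ∃ S : Finset I, GrownTree G Finset.univ S ∧
      ∀ i ∈ nonLoops G, a = some (some i) → i ∈ S := by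
    rintro (_ | _ | i)
    · exact ⟨t₀, ht₀, by simp⟩
    · exact ⟨t₀, ht₀, by simp⟩
    · by_cases hi : i ∈ nonLoops G
      · obtain ⟨S, hS, h⟩ := exists_grownTree_mem hG i (mem_nonLoops.1 hi)
        exact ⟨S, h, by rintro j - hj; cases hj; exact hS⟩
      · exact ⟨t₀, ht₀, by rintro j hj h; cases h; exact absurd hj hi⟩
  choose S hS h using this
  exact ⟨S, hS, fun i hi => ⟨_, h _ i hi rfl⟩⟩

/-- If every element of `N` is in one of the sets `S a`, then a product over `N` is bounded by a sum
of products of larger powers over the complements of these sets. -/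
lemma prod_le_sum_prod_rpow {α : Type*} [Fintype α] (hα : 2 ≤ Fintype.card α) (S : α → Finset I)
    (N : Finset I) (hS : ∀ i ∈ N, ∃ a, i ∈ S a) (w : I → ℝ) (hw : ∀ i, 1 ≤ w i) :
    ∏ i ∈ N, (w i)⁻¹ ≤
      ∑ a, ∏ i ∈ N \ S a, w i ^ (-((Fintype.card α : ℝ) / ((Fintype.card α : ℝ) - 1))) := by
  set m : ℝ := (Fintype.card α : ℝ) with hm
  have hm2 : (2 : ℝ) ≤ m := by rw [hm]; exact_mod_cast hα
  -- Chosen so that `q (m - 1) = m`. It exceeds `1`, which is the gain in decay.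
  set q := m / (m - 1) with hq
  have hq0 : 0 < q := div_pos (by linarith) (by linarith)
  have hw0 : ∀ i, 0 < w i := fun i => lt_of_lt_of_le one_pos (hw i)
  set W := ∏ i ∈ N, (w i)⁻¹ with hW
  have hW0 : 0 < W := Finset.prod_pos fun i _ => inv_pos.2 (hw0 i)
  set A : α → ℝ := fun a => ∏ i ∈ N \ S a, w i ^ (-q) with hA
  have hA0 : ∀ a, 0 < A a := fun a => Finset.prod_pos fun i _ => Real.rpow_pos_of_pos (hw0 i) _
  -- Each line is missing from the complement of at least one tree, so it occurs at most `m - 1`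
  -- times in the product of the `A a`, with a total exponent of at least `-m`. Hence some `A a` is
  -- at least `W`.
  have hprod : W ^ Fintype.card α ≤ ∏ a, A a := by
    have e1 : ∏ a, A a = ∏ i ∈ N, ∏ a, (if i ∈ S a then 1 else w i ^ (-q)) := by
      rw [Finset.prod_comm]
      refine Finset.prod_congr rfl fun a _ => ?_
      simp only [hA]
      rw [Finset.sdiff_eq_filter, Finset.prod_filter]
      exact Finset.prod_congr rfl fun i _ => by simp only [ite_not]
    rw [e1, hW, ← Finset.prod_pow]
    refine Finset.prod_le_prod (fun i _ => by have := hw0 i; positivity) fun i hi => ?_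
    obtain ⟨a, ha⟩ := hS i hi
    rw [← Finset.mul_prod_erase _ _ (Finset.mem_univ a), if_pos ha, one_mul]
    have h1 : w i ^ (-q) ≤ 1 := Real.rpow_le_one_of_one_le_of_nonpos (hw i) (by linarith)
    have h2 : 0 < w i ^ (-q) := Real.rpow_pos_of_pos (hw0 i) _
    have h3 : ∏ a' ∈ Finset.univ.erase a, w i ^ (-q) ≤
        ∏ a' ∈ Finset.univ.erase a, (if i ∈ S a' then 1 else w i ^ (-q)) :=
      Finset.prod_le_prod (fun _ _ => h2.le) fun a' _ => by split_ifs; exacts [h1, le_rfl]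
    refine le_trans (le_of_eq ?_) h3
    rw [Finset.prod_const, Finset.card_erase_of_mem (Finset.mem_univ a), Finset.card_univ,
      inv_pow, ← Real.rpow_natCast, ← Real.rpow_neg (hw0 i).le, ← Real.rpow_natCast,
      ← Real.rpow_mul (hw0 i).le]
    congr 1
    rw [Nat.cast_sub (by omega), ← hm, hq, Nat.cast_one]
    have : m - 1 ≠ 0 := by linarith
    field_simp
  have : ∃ a, W ≤ A a := by
    by_contra h
    push Not at h
    have : Nonempty α := Fintype.card_pos_iff.1 (by omega)
    have := Finset.prod_lt_prod_of_nonempty (s := Finset.univ) (f := A) (g := fun _ => W)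
      (fun a _ => hA0 a) (fun a _ => h a) Finset.univ_nonempty
    rw [Finset.prod_const, Finset.card_univ] at this
    exact absurd hprod (not_le.2 this)
  obtain ⟨a, ha⟩ := this
  exact ha.trans (Finset.single_le_sum (f := A) (fun a _ => (hA0 a).le) (Finset.mem_univ a))

/-- Decay of order one in each line is not integrable over a single coordinate system, but each line
is dependent for some spanning tree. Comparing all trees of the family converts these surplus
factors into an exponent above one. -/
lemma integrable_prod_decay {X : Type*} [MeasurableSpace X] {μ : Measure X} (hG : G.IsConnected)
    (k : X → I → ℝ) (h : ∀ t', GrownTree G Finset.univ t' → ∀ q : ℝ, 1 < q →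
      Integrable (fun x => ∏ i ∈ nonLoops G \ t', (1 + |k x i|) ^ (-q)) μ)
    (hm : AEStronglyMeasurable (fun x => ∏ i ∈ nonLoops G, (1 + |k x i|)⁻¹) μ) :
    Integrable (fun x => ∏ i ∈ nonLoops G, (1 + |k x i|)⁻¹) μ := by
  obtain ⟨S, hS, hmem⟩ := exists_treeFamily hG
  have hcard : 2 ≤ Fintype.card (Option (Option I)) := by simp
  have hc2 : (2 : ℝ) ≤ Fintype.card (Option (Option I)) := by exact_mod_cast hcard
  refine (integrable_finsetSum Finset.univ fun a _ => h (S a) (hS a)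
    (Fintype.card (Option (Option I)) / (Fintype.card (Option (Option I)) - 1)) ?_).mono' hm
    (ae_of_all _ fun x => ?_)
  · rw [lt_div_iff₀ (by linarith)]; linarith
  · rw [Real.norm_of_nonneg (Finset.prod_nonneg fun i _ => by positivity)]
    exact prod_le_sum_prod_rpow hcard S _ hmem (fun i => 1 + |k x i|)
      fun i => by linarith [abs_nonneg (k x i)]

end

section

variable {V I X κ : Type*} [Fintype V] [Fintype I] [Fintype κ] [MeasurableSpace X]

/-! ### Signed propagators -/

/-- A sign as a complex number. -/
def sgn (e : ℤˣ) : ℂ := ((e : ℤ) : ℂ)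

@[simp] lemma sgn_one : sgn 1 = 1 := by simp [sgn]

@[simp] lemma sgn_neg (e : ℤˣ) : sgn (-e) = -sgn e := by simp [sgn]

@[simp] lemma sgn_mul (e f : ℤˣ) : sgn (e * f) = sgn e * sgn f := by simp [sgn]

lemma sgn_sq (e : ℤˣ) : sgn e * sgn e = 1 := by
  rcases Int.units_eq_one_or e with rfl | rfl <;> simp

lemma sum_sgn (f : ℤˣ → ℂ) : ∑ e, f e = f 1 + f (-1) := by
  rw [UnitsInt.univ, Finset.sum_pair (by decide)]

/-- The propagator `2E (a + i k b) / (k² + E²)`. -/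
def lineProp (a b : ℂ) (E k : ℝ) : ℂ := 2 * E * (a + Complex.I * k * b) / ((k : ℂ) ^ 2 + (E : ℂ) ^ 2)

/-- Partial fractions at the poles `ik = ±E`, where the numerator becomes `a ± bE`. -/
lemma lineProp_eq (a b : ℂ) {E : ℝ} (hE : E ≠ 0) (k : ℝ) : lineProp a b E k =
    ∑ e : ℤˣ, sgn e * (a + sgn e * (b * E)) * (sgn e * E - Complex.I * k)⁻¹ := by
  rw [sum_sgn]
  have h1 : (E : ℂ) - Complex.I * k ≠ 0 := fun h => hE (by simpa using congrArg Complex.re h)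
  have h2 : -(E : ℂ) - Complex.I * k ≠ 0 := fun h => hE (by simpa using congrArg Complex.re h)
  have h3 : (k : ℂ) ^ 2 + (E : ℂ) ^ 2 = -((E - Complex.I * k) * (-(E : ℂ) - Complex.I * k)) := by
    ring_nf; rw [Complex.I_sq]; ring
  rw [lineProp, h3]
  simp only [sgn_one, sgn_neg, one_mul, neg_mul]
  field_simp
  ring

lemma norm_inv_signed_le {E : ℝ} (hE : E ≠ 0) (e : ℤˣ) (k : ℝ) :
    ‖(sgn e * E - Complex.I * k)⁻¹‖ ≤ (1 + |E|⁻¹) * (1 + |k|)⁻¹ := by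
  have hre : |(sgn e * E - Complex.I * k).re| = |E| := by
    rcases Int.units_eq_one_or e with rfl | rfl <;> simp
  have him : |(sgn e * E - Complex.I * k).im| = |k| := by
    rcases Int.units_eq_one_or e with rfl | rfl <;> simp
  have := norm_inv_le (w := sgn e * E - Complex.I * k) (by
    intro h; rw [h, abs_zero] at hre; exact hE (abs_eq_zero.1 hre.symm))
  rwa [hre, him] at this

lemma norm_lineProp_le (a b : ℂ) {E : ℝ} (hE : 0 < E) (k : ℝ) :
    ‖lineProp a b E k‖ ≤ 2 * (‖a‖ + ‖b‖ * E) * (1 + E⁻¹) * (1 + |k|)⁻¹ := by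
  rw [lineProp_eq a b hE.ne', sum_sgn]
  have h : ∀ e : ℤˣ, ‖sgn e * (a + sgn e * (b * E)) * (sgn e * E - Complex.I * k)⁻¹‖ ≤
      (‖a‖ + ‖b‖ * E) * ((1 + E⁻¹) * (1 + |k|)⁻¹) := by
    intro e
    have he : ‖sgn e‖ = 1 := by rcases Int.units_eq_one_or e with rfl | rfl <;> simp
    rw [norm_mul, norm_mul, he, one_mul]
    refine mul_le_mul ?_ ?_ (norm_nonneg _) (by positivity)
    · refine (norm_add_le _ _).trans ?_
      rw [norm_mul, norm_mul, he, one_mul, Complex.norm_real, Real.norm_of_nonneg hE.le]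
    · have := norm_inv_signed_le hE.ne' e k
      rwa [abs_of_pos hE] at this
  calc _ ≤ _ := norm_add_le _ _
    _ ≤ _ := add_le_add (h 1) (h (-1))
    _ = _ := by ring

lemma continuousAt_lineProp (a b : ℂ) {E : ℝ} (hE : 0 < E) (k : ℝ) :
    ContinuousAt (fun E : ℝ => lineProp a b E k) E := by
  unfold lineProp
  refine ContinuousAt.div (by fun_prop) (by fun_prop) ?_
  have : (0 : ℝ) < k ^ 2 + E ^ 2 := by positivity
  exact_mod_cast this.ne'

lemma continuous_lineProp (a b : ℂ) {E : ℝ} (hE : 0 < E) : Continuous (lineProp a b E) := by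
  unfold lineProp
  refine Continuous.div (by fun_prop) (by fun_prop) fun k => ?_
  have : (0 : ℝ) < k ^ 2 + E ^ 2 := by positivity
  exact_mod_cast this.ne'

/-! ### Integrals of products of propagators -/

lemma bdry_apply (G : FeynmanGraph V I) (S : Finset I) (z : I → ℂ) (v : V) :
    bdry G S z v = ∑ i ∈ S, ((if G.src i = v then z i else 0) - (if G.tgt i = v then z i else 0)) := by
  simp only [bdry, Finset.sum_apply, Pi.smul_apply, lineDir, Pi.sub_apply, Pi.single_apply,
    smul_eq_mul]
  refine Finset.sum_congr rfl fun i _ => ?_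
  simp only [eq_comm (a := v)]
  split_ifs <;> ring

lemma bdry_nonLoops (G : FeynmanGraph V I) (z : I → ℂ) (v : V) :
    bdry G (nonLoops G) z v = divergence G z v := by
  rw [bdry_apply, divergence, nonLoops, Finset.sum_filter]
  refine Finset.sum_congr rfl fun i _ => ?_
  by_cases h : G.src i = G.tgt i <;> simp [h]

lemma pairTop_linesWeight_congr (G : FeynmanGraph V I) (N : Finset I) {x x' : I → ℂ} (y : V → ℂ)
    (h : ∀ i ∈ N, x i = x' i) (U : Finset V) :
    pairTop y (linesWeight G N x) U = pairTop y (linesWeight G N x') U := by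
  have : linesWeight G N x = linesWeight G N x' :=
    Finset.prod_congr rfl fun i hi => by rw [h i hi]
  rw [this]

variable {ν : Measure X} [SigmaFinite ν] {τ : ℂ} {χ : ℂ → ℂ} {Γ : AddSubgroup ℂ}
  {z₀ : I → ℂ} {z : I → X → ℂ} {G : FeynmanGraph V I} {t : Finset I} {c : κ → I}

/-- The energies of the tree lines are fixed by conservation, so their product of inverses is a
chain sum (`GrownTree.pairTop_eq`) in vertex energies shifted by the integrated lines. This is the
integrand of `integral_independent_energies`. -/
lemma integral_prod_inv (ht : GrownTree G Finset.univ t) (hc : Enumerates G t c)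
    (hlaw : CutLaw G t (nonLoops G) χ z₀)
    (hE : EnergyIntegral ν τ χ Γ z₀ {i | i ∈ nonLoops G ∧ i ∉ t} z)
    (Z : (κ → X) → I → ℂ) (hZ : ∀ x j, Z x (c j) = z (c j) (x j))
    (hZre : ∀ x, ∀ i, (Z x i).re = (z₀ i).re) {y : V → ℂ}
    (hy0 : total y Finset.univ = 0) (hy : ∀ x v, bdry G (nonLoops G) (Z x) v = y v)
    (hyΓ : ∀ v, y v - bdry G (nonLoops G) z₀ v ∈ Γ)
    (hint : Integrable (fun x => ∏ i ∈ nonLoops G, (Z x i)⁻¹) (Measure.pi fun _ : κ => ν)) :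
    ∫ x, ∏ i ∈ nonLoops G, (Z x i)⁻¹ ∂(Measure.pi fun _ : κ => ν) =
      τ ^ Fintype.card κ * pairTop y (linesWeight G (nonLoops G) (χ ∘ z₀)) Finset.univ := by
  set n := Fintype.card κ with hn
  let e : Fin n ≃ κ := (Fintype.equivFin κ).symm
  set l : Fin n → I := fun j => c (e j) with hl
  have hlim : t ∪ Finset.univ.image l = nonLoops G := by
    ext i
    simp only [Finset.mem_union, Finset.mem_image, Finset.mem_univ, true_and, hl]
    rw [← e.surjective.exists (p := fun j => c j = i), hc.range]
    constructor
    · rintro (h | h)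
      · exact ht.subset_nonLoops h
      · exact h.1
    · intro h
      by_cases hit : i ∈ t <;> simp [h, hit]
  have hmem : ∀ j, l j ∈ nonLoops G ∧ l j ∉ t := fun j => (hc.range _).1 ⟨_, rfl⟩
  have hdisj : Disjoint t (Finset.univ.image l) := by
    rw [Finset.disjoint_right]
    intro i hi
    obtain ⟨j, -, rfl⟩ := Finset.mem_image.1 hi
    exact (hmem j).2
  have hlinj : Function.Injective l := hc.injective.comp e.injective
  have hmp := measurePreserving_piCongrLeft (fun _ : κ => ν) e
  set Φ := MeasurableEquiv.piCongrLeft (fun _ : κ => X) e with hΦ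
  have hΦa : ∀ (x : Fin n → X) (j : Fin n), Φ x (e j) = x j := fun x j => by
    rw [hΦ, MeasurableEquiv.coe_piCongrLeft, Equiv.piCongrLeft_apply_apply]
  have hb : ∀ x : Fin n → X, bdry G t (Z (Φ x)) =
      y - ∑ j, z (l j) (x j) • lineDir (G.src (l j)) (G.tgt (l j)) := by
    intro x
    have h1 : bdry G (nonLoops G) (Z (Φ x)) = bdry G t (Z (Φ x)) +
        ∑ j, z (l j) (x j) • lineDir (G.src (l j)) (G.tgt (l j)) := by
      rw [bdry, ← hlim, Finset.sum_union hdisj, Finset.sum_image (fun a _ b _ h => hlinj h), bdry]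
      congr 1
      refine Finset.sum_congr rfl fun j _ => ?_
      rw [hl, hZ, hΦa]
    rw [← funext (hy (Φ x)), h1, add_sub_cancel_right]
  have hprod : ∀ x : Fin n → X, ∏ i ∈ nonLoops G, (Z (Φ x) i)⁻¹ =
      (∏ j, (z (l j) (x j))⁻¹) * pairTop
        (y - ∑ j, z (l j) (x j) • lineDir (G.src (l j)) (G.tgt (l j)))
        (linesWeight G t (χ ∘ z₀)) Finset.univ := by
    intro x
    rw [← hb, ht.pairTop_eq, ← hlim, Finset.prod_union hdisj,
      Finset.prod_image (fun a _ b _ h => hlinj h), mul_comm]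
    · congr 1
      refine Finset.prod_congr rfl fun j _ => ?_
      rw [hl, hZ, hΦa]
    · intro T hT hTn h
      have h1 := (hlaw t le_rfl ht.subset_nonLoops T hTn hT.ne).1
      apply h1
      rw [total_bdry_re]
      simp only [← hZre (Φ x)]
      rw [← total_bdry_re, h, Complex.zero_re]
  rw [← hmp.integral_comp' (fun x => ∏ i ∈ nonLoops G, (Z x i)⁻¹)]
  have hint' := (hmp.integrable_comp_emb (MeasurableEquiv.measurableEmbedding _)).2 hint
  rw [funext hprod]
  rw [show (fun x => ∏ i ∈ nonLoops G, (Z x i)⁻¹) ∘ Φ = _ from funext hprod] at hint'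
  rw [integral_independent_energies (fun i hi => mem_nonLoops.1 hi) hlaw ht.subset_nonLoops hE n l
    hlinj hmem y hy0 (by rw [hlim]; exact hyΓ) hint', hlim]

/-! ### Amplitudes as sums over the signs of the energies. -/

/-- The sum over the signs of the energies of old-fashioned perturbation theory. -/
def signedSum (G : FeynmanGraph V I) (a b : I → ℂ) (p : V → ℝ) (E : I → ℝ) (x : I → ℂ) : ℂ :=
  ∑ ε : I → ℤˣ, (∏ i, sgn (ε i) * (a i + sgn (ε i) * (b i * E i))) *
    (∏ i ∈ (nonLoops G)ᶜ, sgn (ε i) * x i) *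
    pairTop (fun v => divergence G (fun i => sgn (ε i) * E i) v - Complex.I * p v)
      (linesWeight G (nonLoops G) fun i => sgn (ε i) * x i) Finset.univ

lemma prod_nonLoops_ite (G : FeynmanGraph V I) (f g : I → ℂ) :
    ∏ i, (if i ∈ nonLoops G then f i else g i) =
      (∏ i ∈ (nonLoops G)ᶜ, g i) * ∏ i ∈ nonLoops G, f i := by
  rw [← Finset.prod_compl_mul_prod (nonLoops G)]
  congr 1
  · exact Finset.prod_congr rfl fun i hi => if_neg (Finset.mem_compl.1 hi)
  · exact Finset.prod_congr rfl fun i hi => if_pos hi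

lemma divergence_ofReal_sub (G : FeynmanGraph V I) (s : I → ℂ) (k : I → ℝ) (v : V) :
    divergence G (fun i => s i - Complex.I * k i) v =
      divergence G s v - Complex.I * (divergence G k v : ℝ) := by
  simp only [divergence, Complex.ofReal_sum, Finset.mul_sum, ← Finset.sum_sub_distrib]
  refine Finset.sum_congr rfl fun i _ => ?_
  split_ifs <;> push_cast <;> ring

lemma integral_prod_lineProp (ht : GrownTree G Finset.univ t) (hc : Enumerates G t c)
    {kf : I → X → ℝ} {θ : I → ℝ} {k : (κ → X) → I → ℝ} {p : V → ℝ} {E : I → ℝ} {x : I → ℂ}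
    (hk : ∀ u j, k u (c j) = kf (c j) (u j)) (hdiv : ∀ u v, divergence G (k u) v = p v)
    (hp : ∑ v, p v = 0) (hΓ : ∀ v, Complex.I * (divergence G θ v - p v : ℝ) ∈ Γ)
    (hχ : ∀ e : ℤˣ, ∀ i ∈ nonLoops G, χ (sgn e * E i - Complex.I * θ i) = sgn e * x i)
    (hE0 : ∀ i, E i ≠ 0)
    (hE : ∀ ε : I → ℤˣ, EnergyIntegral ν τ χ Γ (fun i => sgn (ε i) * E i - Complex.I * θ i)
      {i | i ∈ nonLoops G ∧ i ∉ t} fun i u => sgn (ε i) * E i - Complex.I * kf i u)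
    (hlaw : ∀ ε : I → ℤˣ, CutLaw G t (nonLoops G) χ fun i => sgn (ε i) * E i - Complex.I * θ i)
    (hint : ∀ ε : I → ℤˣ, Integrable
      (fun u => ∏ i ∈ nonLoops G, (sgn (ε i) * E i - Complex.I * k u i)⁻¹)
      (Measure.pi fun _ : κ => ν)) (a b : I → ℂ) :
    (∏ i ∈ (nonLoops G)ᶜ, 2 * a i * x i) *
        ∫ u, ∏ i ∈ nonLoops G, lineProp (a i) (b i) (E i) (k u i) ∂(Measure.pi fun _ : κ => ν) =
      τ ^ Fintype.card κ * signedSum G a b p E x := by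
  set pre : (I → ℤˣ) → ℂ := fun ε => (∏ i, sgn (ε i) * (a i + sgn (ε i) * (b i * E i))) *
    (∏ i ∈ (nonLoops G)ᶜ, sgn (ε i) * x i) with hpre
  have hpt : ∀ u, (∏ i ∈ (nonLoops G)ᶜ, 2 * a i * x i) *
      ∏ i ∈ nonLoops G, lineProp (a i) (b i) (E i) (k u i) =
      ∑ ε : I → ℤˣ, pre ε * ∏ i ∈ nonLoops G, (sgn (ε i) * E i - Complex.I * k u i)⁻¹ := by
    intro u
    rw [← prod_nonLoops_ite]
    -- A self-loop joins the sum over signs as well: `∑_e e(a + ebE) · ex = 2ax`, in which the odd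
    -- part of the numerator drops out.
    have h1 : ∀ i, (if i ∈ nonLoops G then lineProp (a i) (b i) (E i) (k u i)
        else 2 * a i * x i) = ∑ e : ℤˣ, sgn e * (a i + sgn e * (b i * E i)) *
          (if i ∈ nonLoops G then (sgn e * E i - Complex.I * k u i)⁻¹ else sgn e * x i) := by
      intro i
      split_ifs with hi
      · exact lineProp_eq _ _ (hE0 i) _
      · rw [sum_sgn]; simp; ring
    simp only [h1]
    rw [Finset.prod_univ_sum, Fintype.piFinset_univ]
    refine Finset.sum_congr rfl fun ε _ => ?_
    rw [Finset.prod_mul_distrib, prod_nonLoops_ite, hpre]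
    ring
  rw [← integral_const_mul]
  simp only [hpt]
  rw [integral_finsetSum _ fun ε _ => (hint ε).const_mul _, signedSum, Finset.mul_sum]
  refine Finset.sum_congr rfl fun ε _ => ?_
  rw [integral_const_mul]
  have := integral_prod_inv ht hc (hlaw ε) (hE ε)
    (fun u i => sgn (ε i) * E i - Complex.I * k u i) (fun u j => by rw [hk])
    (fun u i => by simp)
    (y := fun v => divergence G (fun i => sgn (ε i) * E i) v - Complex.I * p v)
    (by
      rw [total, Finset.sum_sub_distrib, ← Finset.mul_sum, ← Complex.ofReal_sum, hp, sum_divergence]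
      simp)
    (fun u v => by rw [bdry_nonLoops, divergence_ofReal_sub, hdiv])
    (fun v => by
      rw [bdry_nonLoops, divergence_ofReal_sub]
      convert hΓ v using 1
      push_cast
      ring) (hint ε)
  rw [this, pairTop_linesWeight_congr G (nonLoops G) _
    (x := χ ∘ fun i => sgn (ε i) * E i - Complex.I * θ i) (x' := fun i => sgn (ε i) * x i)
    (fun i hi => hχ (ε i) i hi)]
  ring

/-! ### Zero temperature and finite temperature -/

/-- The signs are absorbed into the coefficients, and the frequency offsets do not affect real
parts. -/
lemma GenericEnergies.signed {E : I → ℝ} (hE : GenericEnergies E) (ε : I → ℤˣ) (θ : I → ℝ) :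
    GenericEnergies fun i => (sgn (ε i) * E i - Complex.I * θ i).re := by
  intro c hc hc0
  have h := hE (fun i => c i * (ε i : ℤ)) (fun i => by
    rcases Int.units_eq_one_or (ε i) with h | h <;> simpa [h] using hc i) (by
    intro h
    apply hc0
    funext i
    have := congrFun h i
    rcases Int.units_eq_one_or (ε i) with h | h <;> simpa [h] using this)
  convert h using 2 with i
  rcases Int.units_eq_one_or (ε i) with h | h <;> simp [h]

lemma signed_re_ne_zero {E : ℝ} (hE : E ≠ 0) (e : ℤˣ) (θ : ℝ) :
    (sgn e * E - Complex.I * θ).re ≠ 0 := by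
  rcases Int.units_eq_one_or e with rfl | rfl <;> simpa using hE

lemma GrownTree.crosses_univ (ht : GrownTree G Finset.univ t) (U : Finset V) (hU : U.Nonempty)
    (hU' : U ≠ Finset.univ) : ∃ i ∈ t, Crosses G U i := by
  refine ht.exists_crosses U ?_ ?_
  · obtain ⟨u, hu⟩ := hU; exact ⟨u, Finset.mem_univ _, hu⟩
  · by_contra h
    push Not at h
    exact hU' (Finset.eq_univ_iff_forall.2 fun u => h u (Finset.mem_univ _))

lemma continuous_coordFlow (ht : GrownTree G Finset.univ t) (hc : Enumerates G t c) {d : V → ℝ}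
    (hd : ∑ v, d v = 0) (i : I) : Continuous fun x : κ → ℝ => coordFlow G t d c x i := by
  have h1 : ∀ i ∉ t, Continuous fun x : κ → ℝ => coordFlow G t d c x i := by
    intro i hi
    have : ∀ x : κ → ℝ, coordFlow G t d c x i = Function.extend c x 0 i :=
      fun x => (ht.treeFlow_spec hd _).1 i hi
    simp only [this]
    by_cases h : ∃ j, c j = i
    · obtain ⟨j, rfl⟩ := h
      simp only [hc.injective.extend_apply]
      fun_prop
    · simp only [Function.extend_apply' _ _ _ h]
      fun_prop
  by_cases hi : i ∈ t
  · obtain ⟨U, hs, hu, hU⟩ := ht.exists_cut i hi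
    have : ∀ x : κ → ℝ, coordFlow G t d c x i = ∑ v ∈ U, d v - ∑ j ∈ tᶜ,
        ((if G.src j ∈ U then coordFlow G t d c x j else 0) -
          (if G.tgt j ∈ U then coordFlow G t d c x j else 0)) := fun x => by
      rw [eq_of_divergence_eq hi hs hu hU (coordFlow G t d c x)]
      simp only [divergence_coordFlow ht hc hd]
    simp only [this]
    refine continuous_const.sub (continuous_finsetSum _ fun j hj => ?_)
    have := h1 j (Finset.mem_compl.1 hj)
    split_ifs <;> fun_prop
  · exact h1 i hi

lemma integrable_prod_of_bound {Y : Type*} [MeasurableSpace Y] {μ : Measure Y} {N : Finset I}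
    {k : Y → I → ℝ} (hk : ∀ i, Measurable fun u => k u i)
    (h : Integrable (fun u => ∏ i ∈ N, (1 + |k u i|)⁻¹) μ) {f : I → ℝ → ℂ}
    (hf : ∀ i, Measurable (f i)) (C : I → ℝ) (hC : ∀ i κ, ‖f i κ‖ ≤ C i * (1 + |κ|)⁻¹) :
    Integrable (fun u => ∏ i ∈ N, f i (k u i)) μ := by
  refine (h.const_mul (∏ i ∈ N, C i)).mono' ?_ (ae_of_all _ fun u => ?_)
  · refine Measurable.aestronglyMeasurable (Finset.measurable_fun_prod _ fun i _ => ?_)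
    exact (hf i).comp (hk i)
  · rw [norm_prod, ← Finset.prod_mul_distrib]
    exact Finset.prod_le_prod (fun _ _ => norm_nonneg _) fun i _ => hC i _

lemma measurable_inv_signed (e : ℤˣ) (E : ℝ) :
    Measurable fun k : ℝ => (sgn e * E - Complex.I * k)⁻¹ := by fun_prop

/-- The product of the propagators is integrable over the independent energies at zero
temperature. -/
lemma integrable_decay_volume (hG : G.IsConnected) (ht : GrownTree G Finset.univ t)
    (hc : Enumerates G t c) {p : V → ℝ} (hp : ∑ v, p v = 0) :
    Integrable (fun u : κ → ℝ => ∏ i ∈ nonLoops G, (1 + |coordFlow G t p c u i|)⁻¹) := by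
  refine integrable_prod_decay hG (fun u => coordFlow G t p c u)
    (fun t' ht' q hq => ht.integrable_decay_sdiff hc hp ht' hq) ?_
  refine Measurable.aestronglyMeasurable (Finset.measurable_fun_prod _ fun i _ => ?_)
  have := (continuous_coordFlow ht hc hp i).measurable
  fun_prop

lemma summable_decay_count (hG : G.IsConnected) (ht : GrownTree G Finset.univ t)
    (hc : Enumerates G t c) {q : V → ℤ} (hq : ∑ v, q v = 0) {r : ℝ} (hr : r ≠ 0) (θ : I → ℝ) :
    Integrable (fun u : κ → ℤ => ∏ i ∈ nonLoops G, (1 + |r * coordFlow G t q c u i + θ i|)⁻¹)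
      Measure.count := by
  refine integrable_prod_decay hG (fun u i => r * coordFlow G t q c u i + θ i)
    (fun t' ht' s hs => integrable_count_iff.2 (ht.summable_decay_sdiff hc hq ht' hs hr θ).norm) ?_
  exact (measurable_of_countable _).aestronglyMeasurable

lemma zeroTemp_signedSum (hG : G.IsConnected) (ht : GrownTree G Finset.univ t)
    (hc : Enumerates G t c) {p : V → ℝ} (hp : ∑ v, p v = 0) {E : I → ℝ} (hE : ∀ i, 0 < E i)
    (hgen : GenericEnergies E) (a b : I → ℂ) :
    (∏ i ∈ (nonLoops G)ᶜ, a i) *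
        ∫ u : κ → ℝ, ∏ i ∈ nonLoops G, lineProp (a i) (b i) (E i) (coordFlow G t p c u i) =
      (2 * Real.pi) ^ Fintype.card κ * signedSum G a b p E fun _ => 1 / 2 := by
  have h := integral_prod_lineProp (ν := volume) (τ := 2 * Real.pi) (χ := halfSign) (Γ := imaginary)
    (kf := fun _ k => k) (θ := fun _ => 0) (x := fun _ => 1 / 2) ht hc
    (coordFlow_coord ht hc hp) (divergence_coordFlow ht hc hp) hp
    (fun v => by rw [mem_imaginary]; simp)
    (fun e i _ => by
      rcases Int.units_eq_one_or e with rfl | rfl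
      · simp [halfSign, hE i]
      · simp [halfSign, (hE i).le])
    (fun i => (hE i).ne')
    (fun ε => by
      have := energyIntegral_volume (s := fun i => (ε i : ℤ) * E i) {i | i ∈ nonLoops G ∧ i ∉ t}
        (fun i _ => mul_ne_zero (by exact_mod_cast (ε i).ne_zero) (hE i).ne')
      simpa [sgn] using this)
    (fun ε => cutLaw_halfSign (fun i hi => mem_nonLoops.1 hi) ht.crosses_univ
      (by simpa using hgen.signed ε fun _ => 0))
    (fun ε => integrable_prod_of_bound
      (fun i => (continuous_coordFlow ht hc hp i).measurable) (integrable_decay_volume hG ht hc hp)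
      (fun i => measurable_inv_signed (ε i) (E i)) _
      fun i k => norm_inv_signed_le (hE i).ne' (ε i) k) a b
  rw [volume_pi]
  simpa [mul_assoc, mul_comm, mul_left_comm] using h

/-- `1/2` plus the occupation factor. -/
def thermalWeight (G : FeynmanGraph V I) (T : ℝ) (E : I → ℝ) (i : I) : ℂ :=
  1 / 2 + (G.occupation T i (E i) : ℂ)

/-- The frequency offset, in units of `2πT`. -/
def freqOffset (G : FeynmanGraph V I) (i : I) : ℝ := if G.fermionic i then 1 / 2 else 0

/-- For a scalar line `coth(E / 2T) / 2 = 1/2 + N`. For a Dirac line the shift by `iπT` turns `coth`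
into `tanh`, and `tanh(E / 2T) / 2` is `1/2` minus the Fermi-Dirac factor. Both functions are odd,
which gives the sign `e`. -/
lemma halfCoth_signed (G : FeynmanGraph V I) {T : ℝ} (hT : 0 < T) {E : I → ℝ} (hE : ∀ i, 0 < E i)
    (e : ℤˣ) (i : I) : halfCoth T (sgn e * E i - Complex.I * (2 * Real.pi * T * freqOffset G i : ℝ)) =
      sgn e * thermalWeight G T E i := by
  have hT0 : (T : ℂ) ≠ 0 := by exact_mod_cast hT.ne'
  have hu : (1 : ℝ) < Real.exp (E i / T) := Real.one_lt_exp_iff.2 (div_pos (hE i) hT)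
  set u : ℝ := Real.exp (E i / T) with hu'
  have hexp : Complex.exp (E i / T) = u := by rw [hu']; push_cast; rfl
  have hexp' : Complex.exp (-(E i / T)) = (u : ℂ)⁻¹ := by rw [Complex.exp_neg, hexp]
  have h0 : (u : ℂ) ≠ 0 := by exact_mod_cast (by linarith : u ≠ 0)
  have h1 : (u : ℂ) - 1 ≠ 0 := by exact_mod_cast (by linarith : u - 1 ≠ 0)
  have h1' : 1 - (u : ℂ) ≠ 0 := by exact_mod_cast (by linarith : 1 - u ≠ 0)
  have h2 : (u : ℂ) + 1 ≠ 0 := by exact_mod_cast (by linarith : u + 1 ≠ 0)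
  have h2' : 1 + (u : ℂ) ≠ 0 := by exact_mod_cast (by linarith : 1 + u ≠ 0)
  by_cases hf : G.fermionic i
  · have hn : ∀ w : ℂ, Complex.exp (-((w - Complex.I * (2 * Real.pi * T * (1 / 2 : ℝ) : ℝ)) / T)) =
        -Complex.exp (-(w / T)) := by
      intro w
      have : -((w - Complex.I * (2 * Real.pi * T * (1 / 2 : ℝ) : ℝ)) / T) =
          -(w / T) + Real.pi * Complex.I := by push_cast; field_simp; ring
      rw [this, Complex.exp_add, Complex.exp_pi_mul_I]; ring
    simp only [halfCoth, thermalWeight, freqOffset, FeynmanGraph.occupation, hf, if_true, hn]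
    rcases Int.units_eq_one_or e with rfl | rfl
    · simp only [sgn_one, one_mul, hexp', ← hu', sub_neg_eq_add]
      push_cast
      field_simp
      ring
    · simp only [sgn_neg, sgn_one, neg_mul, one_mul, neg_div, neg_neg, hexp, ← hu', sub_neg_eq_add]
      push_cast
      field_simp
      ring
  · simp only [halfCoth, thermalWeight, freqOffset, FeynmanGraph.occupation, hf, if_false, mul_zero,
      Complex.ofReal_zero, sub_zero]
    rcases Int.units_eq_one_or e with rfl | rfl
    · simp only [sgn_one, one_mul, hexp', ← hu']
      push_cast
      field_simp
      ring
    · simp only [sgn_neg, sgn_one, neg_mul, one_mul, neg_div, neg_neg, hexp, ← hu']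
      push_cast
      field_simp
      ring

lemma finiteTemp_signedSum (hG : G.IsConnected) (ht : GrownTree G Finset.univ t)
    (hc : Enumerates G t c) {T : ℝ} (hT : 0 < T) {p : V → ℝ} {q : V → ℤ} (hq : ∑ v, q v = 0)
    (hpq : ∀ v, p v = 2 * Real.pi * T * (q v + divergence G (freqOffset G) v)) {E : I → ℝ}
    (hE : ∀ i, 0 < E i) (hgen : GenericEnergies E) (a b : I → ℂ) :
    (∏ i ∈ (nonLoops G)ᶜ, 2 * a i * thermalWeight G T E i) *
        ∫ u : κ → ℤ, ∏ i ∈ nonLoops G, lineProp (a i) (b i) (E i)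
          (2 * Real.pi * T * (coordFlow G t q c u i + freqOffset G i)) ∂Measure.count =
      (T : ℂ)⁻¹ ^ Fintype.card κ * signedSum G a b p E (thermalWeight G T E) := by
  have hT2 : 2 * Real.pi * T ≠ 0 := by positivity
  have hp : ∑ v, p v = 0 := by
    simp only [hpq, ← Finset.mul_sum, Finset.sum_add_distrib]
    rw [sum_divergence, ← Int.cast_sum, hq]
    simp
  have hdiv : ∀ (n : I → ℤ) v, divergence G (fun i => 2 * Real.pi * T * (n i + freqOffset G i)) v =
      2 * Real.pi * T * (divergence G n v + divergence G (freqOffset G) v) := by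
    intro n v
    simp only [divergence, Int.cast_sum, ← Finset.sum_add_distrib, Finset.mul_sum]
    refine Finset.sum_congr rfl fun i _ => ?_
    split_ifs <;> push_cast <;> ring
  have hdiv0 : ∀ v, divergence G (fun i => 2 * Real.pi * T * freqOffset G i) v =
      2 * Real.pi * T * divergence G (freqOffset G) v := by
    intro v
    have := hdiv 0 v
    simpa [divergence] using this
  have hdec : Integrable (fun u : κ → ℤ => ∏ i ∈ nonLoops G,
      (1 + |2 * Real.pi * T * (coordFlow G t q c u i + freqOffset G i)|)⁻¹) Measure.count := by
    simpa only [mul_add] using summable_decay_count hG ht hc hq hT2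
      fun i => 2 * Real.pi * T * freqOffset G i
  have hint : ∀ ε : I → ℤˣ, Integrable (fun u : κ → ℤ => ∏ i ∈ nonLoops G, (sgn (ε i) * E i -
      Complex.I * (2 * Real.pi * T * (coordFlow G t q c u i + freqOffset G i) : ℝ))⁻¹)
      Measure.count := fun ε =>
    integrable_prod_of_bound (f := fun i k => (sgn (ε i) * E i - Complex.I * k)⁻¹)
      (k := fun u i => 2 * Real.pi * T * (coordFlow G t q c u i + freqOffset G i))
      (fun i => measurable_of_countable _) hdec (fun i => measurable_inv_signed (ε i) (E i))
      (fun i => 1 + |E i|⁻¹) fun i k => norm_inv_signed_le (hE i).ne' (ε i) k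
  have h := integral_prod_lineProp (ν := (Measure.count : Measure ℤ)) (τ := (T : ℂ)⁻¹)
    (χ := halfCoth T) (Γ := matsubaraGroup T)
    (kf := fun i n => 2 * Real.pi * T * (n + freqOffset G i))
    (θ := fun i => 2 * Real.pi * T * freqOffset G i) (x := thermalWeight G T E)
    (k := fun u i => 2 * Real.pi * T * (coordFlow G t q c u i + freqOffset G i)) ht hc
    (fun u j => by rw [coordFlow_coord ht hc hq])
    (fun u v => by rw [hdiv, divergence_coordFlow ht hc hq, hpq]) hp
    (fun v => by
      rw [hdiv0, hpq]
      exact mem_matsubaraGroup.2 ⟨-q v, by push_cast; ring⟩)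
    (fun e i _ => halfCoth_signed G hT hE e i)
    (fun i => (hE i).ne')
    (fun ε => by
      have := energyIntegral_count hT {i | i ∈ nonLoops G ∧ i ∉ t}
        (z₀ := fun i => sgn (ε i) * E i - Complex.I * (2 * Real.pi * T * freqOffset G i : ℝ))
        (fun i _ => signed_re_ne_zero (hE i).ne' (ε i) _)
      refine Eq.mp (congrArg (EnergyIntegral _ _ _ _ _ _) ?_) this
      funext i n
      push_cast
      ring)
    (fun ε => cutLaw_halfCoth hT (fun i hi => mem_nonLoops.1 hi) ht.crosses_univ
      (hgen.signed ε _) (fun i => signed_re_ne_zero (hE i).ne' (ε i) _))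
    (fun ε => by rw [pi_count]; exact hint ε) a b
  rw [pi_count] at h
  exact h

/-! ### Continuity in the kinematic energies -/

/-- Dominated convergence, with a bound uniform for `E i / 2 < E' i < 2 E i`. It carries identities
from generic to arbitrary positive energies. -/
lemma continuousAt_integral_prod_lineProp {Y : Type*} [MeasurableSpace Y] {μ : Measure Y}
    {N : Finset I} {k : Y → I → ℝ} (hk : ∀ i, Measurable fun u => k u i)
    (h : Integrable (fun u => ∏ i ∈ N, (1 + |k u i|)⁻¹) μ) (a b : I → ℂ) {E : I → ℝ}
    (hE : ∀ i, 0 < E i) : ContinuousAt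
      (fun E : I → ℝ => ∫ u, ∏ i ∈ N, lineProp (a i) (b i) (E i) (k u i) ∂μ) E := by
  have hnear : ∀ᶠ E' : I → ℝ in 𝓝 E, ∀ i, E i / 2 < E' i ∧ E' i < 2 * E i := by
    rw [eventually_all]
    intro i
    have h1 : Tendsto (fun E' : I → ℝ => E' i) (𝓝 E) (𝓝 (E i)) := (continuous_apply i).tendsto E
    have := hE i
    exact (h1.eventually (lt_mem_nhds (by linarith))).and (h1.eventually (gt_mem_nhds (by linarith)))
  refine continuousAt_of_dominated
    (bound := fun u => (∏ i ∈ N, 2 * (‖a i‖ + ‖b i‖ * (2 * E i)) * (1 + (E i / 2)⁻¹)) *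
      ∏ i ∈ N, (1 + |k u i|)⁻¹) ?_ ?_ (h.const_mul _) ?_
  · filter_upwards [hnear] with E' hE'
    refine Measurable.aestronglyMeasurable (Finset.measurable_fun_prod _ fun i _ => ?_)
    exact (continuous_lineProp _ _ (by linarith [hE i, (hE' i).1])).measurable.comp (hk i)
  · filter_upwards [hnear] with E' hE'
    refine ae_of_all _ fun u => ?_
    rw [norm_prod, ← Finset.prod_mul_distrib]
    refine Finset.prod_le_prod (fun _ _ => norm_nonneg _) fun i _ => ?_
    have h0 := hE i
    have h1 : 0 < E' i := by linarith [hE i, (hE' i).1]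
    refine (norm_lineProp_le _ _ h1 _).trans ?_
    have h2 := (hE' i).1.le
    have h3 := (hE' i).2.le
    gcongr
  · refine ae_of_all _ fun u => ?_
    exact tendsto_finsetProd _ fun i _ => Tendsto.comp (continuousAt_lineProp _ _ (hE i) _)
      ((continuous_apply i).tendsto E)

end

section

variable {V I : Type*}

/-! ### Multilinearity in the weights of the lines -/

section chainLinear

variable {Y : Finset V → ℂ} {φ₁ φ₂ φ₃ : V → V → ℂ} {a b : V} {α β : ℂ}

lemma pairWeight_congr_off {φ φ' : V → V → ℂ} {T : Finset V} {v : V}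
    (h : ∀ u w, ¬(u = a ∧ w = b) → ¬(u = b ∧ w = a) → φ u w = φ' u w)
    (hT : ¬(a ∈ insert v T ∧ b ∈ insert v T) ∨ (v ≠ a ∧ v ≠ b)) :
    pairWeight φ T v = pairWeight φ' T v := by
  refine Finset.prod_congr rfl fun u hu => h u v ?_ ?_
  · rintro ⟨rfl, rfl⟩
    rcases hT with hT | hT
    · exact hT ⟨Finset.mem_insert_of_mem hu, Finset.mem_insert_self _ _⟩
    · exact hT.2 rfl
  · rintro ⟨rfl, rfl⟩
    rcases hT with hT | hT
    · exact hT ⟨Finset.mem_insert_self _ _, Finset.mem_insert_of_mem hu⟩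
    · exact hT.1 rfl

lemma pairWeight_linear {u v : V} {T : Finset V} (hu : u ∈ T)
    (h : ∀ p ∈ T, p ≠ u → φ₃ p v = φ₁ p v ∧ φ₃ p v = φ₂ p v)
    (hl : φ₃ u v = α * φ₁ u v + β * φ₂ u v) :
    pairWeight φ₃ T v = α * pairWeight φ₁ T v + β * pairWeight φ₂ T v := by
  have h1 : ∏ p ∈ T.erase u, φ₃ p v = ∏ p ∈ T.erase u, φ₁ p v :=
    Finset.prod_congr rfl fun p hp =>
      (h p (Finset.mem_of_mem_erase hp) (Finset.ne_of_mem_erase hp)).1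
  have h2 : ∏ p ∈ T.erase u, φ₃ p v = ∏ p ∈ T.erase u, φ₂ p v :=
    Finset.prod_congr rfl fun p hp =>
      (h p (Finset.mem_of_mem_erase hp) (Finset.ne_of_mem_erase hp)).2
  rw [pairWeight, pairWeight, pairWeight, ← Finset.mul_prod_erase T _ hu,
    ← Finset.mul_prod_erase T (fun p => φ₁ p v) hu, ← Finset.mul_prod_erase T (fun p => φ₂ p v) hu,
    ← h1, ← h2, hl]
  ring

/-- In an ordering either `a` precedes `b` or conversely, so exactly one of the weights of this pair
occurs, and it occurs once. The induction removes the last vertex until it is `a` or `b`. -/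
lemma topChain_linear (hab : a ≠ b)
    (h : ∀ u w, ¬(u = a ∧ w = b) → ¬(u = b ∧ w = a) → φ₃ u w = φ₁ u w ∧ φ₃ u w = φ₂ u w)
    (hl : φ₃ a b = α * φ₁ a b + β * φ₂ a b) (hl' : φ₃ b a = α * φ₁ b a + β * φ₂ b a) (n : ℕ) :
    ∀ U : Finset V, U.card = n → a ∈ U → b ∈ U → topChain Y (pairWeight φ₃) U =
      α * topChain Y (pairWeight φ₁) U + β * topChain Y (pairWeight φ₂) U := by
  induction n with
  | zero => intro U hU ha; simp_all
  | succ n ih =>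
    intro U hU ha hb
    have hc : ∀ T : Finset V, ¬(a ∈ T ∧ b ∈ T) →
        chain Y (pairWeight φ₃) T = chain Y (pairWeight φ₁) T ∧
        chain Y (pairWeight φ₃) T = chain Y (pairWeight φ₂) T := by
      intro T hT
      have hT' : ∀ S ⊆ T, ∀ v ∈ T, ¬(a ∈ insert v S ∧ b ∈ insert v S) := fun S hS v hv h' =>
        hT ⟨Finset.insert_subset hv hS h'.1, Finset.insert_subset hv hS h'.2⟩
      constructor
      · exact chain_congr T (fun _ _ _ => rfl) fun S hS v hv _ =>
          pairWeight_congr_off (fun u w h1 h2 => (h u w h1 h2).1) (Or.inl (hT' S hS v hv))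
      · exact chain_congr T (fun _ _ _ => rfl) fun S hS v hv _ =>
          pairWeight_congr_off (fun u w h1 h2 => (h u w h1 h2).2) (Or.inl (hT' S hS v hv))
    unfold topChain
    rw [Finset.mul_sum, Finset.mul_sum, ← Finset.sum_add_distrib]
    refine Finset.sum_congr rfl fun v hv => ?_
    by_cases hva : v = a
    · subst hva
      obtain ⟨h1, h2⟩ := hc (U.erase v) (by simp)
      rw [← h1, ← h2, pairWeight_linear (α := α) (β := β) (φ₁ := φ₁) (φ₂ := φ₂)
        (Finset.mem_erase.2 ⟨hab.symm, hb⟩) (fun p _ hpb => h p v (fun h' => hab h'.2)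
          (fun h' => hpb h'.1)) hl']
      ring
    by_cases hvb : v = b
    · subst hvb
      obtain ⟨h1, h2⟩ := hc (U.erase v) (by simp)
      rw [← h1, ← h2, pairWeight_linear (α := α) (β := β) (φ₁ := φ₁) (φ₂ := φ₂)
        (Finset.mem_erase.2 ⟨hab, ha⟩) (fun p _ hpb => h p v (fun h' => hpb h'.1)
          (fun h' => hab h'.2.symm)) hl]
      ring
    · have ha' : a ∈ U.erase v := Finset.mem_erase.2 ⟨Ne.symm hva, ha⟩
      have hb' : b ∈ U.erase v := Finset.mem_erase.2 ⟨Ne.symm hvb, hb⟩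
      have e1 : pairWeight φ₃ (U.erase v) v = pairWeight φ₁ (U.erase v) v :=
        pairWeight_congr_off (a := a) (b := b)
          (fun u w h1 h2 => (h u w h1 h2).1) (Or.inr ⟨hva, hvb⟩)
      have e2 : pairWeight φ₃ (U.erase v) v = pairWeight φ₂ (U.erase v) v :=
        pairWeight_congr_off (a := a) (b := b)
          (fun u w h1 h2 => (h u w h1 h2).2) (Or.inr ⟨hva, hvb⟩)
      have hn : (U.erase v).Nonempty := ⟨a, ha'⟩
      rw [← e1, ← e2, chain_of_nonempty _ _ hn, chain_of_nonempty _ _ hn, chain_of_nonempty _ _ hn,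
        ih _ (by rw [Finset.card_erase_of_mem hv, hU]; rfl) ha' hb']
      ring

end chainLinear

variable [Fintype V] [Fintype I]

/-- The pair weight of a line from `a` to `b` whose weight is `l.1` if `a` comes before `b`, and `l.2`
otherwise. -/
def pairLine (l : ℂ × ℂ) (a b u w : V) : ℂ :=
  if u = a ∧ w = b then l.1 else if u = b ∧ w = a then l.2 else 1

/-- The pair weight of all the lines. -/
def pairLines (G : FeynmanGraph V I) (l : I → ℂ × ℂ) (u w : V) : ℂ :=
  ∏ i ∈ nonLoops G, pairLine (l i) (G.src i) (G.tgt i) u w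

/-- The chain sum for the vertex weights `pairLines G l`, with the factors of the self-loops. -/
def lineTop (G : FeynmanGraph V I) (Y : Finset V → ℂ) (l : I → ℂ × ℂ) : ℂ :=
  (∏ i ∈ (nonLoops G)ᶜ, ((l i).1 + (l i).2) / 2) *
    topChain Y (pairWeight (pairLines G l)) Finset.univ

lemma lineTop_update (G : FeynmanGraph V I) (Y : Finset V → ℂ) (l : I → ℂ × ℂ) (i : I) (α β : ℂ)
    (m m' : ℂ × ℂ) : lineTop G Y (Function.update l i (α • m + β • m')) =
      α * lineTop G Y (Function.update l i m) + β * lineTop G Y (Function.update l i m') := by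
  by_cases hi : i ∈ nonLoops G
  · have hp : ∀ m, ∏ j ∈ (nonLoops G)ᶜ, ((Function.update l i m j).1 + (Function.update l i m j).2) / 2 =
        ∏ j ∈ (nonLoops G)ᶜ, ((l j).1 + (l j).2) / 2 := fun m =>
      Finset.prod_congr rfl fun j hj => by
        have : j ≠ i := by rintro rfl; exact Finset.mem_compl.1 hj hi
        rw [Function.update_of_ne this]
    have hw : ∀ m u w, pairLines G (Function.update l i m) u w =
        pairLine m (G.src i) (G.tgt i) u w *
          ∏ j ∈ (nonLoops G).erase i, pairLine (l j) (G.src j) (G.tgt j) u w := fun m u w => by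
      rw [pairLines, ← Finset.mul_prod_erase _ _ hi, Function.update_self]
      congr 1
      exact Finset.prod_congr rfl fun j hj => by
        rw [Function.update_of_ne (Finset.ne_of_mem_erase hj)]
    have hab := mem_nonLoops.1 hi
    rw [lineTop, lineTop, lineTop, hp, hp, hp, topChain_linear (α := α) (β := β)
      (φ₁ := pairLines G (Function.update l i m)) (φ₂ := pairLines G (Function.update l i m'))
      hab ?_ ?_ ?_ _ Finset.univ rfl (Finset.mem_univ _) (Finset.mem_univ _)]
    · ring
    · intro u w h1 h2
      simp only [hw, pairLine, if_neg h1, if_neg h2]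
      exact ⟨trivial, trivial⟩
    · simp only [hw, pairLine]
      simp
      ring
    · simp only [hw, pairLine]
      simp [hab.symm, hab]
      ring
  · have hp : ∀ m, ∏ j ∈ (nonLoops G)ᶜ, ((Function.update l i m j).1 + (Function.update l i m j).2) / 2 =
        (m.1 + m.2) / 2 * ∏ j ∈ (nonLoops G)ᶜ.erase i, ((l j).1 + (l j).2) / 2 := fun m => by
      rw [← Finset.mul_prod_erase _ _ (Finset.mem_compl.2 hi), Function.update_self]
      congr 1
      exact Finset.prod_congr rfl fun j hj => by
        rw [Function.update_of_ne (Finset.ne_of_mem_erase hj)]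
    have hw : ∀ m, pairLines G (Function.update l i m) = pairLines G l := fun m => by
      funext u w
      exact Finset.prod_congr rfl fun j hj => by
        have : j ≠ i := by rintro rfl; exact hi hj
        rw [Function.update_of_ne this]
    rw [lineTop, lineTop, lineTop, hp, hp, hp, hw, hw, hw]
    simp
    ring

/-- The chain sum as a multilinear function of the weights of the lines. -/
def lineTopMap (G : FeynmanGraph V I) (Y : Finset V → ℂ) :
    MultilinearMap ℂ (fun _ : I => ℂ × ℂ) ℂ :=
  MultilinearMap.mk' (lineTop G Y)
    (fun l i m m' => by simpa using lineTop_update G Y l i 1 1 m m')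
    (fun l i c m => by simpa using lineTop_update G Y l i c 0 m 0)

lemma lineTopMap_apply (G : FeynmanGraph V I) (Y : Finset V → ℂ) (l : I → ℂ × ℂ) :
    lineTopMap G Y l = lineTop G Y l := rfl

/-- The weights `(x + 1/2, x - 1/2)`. -/
def shiftPair (x : ℂ) : ℂ × ℂ := (x + 1 / 2, x - 1 / 2)

lemma linesWeight_nonLoops (G : FeynmanGraph V I) (x : I → ℂ) :
    linesWeight G (nonLoops G) x = pairLines G fun i => shiftPair (x i) := by
  funext u w
  rw [linesWeight_apply]
  rfl

/-- The vertex energies for energies `s` of the lines and external energies `p`. -/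
def vertexEnergy (G : FeynmanGraph V I) (p : V → ℝ) (s : I → ℂ) (v : V) : ℂ :=
  divergence G s v - Complex.I * p v

lemma signedSum_eq (G : FeynmanGraph V I) (a b : I → ℂ) (p : V → ℝ) (E : I → ℝ) (x : I → ℂ) :
    signedSum G a b p E x = ∑ ε : I → ℤˣ, (∏ i, sgn (ε i) * (a i + sgn (ε i) * (b i * E i))) *
      lineTopMap G (total (vertexEnergy G p fun i => sgn (ε i) * E i))
        fun i => shiftPair (sgn (ε i) * x i) := by
  refine Finset.sum_congr rfl fun ε _ => ?_
  rw [lineTopMap_apply, lineTop, linesWeight_nonLoops, mul_assoc]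
  congr 2
  refine Finset.prod_congr rfl fun i _ => ?_
  simp only [shiftPair]
  ring

/-! ### Reflections -/

/-- The sign that is `-1` on `B`. -/
def flipSign (B : Finset I) (i : I) : ℤˣ := if i ∈ B then -1 else 1

/-- Reflection of the energies in `B`. -/
def flipEnergy (B : Finset I) (E : I → ℝ) (i : I) : ℝ := if i ∈ B then -E i else E i

lemma flipEnergy_eq (B : Finset I) (E : I → ℝ) (i : I) :
    (flipEnergy B E i : ℂ) = sgn (flipSign B i) * E i := by
  unfold flipEnergy flipSign
  split_ifs <;> simp

lemma prod_flipSign (B : Finset I) : ∏ i, sgn (flipSign B i) = (-1) ^ B.card := by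
  have : ∀ i, sgn (flipSign B i) = if i ∈ B then -1 else 1 := fun i => by
    unfold flipSign; split_ifs <;> simp
  simp only [this, Finset.prod_ite, Finset.prod_const]
  simp

/-- Multiplying the summation signs by those of the reflection restores the energies; the prefactors
yield `(-1) ^ B.card`, and the sign reappears on `x`. -/
lemma signedSum_flip (G : FeynmanGraph V I) (a b : I → ℂ) (p : V → ℝ) (E : I → ℝ) (x : I → ℂ)
    (B : Finset I) : signedSum G a b p (flipEnergy B E) x =
      (-1) ^ B.card * signedSum G a b p E fun i => sgn (flipSign B i) * x i := by
  rw [signedSum_eq, signedSum_eq, ← prod_flipSign, Finset.mul_sum]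
  refine Fintype.sum_equiv (Equiv.mulRight (flipSign B)) _ _ fun ε => ?_
  have hs : ∀ i, sgn (flipSign B i) * sgn (flipSign B i) = 1 := fun i => sgn_sq _
  have e1 : ∀ i, sgn ((Equiv.mulRight (flipSign B) ε) i) = sgn (ε i) * sgn (flipSign B i) :=
    fun i => by simp
  simp only [e1, flipEnergy_eq]
  rw [← mul_assoc, ← Finset.prod_mul_distrib]
  congr 1
  · refine Finset.prod_congr rfl fun i _ => ?_
    linear_combination
      (-(sgn (ε i) * a i + sgn (ε i) ^ 2 * b i * sgn (flipSign B i) * E i)) * hs i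
  · simp only [mul_assoc]
    congr 2
    funext i
    rw [← mul_assoc (sgn (flipSign B i)), hs, one_mul]

/-! ### Expansion in the occupation factors -/

lemma piecewise_shiftPair (ε : I → ℤˣ) (B : Finset I) :
    (fun i => shiftPair (sgn (ε i) * (sgn (flipSign B i) * (1 / 2)))) =
      B.piecewise (fun i => shiftPair (-(sgn (ε i) * (1 / 2))))
        fun i => shiftPair (sgn (ε i) * (1 / 2)) := by
  funext i
  by_cases hi : i ∈ B <;> simp [hi, flipSign]

lemma map_piecewise_sub (f : MultilinearMap ℂ (fun _ : I => ℂ × ℂ) ℂ) (l l' : I → ℂ × ℂ)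
    (A : Finset I) : f (A.piecewise (l - l') l) =
      ∑ B ∈ A.powerset, (-1) ^ B.card * f (B.piecewise l' l) := by
  have h := f.map_piecewise_add (-l') l A
  rw [neg_add_eq_sub] at h
  rw [h]
  refine Finset.sum_congr rfl fun B _ => ?_
  have h2 := f.map_piecewise_smul (fun _ => (-1 : ℂ)) (B.piecewise l' l) B
  rw [Finset.prod_const, smul_eq_mul] at h2
  rw [← h2]
  congr 1
  funext i
  by_cases hi : i ∈ B <;> simp [hi]

lemma map_add_smul_sub (f : MultilinearMap ℂ (fun _ : I => ℂ × ℂ) ℂ) (l l' : I → ℂ × ℂ)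
    (n : I → ℂ) : f (fun i => l i + n i • (l i - l' i)) =
      ∑ A : Finset I, (∏ i ∈ A, n i) * ∑ B ∈ A.powerset, (-1) ^ B.card * f (B.piecewise l' l) := by
  have h := f.map_add_univ (fun i => n i • (l i - l' i)) l
  have e : (fun i => l i + n i • (l i - l' i)) = (fun i => n i • (l i - l' i)) + l := by
    funext i; simp [add_comm]
  rw [e, h]
  refine Finset.sum_congr rfl fun A _ => ?_
  rw [← map_piecewise_sub]
  have h2 := f.map_piecewise_smul n (A.piecewise (l - l') l) A
  rw [smul_eq_mul] at h2
  rw [← h2]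
  congr 1
  funext i
  by_cases hi : i ∈ A <;> simp [hi]

/-- The pair of weights is affine in `x`, so the occupation factor multiplies the difference of the
pairs for `ε/2` and `-ε/2`. In the multilinear expansion, choosing the pair for `-ε/2` on `B` is a
reflection by `signedSum_flip`, whose sign cancels the `(-1) ^ B.card` of the difference. -/
lemma signedSum_half_add (G : FeynmanGraph V I) (a b : I → ℂ) (p : V → ℝ) (E : I → ℝ)
    (n : I → ℂ) : signedSum G a b p E (fun i => 1 / 2 + n i) =
      ∑ A : Finset I, (∏ i ∈ A, n i) *
        ∑ B ∈ A.powerset, signedSum G a b p (flipEnergy B E) fun _ => 1 / 2 := by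
  simp only [signedSum_flip]
  simp only [signedSum_eq, piecewise_shiftPair]
  have h1 : ∀ ε : I → ℤˣ, (fun i => shiftPair (sgn (ε i) * (1 / 2 + n i))) =
      fun i => shiftPair (sgn (ε i) * (1 / 2)) + n i •
        (shiftPair (sgn (ε i) * (1 / 2)) - shiftPair (-(sgn (ε i) * (1 / 2)))) := by
    intro ε
    funext i
    simp only [shiftPair, Prod.mk_sub_mk, Prod.smul_mk, Prod.mk_add_mk, smul_eq_mul]
    congr 1 <;> ring
  simp only [h1]
  have h2 : ∀ f : MultilinearMap ℂ (fun _ : I => ℂ × ℂ) ℂ, ∀ l l' : I → ℂ × ℂ,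
      f (fun i => l i + n i • (l i - l' i)) = ∑ A : Finset I, (∏ i ∈ A, n i) *
        ∑ B ∈ A.powerset, (-1) ^ B.card * f (B.piecewise l' l) := fun f l l' =>
    map_add_smul_sub f l l' n
  simp only [h2, Finset.mul_sum]
  rw [Finset.sum_comm]
  refine Finset.sum_congr rfl fun A _ => ?_
  rw [Finset.sum_comm]
  refine Finset.sum_congr rfl fun B _ => Finset.sum_congr rfl fun ε _ => ?_
  ring

lemma total_vertexEnergy (G : FeynmanGraph V I) (p : V → ℝ) (s : I → ℂ) (U : Finset V) :
    total (vertexEnergy G p s) U =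
      ∑ i, s i * crossSign G U i - Complex.I * ∑ v ∈ U, (p v : ℂ) := by
  unfold total vertexEnergy
  rw [Finset.sum_sub_distrib, sum_divergence, Finset.mul_sum]
  congr 1
  refine Finset.sum_congr rfl fun i _ => ?_
  unfold crossSign
  split_ifs <;> simp

lemma total_vertexEnergy_re (G : FeynmanGraph V I) (p : V → ℝ) (s : I → ℂ) (U : Finset V) :
    (total (vertexEnergy G p s) U).re = ∑ i, crossSign G U i * (s i).re := by
  rw [total_vertexEnergy]
  simp [mul_comm, ← Complex.ofReal_sum]

lemma abs_crossSign_le (G : FeynmanGraph V I) (U : Finset V) (i : I) : |crossSign G U i| ≤ 1 := by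
  unfold crossSign; split_ifs <;> simp

lemma crossSign_ne_zero {G : FeynmanGraph V I} {U : Finset V} {i : I} (h : Crosses G U i) :
    crossSign G U i ≠ 0 := by
  unfold crossSign; rcases h with h | h <;> simp [h]

lemma exists_crossSign_ne_zero {G : FeynmanGraph V I} (hG : G.IsConnected) {U : Finset V}
    (hU : U.Nonempty) (hU' : U ≠ Finset.univ) : ∃ i, crossSign G U i ≠ 0 := by
  obtain ⟨i, -, hi⟩ := exists_crosses_of_connected hG U hU (by
    by_contra h
    push Not at h
    exact hU' (Finset.eq_univ_iff_forall.2 h))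
  exact ⟨i, crossSign_ne_zero hi⟩

lemma total_vertexEnergy_ne_zero {G : FeynmanGraph V I} (hG : G.IsConnected) {p : V → ℝ}
    {E : I → ℝ} (hE : GenericEnergies E) (ε : I → ℤˣ) {U : Finset V} (hU : U.Nonempty)
    (hU' : U ≠ Finset.univ) : total (vertexEnergy G p fun i => sgn (ε i) * E i) U ≠ 0 := by
  intro h
  have h1 := total_vertexEnergy_re G p (fun i => sgn (ε i) * E i) U
  rw [h, Complex.zero_re] at h1
  have h2 := hE.signed ε (fun _ => 0) (crossSign G U) (abs_crossSign_le G U) (by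
    obtain ⟨i, hi⟩ := exists_crossSign_ne_zero hG hU hU'
    exact fun h => hi (congrFun h i))
  apply h2
  rw [h1]
  simp

lemma sum_flip_eq_zero [Nonempty V] {G : FeynmanGraph V I} (hG : G.IsConnected) (a b : I → ℂ)
    {p : V → ℝ} (hp : ∑ v, p v = 0) {E : I → ℝ} (hE : GenericEnergies E) {A : Finset I}
    (hA : ¬ (G.snip A).Connected) :
    ∑ B ∈ A.powerset, signedSum G a b p (flipEnergy B E) (fun _ => 1 / 2) = 0 := by
  obtain ⟨T, hT, hT', hcut⟩ := exists_cut_of_not_connected hA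
  simp only [signedSum_flip]
  simp only [signedSum_eq, piecewise_shiftPair, Finset.mul_sum]
  rw [Finset.sum_comm]
  refine Finset.sum_eq_zero fun ε _ => ?_
  have h := map_piecewise_sub (lineTopMap G (total (vertexEnergy G p fun i => sgn (ε i) * E i)))
    (fun i => shiftPair (sgn (ε i) * (1 / 2))) (fun i => shiftPair (-(sgn (ε i) * (1 / 2)))) A
  suffices h0 : lineTopMap G (total (vertexEnergy G p fun i => sgn (ε i) * E i))
      (A.piecewise ((fun i => shiftPair (sgn (ε i) * (1 / 2))) -
        fun i => shiftPair (-(sgn (ε i) * (1 / 2)))) fun i => shiftPair (sgn (ε i) * (1 / 2))) = 0 by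
    rw [h0] at h
    calc _ = (∏ i, sgn (ε i) * (a i + sgn (ε i) * (b i * E i))) * ∑ B ∈ A.powerset, _ := by
          rw [Finset.mul_sum]
          exact Finset.sum_congr rfl fun B _ => mul_left_comm _ _ _
      _ = 0 := by rw [← h, mul_zero]
  rw [lineTopMap_apply, lineTop]
  refine mul_eq_zero_of_right _ ?_
  have hu : (Finset.univ : Finset V) = T ∪ Tᶜ := by simp
  rw [hu]
  refine pairTop_union_eq_zero _ _ T Tᶜ disjoint_compl_right hT ?_ ?_ ?_ ?_
  · obtain ⟨u, hu⟩ := hT'; exact ⟨u, Finset.mem_compl.2 hu⟩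
  · intro u hu w hw
    rw [Finset.mem_compl] at hw
    refine Finset.prod_congr rfl fun i _ => ?_
    by_cases hi : i ∈ A
    · rw [Finset.piecewise_eq_of_mem _ _ _ hi]
      -- The difference of the two pairs has equal entries, so a line of `A` no longer distinguishes
      -- the order of its ends.
      have : ((fun i => shiftPair (sgn (ε i) * (1 / 2))) -
          fun i => shiftPair (-(sgn (ε i) * (1 / 2)))) i = (sgn (ε i), sgn (ε i)) := by
        simp only [Pi.sub_apply, shiftPair, Prod.mk_sub_mk]
        congr 1 <;> ring
      rw [this]
      unfold pairLine
      by_cases h1 : u = G.src i ∧ w = G.tgt i <;> by_cases h2 : u = G.tgt i ∧ w = G.src i <;>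
        grind
    · have hn : ¬ Crosses G T i := fun h => hi (hcut i h)
      have h1 : ¬(u = G.src i ∧ w = G.tgt i) := by
        rintro ⟨rfl, rfl⟩; exact hn (Or.inl ⟨hu, hw⟩)
      have h2 : ¬(u = G.tgt i ∧ w = G.src i) := by
        rintro ⟨rfl, rfl⟩; exact hn (Or.inr ⟨hw, hu⟩)
      unfold pairLine
      rw [if_neg h1, if_neg h2, if_neg (fun h => h2 h.symm), if_neg (fun h => h1 h.symm)]
  · intro U hU hUn
    rw [← hu] at hU
    exact total_vertexEnergy_ne_zero hG hE ε hUn hU.ne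
  · rw [← hu, total_vertexEnergy]
    have : ∑ v, (p v : ℂ) = 0 := by exact_mod_cast hp
    rw [this]
    simp [crossSign]

end

section

variable {V I : Type*} [Fintype V] [Fintype I]

/-! ### The zero-temperature chain sum is a rational function -/

/-- The energy denominator of old-fashioned perturbation theory. -/
def cutEnergy (G : FeynmanGraph V I) (p : V → ℝ) (E : I → ℝ) (U : Finset V) : ℂ :=
  ∑ i, (|crossSign G U i| : ℤ) * (E i : ℂ) - Complex.I * ∑ v ∈ U, (p v : ℂ)

/-- The weights that force the direction of the line. -/
def direct (e : ℤˣ) : ℂ × ℂ := if e = 1 then (1, 0) else (0, 1)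

lemma shiftPair_sgn (e : ℤˣ) : shiftPair (sgn e * (1 / 2)) = sgn e • direct e := by
  rcases Int.units_eq_one_or e with rfl | rfl
  · simp [shiftPair, direct]; norm_num
  · simp [shiftPair, direct]; norm_num

/-- Directed weights kill every ordering that places some line against its direction. If an initial
segment is crossed by all its lines along their directions, this persists when the last vertex is
removed, or else that vertex has weight zero. On such segments `ε i * crossSign` is the absolute
value, so the vertex energy is the cut energy. -/
lemma chain_directed_eq (G : FeynmanGraph V I) (p : V → ℝ) (E : I → ℝ) (ε : I → ℤˣ)
    (U : Finset V) : (∀ i, crossSign G U i ≠ 0 → crossSign G U i = ε i) →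
    chain (total (vertexEnergy G p fun i => sgn (ε i) * E i))
        (pairWeight (pairLines G fun i => direct (ε i))) U =
      chain (cutEnergy G p E) (pairWeight (pairLines G fun i => direct (ε i))) U ∧
    topChain (total (vertexEnergy G p fun i => sgn (ε i) * E i))
        (pairWeight (pairLines G fun i => direct (ε i))) U =
      topChain (cutEnergy G p E) (pairWeight (pairLines G fun i => direct (ε i))) U := by
  induction U using Finset.strongInduction with
  | H U ih =>
    intro hU
    have htop : topChain (total (vertexEnergy G p fun i => sgn (ε i) * E i))
        (pairWeight (pairLines G fun i => direct (ε i))) U =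
      topChain (cutEnergy G p E) (pairWeight (pairLines G fun i => direct (ε i))) U := by
      refine Finset.sum_congr rfl fun v hv => ?_
      by_cases hT : ∀ i, crossSign G (U.erase v) i ≠ 0 → crossSign G (U.erase v) i = ε i
      · rw [(ih _ (Finset.erase_ssubset hv) hT).1]
      · push Not at hT
        obtain ⟨i, h0, hne⟩ := hT
        suffices h : pairWeight (pairLines G fun i => direct (ε i)) (U.erase v) v = 0 by
          rw [h, mul_zero, mul_zero]
        have hzero : ∀ u ∈ U.erase v, pairLine (direct (ε i)) (G.src i) (G.tgt i) u v = 0 →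
            i ∈ nonLoops G → pairWeight (pairLines G fun i => direct (ε i)) (U.erase v) v = 0 :=
          fun u hu h hi => Finset.prod_eq_zero hu (Finset.prod_eq_zero hi h)
        have hi : i ∈ nonLoops G := mem_nonLoops.2 fun h => h0 (by simp [crossSign, h])
        have hst := mem_nonLoops.1 hi
        have hUi := hU i
        rcases Int.units_eq_one_or (ε i) with he | he
        · by_cases hs : G.src i ∈ U.erase v <;> by_cases htt : G.tgt i ∈ U.erase v <;>
            simp only [crossSign, hs, htt, if_true, if_false, he] at h0 hne <;> try simp at h0 hne
          by_cases hv' : G.src i = v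
          · refine hzero _ htt ?_ hi
            simp only [pairLine, direct, he, if_true, hv']
            simp [Finset.ne_of_mem_erase htt]
          · exfalso
            have h1 : G.src i ∉ U := fun h => hs (Finset.mem_erase.2 ⟨hv', h⟩)
            have h2 := Finset.mem_of_mem_erase htt
            simp [crossSign, h1, h2, he] at hUi
        · by_cases hs : G.src i ∈ U.erase v <;> by_cases htt : G.tgt i ∈ U.erase v <;>
            simp only [crossSign, hs, htt, if_true, if_false, he] at h0 hne <;> try simp at h0 hne
          by_cases hv' : G.tgt i = v
          · refine hzero _ hs ?_ hi
            have : (-1 : ℤˣ) ≠ 1 := by decide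
            simp [pairLine, direct, he, hv', this]
          · exfalso
            have h1 : G.tgt i ∉ U := fun h => htt (Finset.mem_erase.2 ⟨hv', h⟩)
            have h2 := Finset.mem_of_mem_erase hs
            simp [crossSign, h1, h2, he] at hUi
    refine ⟨?_, htop⟩
    rcases U.eq_empty_or_nonempty with rfl | hn
    · simp
    rw [chain_of_nonempty _ _ hn, chain_of_nonempty _ _ hn, htop]
    congr 2
    rw [total_vertexEnergy, cutEnergy]
    congr 1
    refine Finset.sum_congr rfl fun i _ => ?_
    by_cases h0 : crossSign G U i = 0
    · simp [h0]
    · rw [hU i h0]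
      rcases Int.units_eq_one_or (ε i) with he | he <;> simp [he]

/-- The chain sum of old-fashioned perturbation theory, as a function of the energies. -/
def oldSum (G : FeynmanGraph V I) (a b : I → ℂ) (p : V → ℝ) (E : I → ℝ) : ℂ :=
  lineTop G (cutEnergy G p E) fun i => (a i + b i * E i, a i - b i * E i)

/-- At `x = 1/2` each pair of weights is a sign times a directed pair, and the denominators no
longer depend on the signs. Multilinearity then sums the signs line by line into the pair `(a + bE,
a - bE)`. -/
lemma signedSum_half (G : FeynmanGraph V I) (a b : I → ℂ) (p : V → ℝ) (E : I → ℝ) :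
    signedSum G a b p E (fun _ => 1 / 2) = oldSum G a b p E := by
  have h1 : ∀ i, ((a i + b i * E i, a i - b i * E i) : ℂ × ℂ) =
      ∑ e : ℤˣ, (a i + sgn e * (b i * E i)) • direct e := by
    intro i
    rw [UnitsInt.univ, Finset.sum_pair (by decide)]
    have : (-1 : ℤˣ) ≠ 1 := by decide
    simp [direct, this]
    ring
  rw [oldSum, ← lineTopMap_apply, funext h1, MultilinearMap.map_sum, signedSum_eq]
  refine Finset.sum_congr rfl fun ε _ => ?_
  rw [MultilinearMap.map_smul_univ, funext fun i => shiftPair_sgn (ε i),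
    MultilinearMap.map_smul_univ, smul_eq_mul, smul_eq_mul, ← mul_assoc, ← Finset.prod_mul_distrib,
    lineTopMap_apply, lineTopMap_apply, lineTop, lineTop,
    (chain_directed_eq G p E ε Finset.univ (by simp [crossSign])).2]
  congr 1
  refine Finset.prod_congr rfl fun i _ => ?_
  linear_combination (a i + sgn (ε i) * (b i * E i)) * sgn_sq (ε i)

/-- `f` is given on `S` by a rational function without poles there. -/
def RationalOn (S : Set (I → ℝ)) (f : (I → ℝ) → ℂ) : Prop :=
  ∃ P Q : MvPolynomial I ℂ, ∀ E ∈ S, MvPolynomial.eval (fun i => (E i : ℂ)) Q ≠ 0 ∧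
    f E = ratEval P Q E

namespace RationalOn

variable {S : Set (I → ℝ)} {f g : (I → ℝ) → ℂ}

lemma of_eval (P : MvPolynomial I ℂ) :
    RationalOn S fun E => MvPolynomial.eval (fun i => (E i : ℂ)) P :=
  ⟨P, 1, fun E _ => by simp [ratEval]⟩

lemma const (c : ℂ) : RationalOn S fun _ => c := by
  simpa using of_eval (S := S) (MvPolynomial.C c)

lemma coord (i : I) : RationalOn S fun E => (E i : ℂ) := by
  simpa using of_eval (S := S) (MvPolynomial.X i)

lemma add (hf : RationalOn S f) (hg : RationalOn S g) : RationalOn S fun E => f E + g E := by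
  obtain ⟨P, Q, h⟩ := hf
  obtain ⟨P', Q', h'⟩ := hg
  refine ⟨P * Q' + Q * P', Q * Q', fun E hE => ?_⟩
  obtain ⟨h1, h2⟩ := h E hE
  obtain ⟨h1', h2'⟩ := h' E hE
  refine ⟨by simp [h1, h1'], ?_⟩
  show f E + g E = _
  rw [h2, h2', ratEval, ratEval, ratEval, div_add_div _ _ h1 h1']
  simp

lemma mul (hf : RationalOn S f) (hg : RationalOn S g) : RationalOn S fun E => f E * g E := by
  obtain ⟨P, Q, h⟩ := hf
  obtain ⟨P', Q', h'⟩ := hg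
  refine ⟨P * P', Q * Q', fun E hE => ?_⟩
  obtain ⟨h1, h2⟩ := h E hE
  obtain ⟨h1', h2'⟩ := h' E hE
  refine ⟨by simp [h1, h1'], ?_⟩
  show f E * g E = _
  rw [h2, h2', ratEval, ratEval, ratEval, div_mul_div_comm]
  simp

lemma inv (hf : RationalOn S f) (h0 : ∀ E ∈ S, f E ≠ 0) : RationalOn S fun E => (f E)⁻¹ := by
  obtain ⟨P, Q, h⟩ := hf
  refine ⟨Q, P, fun E hE => ?_⟩
  obtain ⟨h1, h2⟩ := h E hE
  refine ⟨fun hP => h0 E hE (by rw [h2, ratEval, hP, zero_div]), ?_⟩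
  show (f E)⁻¹ = _
  rw [h2, ratEval, ratEval, inv_div]

lemma sum {α : Type*} (s : Finset α) {f : α → (I → ℝ) → ℂ} (h : ∀ j ∈ s, RationalOn S (f j)) :
    RationalOn S fun E => ∑ j ∈ s, f j E := by
  induction s using Finset.induction_on with
  | empty => simpa using const 0
  | insert j s hj ih =>
    simp only [Finset.sum_insert hj]
    exact (h j (Finset.mem_insert_self _ _)).add (ih fun l hl => h l (Finset.mem_insert_of_mem hl))

lemma prod {α : Type*} (s : Finset α) {f : α → (I → ℝ) → ℂ} (h : ∀ j ∈ s, RationalOn S (f j)) :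
    RationalOn S fun E => ∏ j ∈ s, f j E := by
  induction s using Finset.induction_on with
  | empty => simpa using const 1
  | insert j s hj ih =>
    simp only [Finset.prod_insert hj]
    exact (h j (Finset.mem_insert_self _ _)).mul (ih fun l hl => h l (Finset.mem_insert_of_mem hl))

end RationalOn

/-- The energies at which no energy denominator vanishes. -/
def noPoles (G : FeynmanGraph V I) (p : V → ℝ) : Set (I → ℝ) :=
  {E | ∀ U : Finset V, U.Nonempty → U ≠ Finset.univ → cutEnergy G p E U ≠ 0}

lemma cutEnergy_re (G : FeynmanGraph V I) (p : V → ℝ) (E : I → ℝ) (U : Finset V) :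
    (cutEnergy G p E U).re = ∑ i, (|crossSign G U i| : ℤ) * E i := by
  rw [cutEnergy]
  simp [← Complex.ofReal_sum]

lemma mem_noPoles_of_pos {G : FeynmanGraph V I} (hG : G.IsConnected) (p : V → ℝ) {E : I → ℝ}
    (hE : ∀ i, 0 < E i) : E ∈ noPoles G p := by
  intro U hU hU' h
  have h1 := cutEnergy_re G p E U
  rw [h, Complex.zero_re] at h1
  obtain ⟨i, hi⟩ := exists_crossSign_ne_zero hG hU hU'
  have : 0 < ∑ i, (|crossSign G U i| : ℤ) * E i := by
    refine Finset.sum_pos' (fun j _ => ?_) ⟨i, Finset.mem_univ _, ?_⟩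
    · have := hE j; positivity
    · have : (0 : ℝ) < (|crossSign G U i| : ℤ) := by exact_mod_cast abs_pos.2 hi
      exact mul_pos this (hE i)
  linarith

lemma GenericEnergies.flip {E : I → ℝ} (hE : GenericEnergies E) (B : Finset I) :
    GenericEnergies (flipEnergy B E) := by
  have := hE.signed (flipSign B) fun _ => 0
  simpa [← flipEnergy_eq] using this

/-- Needed besides positive energies because the thermal operator evaluates the rational function at
reflected ones, and genericity survives reflection. -/
lemma GenericEnergies.mem_noPoles {G : FeynmanGraph V I} (hG : G.IsConnected) (p : V → ℝ)
    {E : I → ℝ} (hE : GenericEnergies E) : E ∈ noPoles G p := by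
  intro U hU hU' h
  have h1 := cutEnergy_re G p E U
  rw [h, Complex.zero_re] at h1
  obtain ⟨i, hi⟩ := exists_crossSign_ne_zero hG hU hU'
  exact hE (fun i => |crossSign G U i|) (fun i => by rw [abs_abs]; exact abs_crossSign_le G U i)
    (fun h => hi (abs_eq_zero.1 (congrFun h i))) h1.symm

/-- The only divisions are by cut energies of nonempty proper subsets; the full vertex set is
excluded by the use of `topChain`. -/
lemma rationalOn_oldSum (G : FeynmanGraph V I) (a b : I → ℂ) (p : V → ℝ) :
    RationalOn (noPoles G p) (oldSum G a b p) := by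
  have hcut : ∀ U, RationalOn (noPoles G p) fun E => cutEnergy G p E U := by
    intro U
    simp only [cutEnergy, sub_eq_add_neg]
    exact (RationalOn.sum _ fun i _ => (RationalOn.const _).mul (RationalOn.coord i)).add
      (RationalOn.const _)
  have hpm : ∀ i, RationalOn (noPoles G p) (fun E => a i + b i * E i) ∧
      RationalOn (noPoles G p) (fun E => a i - b i * E i) := by
    intro i
    refine ⟨(RationalOn.const _).add ((RationalOn.const _).mul (RationalOn.coord i)), ?_⟩
    simp only [sub_eq_add_neg, ← neg_mul]
    exact (RationalOn.const _).add ((RationalOn.const _).mul (RationalOn.coord i))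
  set l : (I → ℝ) → I → ℂ × ℂ := fun E i => (a i + b i * E i, a i - b i * E i) with hl
  have hw : ∀ T v, RationalOn (noPoles G p) fun E => pairWeight (pairLines G (l E)) T v := by
    intro T v
    refine RationalOn.prod _ fun u _ => RationalOn.prod _ fun i _ => ?_
    simp only [pairLine, hl]
    split_ifs
    · exact (hpm i).1
    · exact (hpm i).2
    · exact RationalOn.const 1
  have hstep : ∀ U : Finset V, (∀ v ∈ U, RationalOn (noPoles G p) fun E =>
      chain (cutEnergy G p E) (pairWeight (pairLines G (l E))) (U.erase v)) →
      RationalOn (noPoles G p) fun E =>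
        topChain (cutEnergy G p E) (pairWeight (pairLines G (l E))) U := fun U h =>
    RationalOn.sum _ fun v hv => (h v hv).mul (hw _ v)
  have hchain : ∀ U : Finset V, U ≠ Finset.univ → RationalOn (noPoles G p) fun E =>
      chain (cutEnergy G p E) (pairWeight (pairLines G (l E))) U := by
    intro U
    induction U using Finset.strongInduction with
    | H U ih =>
      intro hU
      rcases U.eq_empty_or_nonempty with rfl | hn
      · simpa using RationalOn.const 1
      · simp only [chain_of_nonempty _ _ hn]
        refine ((hcut U).inv fun E hE => hE U hn hU).mul (hstep U fun v hv => ih _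
          (Finset.erase_ssubset hv) ?_)
        intro h
        have := Finset.notMem_erase v U
        rw [h] at this
        exact this (Finset.mem_univ v)
  unfold oldSum lineTop
  refine (RationalOn.prod _ fun i _ => ?_).mul (hstep _ fun v _ => hchain _ ?_)
  · simp only [div_eq_mul_inv]
    exact ((hpm i).1.add (hpm i).2).mul (RationalOn.const _)
  · intro h
    have := Finset.notMem_erase v Finset.univ
    rw [h] at this
    exact this (Finset.mem_univ v)

/-! ### The thermal operator -/

lemma flipEnergy_insert {i : I} {B : Finset I} (hi : i ∉ B) (E : I → ℝ) :
    flipEnergy (insert i B) E = flipEnergy B (Function.update E i (-E i)) := by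
  funext j
  by_cases hj : j = i
  · subst hj; simp [flipEnergy, hi]
  · simp [flipEnergy, hj]

lemma noncommProd_reflection (A : Finset I) (f : (I → ℝ) → ℂ) :
    ∀ (hc : (A : Set I).Pairwise (Function.onFun Commute fun i => 1 + reflection i)) (E : I → ℝ),
    A.noncommProd (fun i => 1 + reflection i) hc f E =
      ∑ B ∈ A.powerset, f (flipEnergy B E) := by
  induction A using Finset.induction_on with
  | empty =>
    intro _ E
    simp only [Finset.noncommProd_empty, Finset.powerset_empty, Finset.sum_singleton,
      Module.End.one_apply]
    congr 1
  | insert i A hi ih =>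
    intro hc E
    rw [Finset.noncommProd_insert_of_notMem _ _ _ _ hi, Finset.sum_powerset_insert hi]
    simp only [Module.End.mul_apply, LinearMap.add_apply, Module.End.one_apply, Pi.add_apply,
      reflection, LinearMap.funLeft_apply]
    congr 1
    · exact ih _ E
    · refine (ih _ _).trans (Finset.sum_congr rfl fun B hB => ?_)
      rw [flipEnergy_insert fun h => hi (Finset.mem_powerset.1 hB h)]

lemma thermalTerm_apply (G : FeynmanGraph V I) (T : ℝ) (A : Finset I) (f : (I → ℝ) → ℂ)
    (E : I → ℝ) : G.thermalTerm T A f E =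
      (∏ i ∈ A, (G.occupation T i (E i) : ℂ)) * ∑ B ∈ A.powerset, f (flipEnergy B E) := by
  rw [FeynmanGraph.thermalTerm, Module.End.mul_apply, LinearMap.mulLeft_apply, Pi.mul_apply]
  exact congrArg _ (noncommProd_reflection A f _ E)

lemma thermalOperator_apply {G : FeynmanGraph V I} {T : ℝ} {f : (I → ℝ) → ℂ} {E : I → ℝ}
    (h : ∀ A : Finset I, ¬ (G.snip A).Connected → ∑ B ∈ A.powerset, f (flipEnergy B E) = 0) :
    G.thermalOperator T f E = ∑ A : Finset I, (∏ i ∈ A, (G.occupation T i (E i) : ℂ)) *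
      ∑ B ∈ A.powerset, f (flipEnergy B E) := by
  rw [FeynmanGraph.thermalOperator, LinearMap.sum_apply, Finset.sum_apply, Finset.sum_filter]
  refine Finset.sum_congr rfl fun A _ => ?_
  rw [thermalTerm_apply]
  split_ifs with hA
  · rfl
  · rw [h A fun hc => hA ⟨card_le_loops hc, hc⟩, mul_zero]

/-- The additional terms, from single lines whose removal disconnects the graph, contribute zero. -/
lemma thermalOperator'_apply {G : FeynmanGraph V I} {T : ℝ} {f : (I → ℝ) → ℂ} {E : I → ℝ}
    (h : ∀ A : Finset I, ¬ (G.snip A).Connected → ∑ B ∈ A.powerset, f (flipEnergy B E) = 0) :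
    G.thermalOperator' T f E = ∑ A : Finset I, (∏ i ∈ A, (G.occupation T i (E i) : ℂ)) *
      ∑ B ∈ A.powerset, f (flipEnergy B E) := by
  have h1 : ∑ A : Finset I with 2 ≤ A.card ∧ A.card ≤ G.loops ∧ (G.snip A).Connected,
      G.thermalTerm T A f E = ∑ A : Finset I with 2 ≤ A.card, G.thermalTerm T A f E := by
    rw [Finset.sum_filter, Finset.sum_filter]
    refine Finset.sum_congr rfl fun A _ => ?_
    by_cases hA : (G.snip A).Connected
    · simp [hA, card_le_loops hA]
    · simp [hA, thermalTerm_apply, h A hA]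
  have h2 : ∑ A : Finset I with ¬ 2 ≤ A.card, G.thermalTerm T A f E =
      f E + ∑ i, G.thermalTerm T {i} f E := by
    have e : (Finset.univ.filter fun A : Finset I => ¬ 2 ≤ A.card) =
        insert ∅ (Finset.univ.image fun i : I => ({i} : Finset I)) := by
      ext A
      simp only [Finset.mem_filter, Finset.mem_univ, true_and, Finset.mem_insert, Finset.mem_image]
      constructor
      · intro hA
        have : A.card = 0 ∨ A.card = 1 := by omega
        rcases this with h | h
        · exact Or.inl (Finset.card_eq_zero.1 h)
        · obtain ⟨i, hi⟩ := Finset.card_eq_one.1 h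
          exact Or.inr ⟨i, hi.symm⟩
      · rintro (rfl | ⟨i, rfl⟩) <;> simp
    rw [e, Finset.sum_insert (by simp), Finset.sum_image Finset.singleton_injective.injOn]
    congr 1
    rw [thermalTerm_apply]
    simp
    congr 1
  simp only [← thermalTerm_apply]
  rw [FeynmanGraph.thermalOperator', LinearMap.add_apply, LinearMap.add_apply, LinearMap.sum_apply,
    LinearMap.sum_apply, Pi.add_apply, Pi.add_apply, Finset.sum_apply, Finset.sum_apply, h1,
    Module.End.one_apply, ← h2, add_comm, Finset.sum_filter_add_sum_filter_not]

/-! ### Density of the generic energies -/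

lemma dense_eval_ne_zero {Q : MvPolynomial I ℂ} (hQ : Q ≠ 0) :
    Dense {E : I → ℝ | MvPolynomial.eval (fun i => (E i : ℂ)) Q ≠ 0} := by
  rw [dense_iff_inter_open]
  rintro U hU ⟨E₀, hE₀⟩
  obtain ⟨r, hr, hball⟩ := Metric.isOpen_iff.1 hU E₀ hE₀
  by_contra hne
  apply hQ
  -- A polynomial vanishing on a product of infinite sets is zero; real intervals inside the given
  -- open set suffice.
  refine MvPolynomial.funext_set (fun i => Complex.ofReal '' Set.Ioo (E₀ i - r / 2) (E₀ i + r / 2))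
    (fun i => (Set.Ioo_infinite (by linarith)).image Complex.ofReal_injective.injOn) ?_
  intro x hx
  have hx' : ∀ i, ∃ e ∈ Set.Ioo (E₀ i - r / 2) (E₀ i + r / 2), (e : ℂ) = x i := fun i =>
    hx i (Set.mem_univ i)
  choose E hE hEx using hx'
  have hEU : E ∈ U := hball (by
    rw [Metric.mem_ball]
    refine lt_of_le_of_lt ((dist_pi_le_iff (by linarith : (0 : ℝ) ≤ r / 2)).2 fun i => ?_)
      (by linarith : r / 2 < r)
    rw [Real.dist_eq, abs_le]
    constructor <;> linarith [(hE i).1, (hE i).2])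
  by_contra h0
  refine hne ⟨E, hEU, ?_⟩
  rw [map_zero] at h0
  rwa [Set.mem_ofPred_eq, funext hEx]

/-- A polynomial that vanishes at all energies that are not generic. -/
def genericPoly (I : Type*) [Fintype I] : MvPolynomial I ℂ :=
  ∏ c ∈ (Fintype.piFinset fun _ : I => ({-1, 0, 1} : Finset ℤ)).erase 0,
    ∑ i, MvPolynomial.C (c i : ℂ) * MvPolynomial.X i

lemma genericPoly_ne_zero : genericPoly I ≠ 0 := by
  refine Finset.prod_ne_zero_iff.2 fun c hc h => (Finset.ne_of_mem_erase hc) ?_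
  funext i
  have h1 := congrArg (MvPolynomial.eval (Pi.single i (1 : ℂ))) h
  simpa [Pi.single_apply] using h1

lemma genericEnergies_of_eval_ne_zero {E : I → ℝ}
    (h : MvPolynomial.eval (fun i => (E i : ℂ)) (genericPoly I) ≠ 0) : GenericEnergies E := by
  intro c hc hc0 hs
  rw [genericPoly, map_prod] at h
  refine Finset.prod_ne_zero_iff.1 h c (Finset.mem_erase.2 ⟨hc0, ?_⟩) ?_
  · rw [Fintype.mem_piFinset]
    intro i
    have := abs_le.1 (hc i)
    simp only [Finset.mem_insert, Finset.mem_singleton]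
    omega
  · simp only [map_sum, map_mul, MvPolynomial.eval_C, MvPolynomial.eval_X]
    exact_mod_cast hs

/-- The polynomial with some of the variables reflected. -/
def flipPoly (B : Finset I) (Q : MvPolynomial I ℂ) : MvPolynomial I ℂ :=
  MvPolynomial.bind₁ (fun i => if i ∈ B then -MvPolynomial.X i else MvPolynomial.X i) Q

lemma eval_flipPoly (B : Finset I) (Q : MvPolynomial I ℂ) (E : I → ℝ) :
    MvPolynomial.eval (fun i => (E i : ℂ)) (flipPoly B Q) =
      MvPolynomial.eval (fun i => (flipEnergy B E i : ℂ)) Q := by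
  rw [flipPoly, MvPolynomial.eval, MvPolynomial.eval₂Hom_bind₁]
  congr 1
  congr 1
  funext i
  unfold flipEnergy
  split_ifs <;> simp

lemma flipEnergy_flipEnergy (B : Finset I) (E : I → ℝ) : flipEnergy B (flipEnergy B E) = E := by
  funext i
  unfold flipEnergy
  split_ifs <;> simp

lemma mem_regularSet {Q : MvPolynomial I ℂ} {E : I → ℝ} : E ∈ regularSet Q ↔
    ∀ B : Finset I, MvPolynomial.eval (fun i => (flipEnergy B E i : ℂ)) Q ≠ 0 := Iff.rfl

/-- Both conditions hold where a single polynomial is nonzero. Its reflected factors are not the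
zero polynomial, since the reflection of a point with all energies `1` is a zero of none of the
corresponding ones. -/
lemma dense_regular_generic {Q : MvPolynomial I ℂ}
    (hQ : ∀ E : I → ℝ, (∀ i, 0 < E i) → MvPolynomial.eval (fun i => (E i : ℂ)) Q ≠ 0) :
    Dense {E | E ∈ regularSet Q ∧ GenericEnergies E} := by
  have h0 : genericPoly I * ∏ B : Finset I, flipPoly B Q ≠ 0 := by
    refine mul_ne_zero genericPoly_ne_zero (Finset.prod_ne_zero_iff.2 fun B _ h => ?_)
    have := eval_flipPoly B Q (flipEnergy B fun _ => 1)
    rw [flipEnergy_flipEnergy, h, map_zero] at this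
    exact hQ (fun _ => 1) (fun _ => one_pos) this.symm
  refine (dense_eval_ne_zero h0).mono fun E hE => ?_
  rw [Set.mem_ofPred_eq, map_mul, map_prod] at hE
  refine ⟨mem_regularSet.2 fun B => ?_, genericEnergies_of_eval_ne_zero (left_ne_zero_of_mul hE)⟩
  rw [← eval_flipPoly]
  exact Finset.prod_ne_zero_iff.1 (right_ne_zero_of_mul hE) B (Finset.mem_univ B)

lemma isOpen_pos : IsOpen {E : I → ℝ | ∀ i, 0 < E i} := by
  simp only [Set.ofPred_forall]
  exact isOpen_iInter_of_finite fun i => isOpen_lt continuous_const (continuous_apply i)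

lemma eq_zero_of_eval_pos {Q : MvPolynomial I ℂ}
    (hQ : ∀ E : I → ℝ, (∀ i, 0 < E i) → MvPolynomial.eval (fun i => (E i : ℂ)) Q = 0) : Q = 0 := by
  by_contra h
  obtain ⟨E, hE, hE'⟩ := dense_iff_inter_open.1 (dense_eval_ne_zero h) _ isOpen_pos
    ⟨fun _ => 1, fun _ => one_pos⟩
  exact hE' (hQ E hE)

lemma continuous_eval_ofReal (Q : MvPolynomial I ℂ) :
    Continuous fun E : I → ℝ => MvPolynomial.eval (fun i => (E i : ℂ)) Q :=
  (MvPolynomial.continuous_eval Q).comp (by fun_prop)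

lemma continuousAt_ratEval {P Q : MvPolynomial I ℂ} {E : I → ℝ}
    (h : MvPolynomial.eval (fun i => (E i : ℂ)) Q ≠ 0) : ContinuousAt (ratEval P Q) E :=
  (continuous_eval_ofReal P).continuousAt.div (continuous_eval_ofReal Q).continuousAt h

lemma continuous_flipEnergy (B : Finset I) : Continuous (flipEnergy B) := by
  refine continuous_pi fun i => ?_
  unfold flipEnergy
  split_ifs <;> fun_prop

end

section

variable {V I S : Type*} [Fintype V] [Fintype I] [Fintype S]

/-! ### From the amplitudes to the thermal operator -/

lemma continuousAt_occupation (G : FeynmanGraph V I) {T : ℝ} (hT : 0 < T) (i : I) {E : ℝ}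
    (hE : 0 < E) : ContinuousAt (G.occupation T i) E := by
  unfold FeynmanGraph.occupation
  have h1 : Real.exp (E / T) - 1 ≠ 0 := by
    have := Real.one_lt_exp_iff.2 (div_pos hE hT)
    linarith
  have h2 : Real.exp (E / T) + 1 ≠ 0 := by positivity
  split_ifs
  · have : ContinuousAt (fun E : ℝ => 1 / (Real.exp (E / T) + 1)) E :=
      continuousAt_const.div (by fun_prop) h2
    exact this.neg
  · exact continuousAt_const.div (by fun_prop) h1

lemma continuousAt_thermalTerm (G : FeynmanGraph V I) {T : ℝ} (hT : 0 < T) (A : Finset I)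
    {P Q : MvPolynomial I ℂ} {E : I → ℝ} (hE : ∀ i, 0 < E i) (hQ : E ∈ regularSet Q) :
    ContinuousAt (G.thermalTerm T A (ratEval P Q)) E := by
  have : G.thermalTerm T A (ratEval P Q) = fun E => (∏ i ∈ A, (G.occupation T i (E i) : ℂ)) *
      ∑ B ∈ A.powerset, ratEval P Q (flipEnergy B E) := funext (thermalTerm_apply G T A _)
  rw [this]
  refine ContinuousAt.mul ?_ ?_
  · refine tendsto_finsetProd _ fun i _ => ?_
    exact (Complex.continuous_ofReal.continuousAt).comp
      (ContinuousAt.comp (f := fun E : I → ℝ => E i) (continuousAt_occupation G hT i (hE i))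
        (continuous_apply i).continuousAt)
  · refine tendsto_finsetSum _ fun B _ => ?_
    exact ContinuousAt.comp (f := flipEnergy B) (continuousAt_ratEval (mem_regularSet.1 hQ B))
      (continuous_flipEnergy B).continuousAt

lemma continuousAt_thermalOperator (G : FeynmanGraph V I) {T : ℝ} (hT : 0 < T)
    {P Q : MvPolynomial I ℂ} {E : I → ℝ} (hE : ∀ i, 0 < E i) (hQ : E ∈ regularSet Q)
    {O : Module.End ℂ ((I → ℝ) → ℂ)} (hO : O = G.thermalOperator T ∨ O = G.thermalOperator' T) :
    ContinuousAt (O (ratEval P Q)) E := by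
  have hsum : ∀ s : Finset (Finset I),
      ContinuousAt (fun E => ∑ A ∈ s, G.thermalTerm T A (ratEval P Q) E) E := fun s =>
    tendsto_finsetSum _ fun A _ => continuousAt_thermalTerm G hT A hE hQ
  rcases hO with rfl | rfl
  · have : G.thermalOperator T (ratEval P Q) = fun E => ∑ A ∈ Finset.univ.filter
        fun A : Finset I => A.card ≤ G.loops ∧ (G.snip A).Connected,
        G.thermalTerm T A (ratEval P Q) E := by
      funext E
      rw [FeynmanGraph.thermalOperator, LinearMap.sum_apply, Finset.sum_apply]
    rw [this]
    exact hsum _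
  · have : G.thermalOperator' T (ratEval P Q) = fun E => ratEval P Q E +
        (∑ i, G.thermalTerm T {i} (ratEval P Q) E) + ∑ A ∈ Finset.univ.filter
        fun A : Finset I => 2 ≤ A.card ∧ A.card ≤ G.loops ∧ (G.snip A).Connected,
        G.thermalTerm T A (ratEval P Q) E := by
      funext E
      rw [FeynmanGraph.thermalOperator', LinearMap.add_apply, LinearMap.add_apply,
        LinearMap.sum_apply, LinearMap.sum_apply, Pi.add_apply, Pi.add_apply, Finset.sum_apply,
        Finset.sum_apply, Module.End.one_apply]
    rw [this]
    refine ((continuousAt_ratEval ?_).add (tendsto_finsetSum _ fun i _ =>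
      continuousAt_thermalTerm G hT {i} hE hQ)).add (hsum _)
    simpa [flipEnergy] using mem_regularSet.1 hQ ∅

lemma eq_of_continuousAt_of_dense {f g : (I → ℝ) → ℂ} {D : Set (I → ℝ)} (hD : Dense D)
    (h : ∀ E ∈ D, (∀ i, 0 < E i) → f E = g E) {E : I → ℝ} (hE : ∀ i, 0 < E i)
    (hf : ContinuousAt f E) (hg : ContinuousAt g E) : f E = g E := by
  have : (𝓝[D] E).NeBot := mem_closure_iff_nhdsWithin_neBot.1 (hD E)
  have hf' := hf.tendsto.mono_left (nhdsWithin_le_nhds (s := D))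
  have hg' := hg.tendsto.mono_left (nhdsWithin_le_nhds (s := D))
  refine tendsto_nhds_unique (hf'.congr' ?_) hg'
  filter_upwards [self_mem_nhdsWithin, nhdsWithin_le_nhds (isOpen_pos.mem_nhds hE)] with E' h1 h2
  exact h E' h1 h2

section assembly

variable {G : FeynmanGraph V I} (hG : G.IsConnected) {p : V → ℝ} (hp : ∑ v, p v = 0)
  {w : S → ℂ} {a b : S → I → ℂ} {F₀ : (I → ℝ) → ℂ} (hc₀ : ∀ E : I → ℝ, (∀ i, 0 < E i) → ContinuousAt F₀ E)
  (h₀ : ∀ E : I → ℝ, (∀ i, 0 < E i) → GenericEnergies E →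
    F₀ E = ∑ σ, w σ * signedSum G (a σ) (b σ) p E fun _ => 1 / 2)

include hG

lemma rationalOn_sum_oldSum :
    RationalOn (noPoles G p) fun E => ∑ σ, w σ * oldSum G (a σ) (b σ) p E :=
  RationalOn.sum _ fun _ _ => (RationalOn.const _).mul (rationalOn_oldSum G _ _ p)

include hc₀ h₀

lemma zeroTemp_eq_oldSum {E : I → ℝ} (hE : ∀ i, 0 < E i) :
    F₀ E = ∑ σ, w σ * oldSum G (a σ) (b σ) p E := by
  have h1 : (1 : MvPolynomial I ℂ) ≠ 0 := one_ne_zero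
  -- With denominator `1` regularity is no condition, so this is the density of generic energies.
  have hd : Dense {E : I → ℝ | E ∈ regularSet (1 : MvPolynomial I ℂ) ∧ GenericEnergies E} :=
    dense_regular_generic fun E _ => by simp
  refine eq_of_continuousAt_of_dense (g := fun E => ∑ σ, w σ * oldSum G (a σ) (b σ) p E) hd
    (fun E hg hE => ?_) hE (hc₀ E hE) ?_
  · rw [h₀ E hE hg.2]
    simp only [signedSum_half]
  · obtain ⟨P, Q, h⟩ := rationalOn_sum_oldSum hG (p := p) (w := w) (a := a) (b := b)
    refine (continuousAt_ratEval (P := P) (h E (mem_noPoles_of_pos hG p hE)).1).congr ?_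
    filter_upwards [isOpen_pos.mem_nhds hE] with E' hE'
    exact (h E' (mem_noPoles_of_pos hG p hE')).2.symm

lemma exists_rationalExtension : ∃ P Q : MvPolynomial I ℂ, IsRationalExtension F₀ P Q := by
  obtain ⟨P, Q, h⟩ := rationalOn_sum_oldSum hG (p := p) (w := w) (a := a) (b := b)
  refine ⟨P, Q, fun E hE => ?_⟩
  rw [zeroTemp_eq_oldSum hG hc₀ h₀ hE]
  exact h E (mem_noPoles_of_pos hG p hE)

/-- Two rational functions that agree at positive energies satisfy a polynomial identity, which then
holds at energies of either sign. So the choice of `P` and `Q` does not matter. -/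
lemma ratEval_eq_oldSum {P Q : MvPolynomial I ℂ} (hPQ : IsRationalExtension F₀ P Q) {E : I → ℝ}
    (hE : GenericEnergies E) (hQ : MvPolynomial.eval (fun i => (E i : ℂ)) Q ≠ 0) :
    ratEval P Q E = ∑ σ, w σ * oldSum G (a σ) (b σ) p E := by
  obtain ⟨P', Q', h⟩ := rationalOn_sum_oldSum hG (p := p) (w := w) (a := a) (b := b)
  have hpoly : P * Q' - P' * Q = 0 := eq_zero_of_eval_pos fun E hE => by
    obtain ⟨h1, h2⟩ := hPQ E hE
    obtain ⟨h3, h4⟩ := h E (mem_noPoles_of_pos hG p hE)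
    dsimp only at h4
    rw [zeroTemp_eq_oldSum hG hc₀ h₀ hE, h4, ratEval, ratEval, div_eq_div_iff h3 h1] at h2
    rw [map_sub, map_mul, map_mul, h2, sub_self]
  obtain ⟨h3, h4⟩ := h E (hE.mem_noPoles hG p)
  have := congrArg (MvPolynomial.eval fun i => (E i : ℂ)) hpoly
  rw [map_sub, map_mul, map_mul, map_zero, sub_eq_zero] at this
  dsimp only at h4
  rw [h4, ratEval, ratEval, div_eq_div_iff hQ h3, this]

include hp

/-- At generic regular energies the expansion in occupation factors applies literally. Continuity of
both sides extends it to all regular positive energies, and continuity of `F` alone turns it into a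
limit at the remaining ones. -/
lemma thermalOperator_ratEval {T : ℝ} (hT : 0 < T) {F : (I → ℝ) → ℂ}
    (hcF : ∀ E : I → ℝ, (∀ i, 0 < E i) → ContinuousAt F E)
    (hF : ∀ E : I → ℝ, (∀ i, 0 < E i) → GenericEnergies E →
      F E = ∑ σ, w σ * signedSum G (a σ) (b σ) p E (thermalWeight G T E))
    {P Q : MvPolynomial I ℂ} (hPQ : IsRationalExtension F₀ P Q)
    {O : Module.End ℂ ((I → ℝ) → ℂ)} (hO : O = G.thermalOperator T ∨ O = G.thermalOperator' T)
    {E : I → ℝ} (hE : ∀ i, 0 < E i) :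
    (E ∈ regularSet Q → F E = O (ratEval P Q) E) ∧ E ∈ closure (regularSet Q) ∧
      Tendsto (O (ratEval P Q)) (𝓝[regularSet Q] E) (𝓝 (F E)) := by
  have hne : Nonempty V := hG.nonempty
  have hd := dense_regular_generic fun E hE => (hPQ E hE).1
  have hgen : ∀ E ∈ {E | E ∈ regularSet Q ∧ GenericEnergies E}, (∀ i, 0 < E i) →
      F E = O (ratEval P Q) E := by
    rintro E ⟨hreg, hg⟩ hE
    have hflip : ∀ A : Finset I, ∑ B ∈ A.powerset, ratEval P Q (flipEnergy B E) =
        ∑ σ, w σ * ∑ B ∈ A.powerset, signedSum G (a σ) (b σ) p (flipEnergy B E) fun _ => 1 / 2 := by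
      intro A
      simp only [Finset.mul_sum]
      rw [Finset.sum_comm]
      refine Finset.sum_congr rfl fun B _ => ?_
      rw [ratEval_eq_oldSum hG hc₀ h₀ hPQ (hg.flip B) (mem_regularSet.1 hreg B)]
      simp only [signedSum_half]
    have hvan : ∀ A : Finset I, ¬ (G.snip A).Connected →
        ∑ B ∈ A.powerset, ratEval P Q (flipEnergy B E) = 0 := by
      intro A hA
      rw [hflip]
      exact Finset.sum_eq_zero fun σ _ => by rw [sum_flip_eq_zero hG _ _ hp hg hA, mul_zero]
    have hOE : O (ratEval P Q) E = ∑ A : Finset I, (∏ i ∈ A, (G.occupation T i (E i) : ℂ)) *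
        ∑ B ∈ A.powerset, ratEval P Q (flipEnergy B E) := by
      rcases hO with rfl | rfl
      · exact thermalOperator_apply hvan
      · exact thermalOperator'_apply hvan
    rw [hOE, hF E hE hg]
    simp only [hflip]
    have : ∀ σ, signedSum G (a σ) (b σ) p E (thermalWeight G T E) = _ := fun σ =>
      signedSum_half_add G (a σ) (b σ) p E fun i => (G.occupation T i (E i) : ℂ)
    simp only [this, Finset.mul_sum]
    rw [Finset.sum_comm]
    refine Finset.sum_congr rfl fun A _ => Finset.sum_congr rfl fun σ _ =>
      Finset.sum_congr rfl fun B _ => ?_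
    ring
  have hreg : ∀ E : I → ℝ, (∀ i, 0 < E i) → E ∈ regularSet Q → F E = O (ratEval P Q) E :=
    fun E hE hEQ => eq_of_continuousAt_of_dense hd hgen hE (hcF E hE)
      (continuousAt_thermalOperator G hT hE hEQ hO)
  refine ⟨hreg E hE, (hd.mono fun E h => h.1) E, ?_⟩
  refine ((hcF E hE).tendsto.mono_left nhdsWithin_le_nhds).congr' ?_
  filter_upwards [self_mem_nhdsWithin, nhdsWithin_le_nhds (isOpen_pos.mem_nhds hE)] with E' h1 h2
  exact hreg E' h2 h1

end assembly

end

section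

variable {V I ι κ : Type*} [Fintype V] [Fintype I] [Fintype ι] [Fintype κ]

/-! ### Sums and integrals over boxes -/

/-- Used to separate the self-loops, whose energies do not enter the conservation equations. -/
lemma sum_box_split (P : ι → Prop) (s : Finset ℤ) (F : ({i // P i} → ℤ) → ℂ) (g : ι → ℤ → ℂ) :
    ∑ n ∈ Fintype.piFinset (fun _ : ι => s), F (fun i => n i) * ∏ i : {i // ¬P i}, g i (n i) =
      (∑ m ∈ Fintype.piFinset (fun _ : {i // P i} => s), F m) *
        ∏ i : {i // ¬P i}, ∑ z ∈ s, g i z := by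
  rw [Finset.prod_univ_sum, Finset.sum_mul_sum, ← Finset.sum_product']
  refine Finset.sum_equiv (Equiv.piEquivPiSubtypeProd P fun _ => ℤ) (fun n => ?_) fun n _ => rfl
  simp only [Fintype.mem_piFinset, Finset.mem_product, Equiv.piEquivPiSubtypeProd_apply]
  refine ⟨fun h => ⟨fun i => h i, fun i => h i⟩, fun h i => ?_⟩
  by_cases hi : P i
  · exact h.1 ⟨i, hi⟩
  · exact h.2 ⟨i, hi⟩

lemma tendsto_box [DecidableEq ι] : Tendsto (fun M : ℕ => Fintype.piFinset fun _ : ι => Finset.Icc (-(M : ℤ)) M)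
    atTop atTop := by
  refine tendsto_atTop_finset_of_monotone (fun M M' h => ?_) fun n => ?_
  · refine Fintype.piFinset_subset _ _ fun _ => Finset.Icc_subset_Icc ?_ ?_
    · exact neg_le_neg (by exact_mod_cast h)
    · exact_mod_cast h
  · refine ⟨∑ i, (n i).natAbs, ?_⟩
    rw [Fintype.mem_piFinset]
    intro i
    have h : (n i).natAbs ≤ ∑ i, (n i).natAbs :=
      Finset.single_le_sum (f := fun i => (n i).natAbs) (fun _ _ => Nat.zero_le _) (Finset.mem_univ i)
    rw [Finset.mem_Icc]
    omega

lemma _root_.HasSum.tendsto_box [DecidableEq ι] {f : (ι → ℤ) → ℂ} {a : ℂ} (h : HasSum f a) :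
    Tendsto (fun M : ℕ => ∑ m ∈ Fintype.piFinset fun _ : ι => Finset.Icc (-(M : ℤ)) M, f m)
      atTop (𝓝 a) := by
  have h' : Tendsto (fun S : Finset (ι → ℤ) => ∑ m ∈ S, f m) atTop (𝓝 a) := h
  exact h'.comp ThermalOperator.tendsto_box

lemma volume_restrict_box (Λ : ℝ) :
    (volume : Measure (ι → ℝ)).restrict (Set.Icc (fun _ => -Λ) fun _ => Λ) =
      Measure.pi fun _ => volume.restrict (Set.Icc (-Λ) Λ) := by
  rw [← Set.pi_univ_Icc, volume_pi, Measure.restrict_pi_pi]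

lemma setIntegral_box_split (P : ι → Prop) (Λ : ℝ) (F : ({i // P i} → ℝ) → ℂ) (g : ι → ℝ → ℂ) :
    ∫ x in Set.Icc (fun _ : ι => -Λ) (fun _ => Λ),
        F (fun i => x i) * ∏ i : {i // ¬P i}, g i (x i) =
      (∫ u in Set.Icc (fun _ : {i // P i} => -Λ) (fun _ => Λ), F u) *
        ∏ i : {i // ¬P i}, ∫ k in Set.Icc (-Λ) Λ, g i k := by
  rw [volume_restrict_box, volume_restrict_box]
  have hmp := measurePreserving_piEquivPiSubtypeProd
    (fun _ : ι => (volume : Measure ℝ).restrict (Set.Icc (-Λ) Λ)) P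
  have h1 := hmp.integral_comp' (fun z : ({i // P i} → ℝ) × ({i // ¬P i} → ℝ) =>
    F z.1 * ∏ i : {i // ¬P i}, g i (z.2 i))
  rw [integral_prod_mul F fun y : {i // ¬P i} → ℝ => ∏ i : {i // ¬P i}, g i (y i)] at h1
  rw [integral_fintype_prod_eq_prod (fun i : {i // ¬P i} => g i)] at h1
  exact h1

lemma integrable_split (P : ι → Prop) {F : ({i // P i} → ℝ) → ℂ} {g : ι → ℝ → ℂ}
    (hF : Integrable F) (hg : ∀ i, ¬P i → Integrable (g i)) :
    Integrable fun x : ι → ℝ => F (fun i => x i) * ∏ i : {i // ¬P i}, g i (x i) := by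
  have hmp := measurePreserving_piEquivPiSubtypeProd (fun _ : ι => (volume : Measure ℝ)) P
  have h0 : Integrable (fun y : {i // ¬P i} → ℝ => ∏ i : {i // ¬P i}, g i.1 (y i))
      (Measure.pi fun _ => volume) :=
    Integrable.fintype_prod (μ := fun _ : {i // ¬P i} => (volume : Measure ℝ))
      (f := fun (i : {i // ¬P i}) (x : ℝ) => g i.1 x) fun i => hg i i.2
  have hF' : Integrable F (Measure.pi fun _ => volume) := hF
  have h1 := hF'.mul_prod h0
  exact (hmp.integrable_comp_emb (MeasurableEquiv.measurableEmbedding _)).2 h1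

lemma summable_split (P : ι → Prop) {F : ({i // P i} → ℤ) → ℂ} {g : ι → ℤ → ℂ}
    (hF : Summable fun m => ‖F m‖) (hg : ∀ i, ¬P i → Summable fun z => ‖g i z‖) :
    Summable fun n : ι → ℤ => F (fun i => n i) * ∏ i : {i // ¬P i}, g i (n i) := by
  have h1 : Summable fun y : {i // ¬P i} → ℤ => ‖∏ i : {i // ¬P i}, g i.1 (y i)‖ := by
    have h := Integrable.fintype_prod (μ := fun _ : {i // ¬P i} => (Measure.count : Measure ℤ))
      (f := fun (i : {i // ¬P i}) (x : ℤ) => g i.1 x)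
      fun i => integrable_count_iff.2 (hg i i.2)
    rw [pi_count] at h
    exact integrable_count_iff.1 h
  have h2 : Summable fun z : ({i // P i} → ℤ) × ({i // ¬P i} → ℤ) =>
      F z.1 * ∏ i : {i // ¬P i}, g i.1 (z.2 i) :=
    Summable.of_norm (Summable.mul_norm (f := F)
      (g := fun y : {i // ¬P i} → ℤ => ∏ i : {i // ¬P i}, g i.1 (y i)) hF h1)
  have h3 := h2.comp_injective (Equiv.piEquivPiSubtypeProd P fun _ => ℤ).injective
  exact h3

lemma aecover_box : AECover (volume : Measure (ι → ℝ)) atTop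
    fun Λ : ℝ => Set.Icc (fun _ : ι => -Λ) fun _ => Λ where
  ae_eventually_mem := ae_of_all _ fun x => by
    have : ∀ᶠ Λ : ℝ in atTop, ∀ i, |x i| ≤ Λ := eventually_all.2 fun i => eventually_ge_atTop _
    filter_upwards [this] with Λ h
    exact ⟨fun i => (abs_le.1 (h i)).1, fun i => (abs_le.1 (h i)).2⟩
  measurableSet _ := measurableSet_Icc

/-! ### Self-loops -/

/-- A scalar propagator is the product of two linear factors whose sum is `Y = 2E`, so the one-line
integral and sum cover the self-loops of scalar lines. -/
lemma scalar_propagator_eq (a : ℂ) {E : ℝ} (k : ℝ) : lineProp a 0 E k =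
    2 * E * a * (((E : ℂ) - Complex.I * k) * ((2 * E : ℝ) - (E - Complex.I * k)))⁻¹ := by
  have : ((E : ℂ) - Complex.I * k) * ((2 * E : ℝ) - (E - Complex.I * k)) =
      (k : ℂ) ^ 2 + (E : ℂ) ^ 2 := by
    push_cast; ring_nf; rw [Complex.I_sq]; ring
  rw [this, lineProp, mul_zero, add_zero, div_eq_mul_inv]

lemma integral_scalar (a : ℂ) {E : ℝ} (hE : 0 < E) :
    Integrable (lineProp a 0 E) ∧ ∫ k, lineProp a 0 E k = 2 * Real.pi * a := by
  obtain ⟨h1, h2⟩ := integral_mul_propagators E hE.ne' (2 * E : ℝ)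
    (by rw [Complex.ofReal_re]; linarith) (by rw [Complex.ofReal_re]; linarith)
  have e : lineProp a 0 E = fun k : ℝ =>
      2 * E * a * (((E : ℂ) - Complex.I * k) * ((2 * E : ℝ) - (E - Complex.I * k)))⁻¹ :=
    funext fun k => scalar_propagator_eq a k
  rw [e]
  refine ⟨h1.const_mul _, ?_⟩
  rw [integral_const_mul, h2]
  have hE' : (E : ℂ) ≠ 0 := by exact_mod_cast hE.ne'
  have e1 : halfSign E = 1 / 2 := by simp [halfSign, hE]
  have e2 : halfSign ((2 * E : ℝ) - E) = 1 / 2 := by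
    have : ((2 * E : ℝ) : ℂ) - E = E := by push_cast; ring
    rw [this, e1]
  rw [e1, e2]
  push_cast
  field_simp
  norm_num
  ring

/-- The part of the numerator linear in `k` is not integrable but odd, and cancels over symmetric
intervals. -/
lemma tendsto_integral_loop (a b : ℂ) {E : ℝ} (hE : 0 < E) :
    Tendsto (fun Λ : ℝ => ∫ k in Set.Icc (-Λ) Λ, lineProp a b E k) atTop (𝓝 (2 * Real.pi * a)) := by
  obtain ⟨h1, h2⟩ := integral_scalar a hE
  have h3 := (aecover_Icc (μ := volume) tendsto_neg_atTop_atBot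
    tendsto_id).integral_tendsto_of_countably_generated h1
  rw [h2] at h3
  refine h3.congr' ?_
  filter_upwards [eventually_ge_atTop 0] with Λ hΛ
  have hodd : ∫ k in (-Λ)..Λ, lineProp 0 b E k = 0 := by
    have h := intervalIntegral.integral_comp_neg (a := -Λ) (b := Λ) (lineProp 0 b E)
    have e : ∀ k : ℝ, lineProp 0 b E (-k) = -lineProp 0 b E k := fun k => by
      simp only [lineProp]; push_cast; ring
    simp only [e, neg_neg, intervalIntegral.integral_neg] at h
    exact self_eq_neg.1 h.symm
  have hadd : ∀ k : ℝ, lineProp a b E k = lineProp a 0 E k + lineProp 0 b E k := fun k => by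
    simp only [lineProp]; ring
  have hle : -Λ ≤ Λ := by linarith
  simp only [id]
  rw [integral_Icc_eq_integral_Ioc, integral_Icc_eq_integral_Ioc,
    ← intervalIntegral.integral_of_le hle, ← intervalIntegral.integral_of_le hle]
  simp only [hadd]
  rw [intervalIntegral.integral_add, hodd, add_zero]
  · exact (continuous_lineProp _ _ hE).intervalIntegrable _ _
  · exact (continuous_lineProp _ _ hE).intervalIntegrable _ _

/-- The box is symmetric in `n`, not in the half-integral frequencies. The offset is put into the
argument of `tendsto_sum_inv_sub_freq`, and the terms with `b` cancel between the two signs `e` in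
the limit. -/
lemma tendsto_sum_loop (G : FeynmanGraph V I) {T : ℝ} (hT : 0 < T) {E : I → ℝ} (hE : ∀ i, 0 < E i)
    (a b : ℂ) (i : I) : Tendsto (fun M : ℕ => ∑ n ∈ Finset.Icc (-(M : ℤ)) M,
      lineProp a b (E i) (2 * Real.pi * T * (n + freqOffset G i))) atTop
      (𝓝 ((T : ℂ)⁻¹ * (2 * a * thermalWeight G T E i))) := by
  have h : ∀ e : ℤˣ, Tendsto (fun M : ℕ => ∑ n ∈ Finset.Icc (-(M : ℤ)) M,
      (sgn e * E i - Complex.I * (2 * Real.pi * T * freqOffset G i : ℝ) -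
        Complex.I * (2 * Real.pi * T * n))⁻¹) atTop
      (𝓝 ((T : ℂ)⁻¹ * (sgn e * thermalWeight G T E i))) := fun e => by
    rw [← halfCoth_signed G hT hE e i]
    exact tendsto_sum_inv_sub_freq hT (signed_re_ne_zero (hE i).ne' e _)
  have h2 := tendsto_finsetSum Finset.univ fun e _ =>
    (h e).const_mul (sgn e * (a + sgn e * (b * E i)))
  have e1 : ∑ e : ℤˣ, sgn e * (a + sgn e * (b * E i)) * ((T : ℂ)⁻¹ *
      (sgn e * thermalWeight G T E i)) = (T : ℂ)⁻¹ * (2 * a * thermalWeight G T E i) := by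
    rw [sum_sgn]; simp; ring
  rw [e1] at h2
  refine h2.congr fun M => ?_
  simp only [Finset.mul_sum]
  rw [Finset.sum_comm]
  refine Finset.sum_congr rfl fun n _ => ?_
  rw [lineProp_eq _ _ (hE i).ne']
  refine Finset.sum_congr rfl fun e _ => ?_
  congr 2
  push_cast
  ring

lemma summable_scalar (a : ℂ) {E T : ℝ} (hE : 0 < E) (hT : 0 < T) :
    Summable fun n : ℤ => ‖lineProp a 0 E (2 * Real.pi * T * n)‖ := by
  have h := (hasSum_mul_propagators (w := E) (Y := (2 * E : ℝ)) hT (by simpa using hE.ne')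
    (by rw [Complex.ofReal_re]; linarith) (by rw [Complex.ofReal_re, Complex.ofReal_re]; linarith)).2
  refine (h.mul_left ‖2 * E * a‖).congr fun n => ?_
  rw [scalar_propagator_eq, norm_mul _ ((_ : ℂ)⁻¹)]
  push_cast
  rfl

/-! ### The constraints of energy conservation -/

variable {G : FeynmanGraph V I} {t : Finset I} {c : κ → I}

/-- The line `i` is not a self-loop. -/
def NonLoop (G : FeynmanGraph V I) (i : I) : Prop := G.src i ≠ G.tgt i

lemma mem_nonLoops_iff {i : I} : i ∈ nonLoops G ↔ NonLoop G i := mem_nonLoops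

/-- Extension by zero to the self-loops. -/
def extendLoops {M : Type*} [Zero M] (G : FeynmanGraph V I) (m : {i // NonLoop G i} → M)
    (i : I) : M := if h : NonLoop G i then m ⟨i, h⟩ else 0

/-- A term of a sum over the integers on the lines that are not self-loops. -/
def flowTerm (G : FeynmanGraph V I) (q : V → ℤ) (g : I → ℤ → ℂ)
    (m : {i // NonLoop G i} → ℤ) : ℂ :=
  if ∀ v, divergence G (extendLoops G m) v = q v then ∏ i, g i.1 (m i) else 0

lemma prod_nonLoops_subtype (G : FeynmanGraph V I) (f : I → ℂ) :
    ∏ i ∈ nonLoops G, f i = ∏ i : {i // NonLoop G i}, f i :=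
  Finset.prod_subtype _ (fun _ => mem_nonLoops_iff) f

lemma prod_loops_subtype (G : FeynmanGraph V I) (f : I → ℂ) :
    ∏ i ∈ (nonLoops G)ᶜ, f i = ∏ i : {i // ¬ NonLoop G i}, f i :=
  Finset.prod_subtype _ (fun _ => by rw [Finset.mem_compl, mem_nonLoops_iff]) f

/-- The conserved integer configurations are the injective image of the independent integers, and
the term vanishes off this image. -/
lemma hasSum_flowTerm (ht : GrownTree G Finset.univ t) (hc : Enumerates G t c) {q : V → ℤ}
    (hq : ∑ v, q v = 0) {g : I → ℤ → ℂ}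
    (hint : Integrable (fun u : κ → ℤ => ∏ i ∈ nonLoops G, g i (coordFlow G t q c u i))
      Measure.count) :
    HasSum (flowTerm G q g)
        (∫ u : κ → ℤ, ∏ i ∈ nonLoops G, g i (coordFlow G t q c u i) ∂Measure.count) ∧
      Summable fun m => ‖flowTerm G q g m‖ := by
  set φ : (κ → ℤ) → ({i // NonLoop G i} → ℤ) := fun u i => coordFlow G t q c u i with hφ
  have hinj : Function.Injective φ := fun u u' h => coordFlow_injective_on ht hc hq ht
    fun i hi _ => congrFun h ⟨i, mem_nonLoops_iff.1 hi⟩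
  have hext : ∀ u v, divergence G (extendLoops G (φ u)) v = q v := fun u v => by
    rw [← divergence_coordFlow ht hc hq u v]
    refine divergence_congr (fun i hi => ?_) v
    simp [extendLoops, mem_nonLoops_iff.1 hi, hφ]
  have hrange : ∀ m, m ∉ Set.range φ → flowTerm G q g m = 0 := by
    intro m hm
    rw [flowTerm, if_neg]
    intro h
    refine hm ⟨fun j => extendLoops G m (c j), funext fun i => ?_⟩
    have := coordFlow_eq_on_nonLoops ht hc hq (k := extendLoops G m) (fun j => rfl) h i.1
      (mem_nonLoops_iff.2 i.2)
    rw [hφ]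
    dsimp only
    rw [this, extendLoops, dif_pos i.2]
  have hcomp : flowTerm G q g ∘ φ =
      fun u => ∏ i ∈ nonLoops G, g i (coordFlow G t q c u i) := by
    funext u
    rw [Function.comp_apply, flowTerm, if_pos (hext u), prod_nonLoops_subtype]
  have hs := integrable_count_iff.1 hint
  have hsum : HasSum (flowTerm G q g ∘ φ)
      (∫ u : κ → ℤ, ∏ i ∈ nonLoops G, g i (coordFlow G t q c u i) ∂Measure.count) := by
    rw [hcomp, integral_countable hint]
    simpa [Measure.real] using hs.of_norm.hasSum
  refine ⟨(hinj.hasSum_iff hrange).1 hsum, ?_⟩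
  refine (hinj.summable_iff fun m hm => by rw [hrange m hm, norm_zero]).1 ?_
  show Summable fun u => ‖(flowTerm G q g ∘ φ) u‖
  rw [hcomp]
  exact hs

lemma conserves_iff {p : V → ℝ} {k : I → ℝ} :
    G.Conserves p k ↔ ∀ v, divergence G k v = p v := by
  refine forall_congr' fun v => ?_
  rw [divergence, Finset.sum_sub_distrib, ← Finset.sum_filter, ← Finset.sum_filter]
  constructor <;> intro h <;> linarith

lemma freq_eq (G : FeynmanGraph V I) (T : ℝ) (n : I → ℤ) (i : I) :
    G.freq T n i = 2 * Real.pi * T * (n i + freqOffset G i) := by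
  unfold FeynmanGraph.freq freqOffset
  split_ifs <;> simp

lemma divergence_freq (G : FeynmanGraph V I) (T : ℝ) (n : I → ℤ) (v : V) :
    divergence G (G.freq T n) v =
      2 * Real.pi * T * (divergence G n v + divergence G (freqOffset G) v) := by
  simp only [divergence, freq_eq, Int.cast_sum, ← Finset.sum_add_distrib, Finset.mul_sum]
  refine Finset.sum_congr rfl fun i _ => ?_
  split_ifs <;> push_cast <;> ring

lemma exists_int_divergence {T : ℝ} (hT : 0 < T) {p : V → ℝ} (hp : G.IsExternal T p) :
    ∃ q : V → ℤ, ∑ v, q v = 0 ∧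
      ∀ v, p v = 2 * Real.pi * T * (q v + divergence G (freqOffset G) v) := by
  obtain ⟨h0, h⟩ := hp
  choose q hq using h
  have hT2 : 2 * Real.pi * T ≠ 0 := by positivity
  -- With `s` outgoing and `r` incoming fermionic line ends, `(s + r) / 2 = r + (s - r) / 2`. The
  -- second summand is the divergence of the frequency offsets, and `r` is absorbed into the
  -- integer.
  have hv : ∀ v, p v = 2 * Real.pi * T *
      (((q v + (Finset.univ.filter fun i => G.fermionic i ∧ G.tgt i = v).card : ℤ) : ℝ) +
        divergence G (freqOffset G) v) := by
    intro v
    rw [hq v]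
    congr 1
    have : divergence G (freqOffset G) v =
        ((Finset.univ.filter fun i => G.fermionic i ∧ G.src i = v).card : ℝ) / 2 -
          ((Finset.univ.filter fun i => G.fermionic i ∧ G.tgt i = v).card : ℝ) / 2 := by
      rw [divergence, Finset.sum_sub_distrib, Finset.card_filter, Finset.card_filter]
      push_cast
      rw [Finset.sum_div, Finset.sum_div]
      congr 1 <;>
      · refine Finset.sum_congr rfl fun i _ => ?_
        unfold freqOffset
        split_ifs <;> simp_all
    rw [this]
    push_cast
    ring
  refine ⟨_, ?_, hv⟩
  simp only [hv, ← Finset.mul_sum, Finset.sum_add_distrib] at h0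
  rw [sum_divergence] at h0
  have h1 := (mul_eq_zero.1 h0).resolve_left hT2
  simp only [Finset.mem_univ, if_true, sub_self, Finset.sum_const_zero, add_zero] at h1
  exact_mod_cast h1

lemma conserves_freq_iff {T : ℝ} (hT : 0 < T) {p : V → ℝ} {q : V → ℤ}
    (hpq : ∀ v, p v = 2 * Real.pi * T * (q v + divergence G (freqOffset G) v)) (n : I → ℤ) :
    G.Conserves p (G.freq T n) ↔ ∀ v, divergence G n v = q v := by
  have hT2 : 2 * Real.pi * T ≠ 0 := by positivity
  rw [conserves_iff]
  refine forall_congr' fun v => ?_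
  rw [divergence_freq, hpq, mul_right_inj' hT2, add_left_inj, Int.cast_inj]

/-! ### Spin -/

/-- The part of the entry of the numerator that does not depend on the energy. -/
def numConst (s : G.Spin) (σ : G.SpinIndex) (i : I) : ℂ :=
  if h : G.fermionic i then ((s.mass i : ℂ) • (1 : Matrix (Fin 4) (Fin 4) ℂ) -
    ∑ j : Fin 3, (s.mom i j : ℂ) • s.γ j.succ) (σ ⟨i, h⟩).1 (σ ⟨i, h⟩).2 else 1

/-- The coefficient of `i k` in the entry of the numerator. -/
def numSlope (s : G.Spin) (σ : G.SpinIndex) (i : I) : ℂ :=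
  if h : G.fermionic i then s.γ 0 (σ ⟨i, h⟩).1 (σ ⟨i, h⟩).2 else 0

lemma two_mul_propagator (s : G.Spin) (σ : G.SpinIndex) (i : I) (k E : ℝ) :
    2 * (E : ℂ) * FeynmanGraph.propagator s σ i k E =
      lineProp (numConst s σ i) (numSlope s σ i) E k := by
  rw [FeynmanGraph.propagator, lineProp, mul_div_assoc]
  congr 2
  unfold numConst numSlope FeynmanGraph.diracNumerator
  split_ifs with h
  · simp only [Matrix.sub_apply, Matrix.add_apply, Matrix.smul_apply, smul_eq_mul]
    ring
  · simp

lemma integrand_eq (s : G.Spin) (k E : I → ℝ) : FeynmanGraph.integrand s k E =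
    ∑ σ : G.SpinIndex, s.vert σ * ∏ i, lineProp (numConst s σ i) (numSlope s σ i) (E i) (k i) := by
  rw [FeynmanGraph.integrand, Finset.mul_sum]
  refine Finset.sum_congr rfl fun σ _ => ?_
  rw [mul_left_comm, ← Finset.prod_mul_distrib]
  simp only [two_mul_propagator]

lemma prod_split (G : FeynmanGraph V I) (f : I → ℂ) : ∏ i, f i =
    (∏ i : {i // NonLoop G i}, f i) * ∏ i : {i // ¬ NonLoop G i}, f i :=
  (Fintype.prod_subtype_mul_prod_subtype _ f).symm

/-- Splits the powers of `T` and of `1 / 2π` between the independent energies of conserved flows and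
the self-loops. -/
lemma loops_eq (ht : GrownTree G Finset.univ t) :
    G.loops = (nonLoops G \ t).card + ((nonLoops G)ᶜ).card := by
  have h1 := ht.card
  have h2 := Finset.card_sdiff_of_subset ht.subset_nonLoops
  have h3 := Finset.card_le_card ht.subset_nonLoops
  have h4 := Finset.card_compl (nonLoops G)
  have h5 := Finset.card_le_univ (nonLoops G)
  rw [Finset.card_univ] at h1
  unfold FeynmanGraph.loops
  omega

end

section

variable {V I ι κ : Type*} [Fintype V] [Fintype I] [Fintype ι] [Fintype κ]
variable {G : FeynmanGraph V I} {t : Finset I} {c : κ → I}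

/-! ### The Matsubara sum -/

/-- The propagator of a line at the Matsubara frequency with index `n`. -/
def freqProp (s : G.Spin) (T : ℝ) (E : I → ℝ) (σ : G.SpinIndex) (i : I) (n : ℤ) : ℂ :=
  lineProp (numConst s σ i) (numSlope s σ i) (E i) (2 * Real.pi * T * (n + freqOffset G i))

lemma divergence_extendLoops (G : FeynmanGraph V I) (n : I → ℤ) (v : V) :
    divergence G (extendLoops G fun i => n i) v = divergence G n v := by
  refine divergence_congr (fun i hi => ?_) v
  simp [extendLoops, mem_nonLoops_iff.1 hi]

lemma matsubaraTerm_eq (s : G.Spin) {T : ℝ} (hT : 0 < T) {p : V → ℝ} {q : V → ℤ}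
    (hpq : ∀ v, p v = 2 * Real.pi * T * (q v + divergence G (freqOffset G) v)) (E : I → ℝ)
    (n : I → ℤ) : FeynmanGraph.matsubaraTerm s p E T n =
      ∑ σ : G.SpinIndex, (T : ℂ) ^ G.loops * s.vert σ *
        (flowTerm G q (freqProp s T E σ) (fun i => n i) *
          ∏ i : {i // ¬ NonLoop G i}, freqProp s T E σ i (n i)) := by
  unfold FeynmanGraph.matsubaraTerm flowTerm
  simp only [conserves_freq_iff hT hpq, divergence_extendLoops]
  split_ifs with h
  · rw [integrand_eq, Finset.mul_sum]
    refine Finset.sum_congr rfl fun σ _ => ?_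
    rw [prod_split G, mul_assoc]
    simp only [freq_eq, freqProp]
  · simp

lemma integrable_freqProp (hG : G.IsConnected) (ht : GrownTree G Finset.univ t)
    (hc : Enumerates G t c) {q : V → ℤ} (hq : ∑ v, q v = 0) {T : ℝ} (hT : 0 < T) (s : G.Spin)
    {E : I → ℝ} (hE : ∀ i, 0 < E i) (σ : G.SpinIndex) :
    Integrable (fun u : κ → ℤ => ∏ i ∈ nonLoops G, freqProp s T E σ i (coordFlow G t q c u i))
      Measure.count := by
  have hT2 : 2 * Real.pi * T ≠ 0 := by positivity
  have h := summable_decay_count hG ht hc hq hT2 fun i => 2 * Real.pi * T * freqOffset G i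
  simp only [← mul_add] at h
  exact integrable_prod_of_bound
    (k := fun u i => 2 * Real.pi * T * ((coordFlow G t q c u i : ℤ) + freqOffset G i))
    (fun i => measurable_of_countable _) h
    (fun i => (continuous_lineProp (numConst s σ i) (numSlope s σ i) (hE i)).measurable) _
    fun i k => norm_lineProp_le _ _ (hE i) k

/-- The value of the Matsubara sum, as a sum over the independent integers of the lines that are
not self-loops. -/
def thermalValue (s : G.Spin) (t : Finset I) (q : V → ℤ) (T : ℝ) (E : I → ℝ) : ℂ :=
  ∑ σ : G.SpinIndex, s.vert σ * ((T : ℂ) ^ (nonLoops G \ t).card *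
    ((∏ i ∈ (nonLoops G)ᶜ, 2 * numConst s σ i * thermalWeight G T E i) *
      ∫ u : {i // i ∈ nonLoops G \ t} → ℤ,
        ∏ i ∈ nonLoops G, freqProp s T E σ i (coordFlow G t q (fun j => j.1) u i) ∂Measure.count))

lemma tendsto_matsubaraPartial (hG : G.IsConnected) (ht : GrownTree G Finset.univ t) (s : G.Spin)
    {T : ℝ} (hT : 0 < T) {p : V → ℝ} {q : V → ℤ} (hq : ∑ v, q v = 0)
    (hpq : ∀ v, p v = 2 * Real.pi * T * (q v + divergence G (freqOffset G) v)) {E : I → ℝ}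
    (hE : ∀ i, 0 < E i) :
    Tendsto (FeynmanGraph.matsubaraPartial s p E T) atTop (𝓝 (thermalValue s t q T E)) := by
  have hT0 : (T : ℂ) ≠ 0 := by exact_mod_cast hT.ne'
  have hmain : ∀ σ : G.SpinIndex, Tendsto (fun M : ℕ =>
      (∑ m ∈ Fintype.piFinset (fun _ : {i // NonLoop G i} => Finset.Icc (-(M : ℤ)) M),
        flowTerm G q (freqProp s T E σ) m) *
        ∏ i : {i // ¬ NonLoop G i}, ∑ z ∈ Finset.Icc (-(M : ℤ)) M,
          freqProp s T E σ i z) atTop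
      (𝓝 ((∫ u : {i // i ∈ nonLoops G \ t} → ℤ,
        ∏ i ∈ nonLoops G, freqProp s T E σ i (coordFlow G t q (fun j => j.1) u i) ∂Measure.count) *
        ∏ i : {i // ¬ NonLoop G i}, (T : ℂ)⁻¹ * (2 * numConst s σ i *
          thermalWeight G T E i))) := by
    intro σ
    refine Tendsto.mul ?_ (tendsto_finsetProd _ fun i _ => tendsto_sum_loop G hT hE _ _ _)
    have h := (hasSum_flowTerm ht (enumerates_subtype G t) hq
      (integrable_freqProp hG ht (enumerates_subtype G t) hq hT s hE σ)).1
    exact h.tendsto_box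
  have hsum := tendsto_finsetSum Finset.univ fun σ _ =>
    (hmain σ).const_mul ((T : ℂ) ^ G.loops * s.vert σ)
  have hlim : ∑ σ : G.SpinIndex, (T : ℂ) ^ G.loops * s.vert σ *
      ((∫ u : {i // i ∈ nonLoops G \ t} → ℤ,
        ∏ i ∈ nonLoops G, freqProp s T E σ i (coordFlow G t q (fun j => j.1) u i) ∂Measure.count) *
        ∏ i : {i // ¬ NonLoop G i}, (T : ℂ)⁻¹ * (2 * numConst s σ i *
          thermalWeight G T E i)) = thermalValue s t q T E := by
    refine Finset.sum_congr rfl fun σ _ => ?_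
    rw [← prod_loops_subtype G fun i => (T : ℂ)⁻¹ * (2 * numConst s σ i * thermalWeight G T E i),
      Finset.prod_mul_distrib, Finset.prod_const, loops_eq ht, pow_add, inv_pow]
    have : (T : ℂ) ^ (nonLoops G)ᶜ.card ≠ 0 := pow_ne_zero _ hT0
    field_simp
  rw [← hlim]
  refine hsum.congr fun M => ?_
  unfold FeynmanGraph.matsubaraPartial
  simp only [matsubaraTerm_eq s hT hpq]
  rw [Finset.sum_comm]
  refine Finset.sum_congr rfl fun σ _ => ?_
  rw [← Finset.mul_sum]
  congr 1
  exact (sum_box_split (NonLoop G) _ (flowTerm G q (freqProp s T E σ))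
    (freqProp s T E σ)).symm

lemma summable_matsubaraTerm (hG : G.IsConnected) (ht : GrownTree G Finset.univ t) (s : G.Spin)
    {T : ℝ} (hT : 0 < T) {p : V → ℝ} {q : V → ℤ} (hq : ∑ v, q v = 0)
    (hpq : ∀ v, p v = 2 * Real.pi * T * (q v + divergence G (freqOffset G) v)) {E : I → ℝ}
    (hE : ∀ i, 0 < E i) (hf : ∀ i, G.fermionic i → NonLoop G i) :
    Summable (FeynmanGraph.matsubaraTerm s p E T) := by
  refine (summable_sum (s := Finset.univ) fun (σ : G.SpinIndex) _ =>
    (summable_split (NonLoop G) (g := freqProp s T E σ)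
      (hasSum_flowTerm ht (enumerates_subtype G t) hq
        (integrable_freqProp hG ht (enumerates_subtype G t) hq hT s hE σ)).2
      fun i hi => ?_).mul_left ((T : ℂ) ^ G.loops * s.vert σ)).congr fun n =>
        (matsubaraTerm_eq s hT hpq E n).symm
  have hi' : ¬ G.fermionic i := fun h => hi (hf i h)
  have := summable_scalar (numConst s σ i) (hE i) hT
  simpa [freqProp, numSlope, freqOffset, hi'] using this

lemma continuousAt_thermalValue (hG : G.IsConnected) (ht : GrownTree G Finset.univ t) (s : G.Spin)
    {T : ℝ} (hT : 0 < T) {q : V → ℤ} (hq : ∑ v, q v = 0) {E : I → ℝ} (hE : ∀ i, 0 < E i) :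
    ContinuousAt (thermalValue s t q T) E := by
  have hT2 : 2 * Real.pi * T ≠ 0 := by positivity
  have h := summable_decay_count hG ht (enumerates_subtype G t) hq hT2
    fun i => 2 * Real.pi * T * freqOffset G i
  simp only [← mul_add] at h
  have hw : ∀ i, ContinuousAt (fun E => thermalWeight G T E i) E := fun i =>
    continuousAt_const.add (Complex.continuous_ofReal.continuousAt.comp
      (ContinuousAt.comp (f := fun E : I → ℝ => E i) (continuousAt_occupation G hT i (hE i))
        (continuous_apply i).continuousAt))
  unfold thermalValue
  refine tendsto_finsetSum _ fun σ _ => ContinuousAt.mul continuousAt_const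
    (ContinuousAt.mul continuousAt_const (ContinuousAt.mul ?_ ?_))
  · exact tendsto_finsetProd _ fun i _ => (hw i).const_mul _
  · have hcont := continuousAt_integral_prod_lineProp (μ := Measure.count) (N := nonLoops G)
      (k := fun (u : {i // i ∈ nonLoops G \ t} → ℤ) (i : I) =>
        2 * Real.pi * T * ((coordFlow G t q (fun j => j.1) u i : ℤ) + freqOffset G i))
      (fun i => measurable_of_countable _) h (numConst s σ) (numSlope s σ) hE
    exact hcont

lemma thermalValue_eq (hG : G.IsConnected) (ht : GrownTree G Finset.univ t) (s : G.Spin)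
    {T : ℝ} (hT : 0 < T) {p : V → ℝ} {q : V → ℤ} (hq : ∑ v, q v = 0)
    (hpq : ∀ v, p v = 2 * Real.pi * T * (q v + divergence G (freqOffset G) v)) {E : I → ℝ}
    (hE : ∀ i, 0 < E i) (hgen : GenericEnergies E) : thermalValue s t q T E =
      ∑ σ : G.SpinIndex, s.vert σ *
        signedSum G (numConst s σ) (numSlope s σ) p E (thermalWeight G T E) := by
  have hT0 : (T : ℂ) ≠ 0 := by exact_mod_cast hT.ne'
  refine Finset.sum_congr rfl fun σ _ => ?_
  have h := finiteTemp_signedSum hG ht (enumerates_subtype G t) hT hq hpq hE hgen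
    (numConst s σ) (numSlope s σ)
  simp only [freqProp]
  rw [h, Fintype.card_coe, ← mul_assoc ((T : ℂ) ^ _), ← mul_pow, mul_inv_cancel₀ hT0, one_pow,
    one_mul]

end

section

variable {V I ι κ : Type*} [Fintype V] [Fintype I] [Fintype ι] [Fintype κ]
variable {G : FeynmanGraph V I} {t : Finset I}

/-! ### The zero-temperature integral -/

/-- The lines outside `t` that are not self-loops. -/
abbrev CoTree (G : FeynmanGraph V I) (t : Finset I) := {j : {i // i ∉ t} // NonLoop G j.1}

lemma enumerates_coTree (G : FeynmanGraph V I) (t : Finset I) :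
    Enumerates G t fun j : CoTree G t => j.1.1 where
  injective _ _ h := Subtype.ext (Subtype.ext h)
  range i := ⟨fun ⟨j, hj⟩ => hj ▸ ⟨mem_nonLoops_iff.2 j.2, j.1.2⟩,
    fun h => ⟨⟨⟨i, h.2⟩, mem_nonLoops_iff.1 h.1⟩, rfl⟩⟩

lemma lineEnergies_spec (ht : GrownTree G Finset.univ t) {ω : V → ℝ} (hω : ∑ v, ω v = 0)
    (x : {i // i ∉ t} → ℝ) : G.Conserves ω (G.lineEnergies t ω x) ∧
      ∀ l : {i // i ∉ t}, G.lineEnergies t ω x l = x l := by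
  refine Classical.epsilon_spec (p := fun k => G.Conserves ω k ∧ ∀ l : {i // i ∉ t}, k l = x l)
    ⟨treeFlow G t ω fun i => if h : i ∉ t then x ⟨i, h⟩ else 0, ?_, fun l => ?_⟩
  · exact conserves_iff.2 (ht.treeFlow_spec hω _).2
  · rw [(ht.treeFlow_spec hω _).1 l l.2, dif_pos l.2]

lemma lineEnergies_nonLoop (ht : GrownTree G Finset.univ t) {ω : V → ℝ} (hω : ∑ v, ω v = 0)
    (x : {i // i ∉ t} → ℝ) {i : I} (hi : i ∈ nonLoops G) : G.lineEnergies t ω x i =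
      coordFlow G t ω (fun j : CoTree G t => j.1.1) (fun j => x j.1) i :=
  (coordFlow_eq_on_nonLoops ht (enumerates_coTree G t) hω
    (fun j => (lineEnergies_spec ht hω x).2 j.1)
    (conserves_iff.1 (lineEnergies_spec ht hω x).1) i hi).symm

lemma prod_coTree_loops (ht : GrownTree G Finset.univ t) (f : I → ℂ) :
    ∏ i ∈ (nonLoops G)ᶜ, f i = ∏ j : {j : {i // i ∉ t} // ¬ NonLoop G j.1}, f j.1.1 := by
  refine Finset.prod_bij' (fun i hi => ⟨⟨i, fun h => Finset.mem_compl.1 hi (ht.subset_nonLoops h)⟩,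
    fun h => Finset.mem_compl.1 hi (mem_nonLoops_iff.2 h)⟩) (fun j _ => j.1.1) ?_ ?_ ?_ ?_ ?_
  · exact fun _ _ => Finset.mem_univ _
  · exact fun j _ => Finset.mem_compl.2 fun h => j.2 (mem_nonLoops_iff.1 h)
  · exact fun _ _ => rfl
  · exact fun _ _ => rfl
  · exact fun _ _ => rfl

/-- The contribution of the lines that are not self-loops to the zero-temperature integrand. -/
def coTreeIntegrand (s : G.Spin) (t : Finset I) (ω : V → ℝ) (E : I → ℝ) (σ : G.SpinIndex)
    (u : CoTree G t → ℝ) : ℂ :=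
  ∏ i ∈ nonLoops G, lineProp (numConst s σ i) (numSlope s σ i) (E i)
    (coordFlow G t ω (fun j : CoTree G t => j.1.1) u i)

lemma zeroTempIntegrand_eq (ht : GrownTree G Finset.univ t) (s : G.Spin) {ω : V → ℝ}
    (hω : ∑ v, ω v = 0) (E : I → ℝ) (x : {i // i ∉ t} → ℝ) :
    FeynmanGraph.zeroTempIntegrand s t ω E x = ∑ σ : G.SpinIndex,
      (1 / (2 * (Real.pi : ℂ))) ^ G.loops * s.vert σ *
        (coTreeIntegrand s t ω E σ (fun j => x j.1) *
          ∏ j : {j : {i // i ∉ t} // ¬ NonLoop G j.1},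
            lineProp (numConst s σ j.1) (numSlope s σ j.1) (E j.1) (x j.1)) := by
  rw [FeynmanGraph.zeroTempIntegrand, integrand_eq, Finset.mul_sum]
  refine Finset.sum_congr rfl fun σ _ => ?_
  rw [mul_assoc, ← Finset.prod_mul_prod_compl (nonLoops G), prod_coTree_loops ht]
  congr 3
  · exact Finset.prod_congr rfl fun i hi => by rw [lineEnergies_nonLoop ht hω x hi]
  · exact Finset.prod_congr rfl fun j _ => by rw [(lineEnergies_spec ht hω x).2 j.1]

lemma integrable_coTreeIntegrand (hG : G.IsConnected) (ht : GrownTree G Finset.univ t)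
    (s : G.Spin) {ω : V → ℝ} (hω : ∑ v, ω v = 0) {E : I → ℝ} (hE : ∀ i, 0 < E i)
    (σ : G.SpinIndex) : Integrable (coTreeIntegrand s t ω E σ) :=
  integrable_prod_of_bound
    (fun i => (continuous_coordFlow ht (enumerates_coTree G t) hω i).measurable)
    (integrable_decay_volume hG ht (enumerates_coTree G t) hω)
    (fun i => (continuous_lineProp (numConst s σ i) (numSlope s σ i) (hE i)).measurable) _
    fun i k => norm_lineProp_le _ _ (hE i) k

/-- The value of the zero-temperature integral, as an integral over the independent energies of the
lines that are not self-loops. -/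
def zeroTempValue (s : G.Spin) (t : Finset I) (ω : V → ℝ) (E : I → ℝ) : ℂ :=
  ∑ σ : G.SpinIndex, s.vert σ * ((1 / (2 * (Real.pi : ℂ))) ^ Fintype.card (CoTree G t) *
    ((∏ i ∈ (nonLoops G)ᶜ, numConst s σ i) * ∫ u, coTreeIntegrand s t ω E σ u))

lemma tendsto_zeroTempPartial (hG : G.IsConnected) (ht : GrownTree G Finset.univ t) (s : G.Spin)
    {ω : V → ℝ} (hω : ∑ v, ω v = 0) {E : I → ℝ} (hE : ∀ i, 0 < E i) :
    Tendsto (FeynmanGraph.zeroTempPartial s t ω E) atTop (𝓝 (zeroTempValue s t ω E)) := by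
  have hpi : (Real.pi : ℂ) ≠ 0 := by exact_mod_cast Real.pi_ne_zero
  have hmain : ∀ σ : G.SpinIndex, Tendsto (fun Λ : ℝ =>
      (∫ u in Set.Icc (fun _ : CoTree G t => -Λ) (fun _ => Λ), coTreeIntegrand s t ω E σ u) *
        ∏ j : {j : {i // i ∉ t} // ¬ NonLoop G j.1}, ∫ k in Set.Icc (-Λ) Λ,
          lineProp (numConst s σ j.1) (numSlope s σ j.1) (E j.1) k) atTop
      (𝓝 ((∫ u, coTreeIntegrand s t ω E σ u) *
        ∏ j : {j : {i // i ∉ t} // ¬ NonLoop G j.1}, 2 * Real.pi * numConst s σ j.1)) := by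
    intro σ
    refine Tendsto.mul ?_ (tendsto_finsetProd _ fun j _ => tendsto_integral_loop _ _ (hE _))
    exact aecover_box.integral_tendsto_of_countably_generated
      (integrable_coTreeIntegrand hG ht s hω hE σ)
  have hsum := tendsto_finsetSum Finset.univ fun σ _ =>
    (hmain σ).const_mul ((1 / (2 * (Real.pi : ℂ))) ^ G.loops * s.vert σ)
  have hlim : ∑ σ : G.SpinIndex, (1 / (2 * (Real.pi : ℂ))) ^ G.loops * s.vert σ *
      ((∫ u, coTreeIntegrand s t ω E σ u) *
        ∏ j : {j : {i // i ∉ t} // ¬ NonLoop G j.1}, 2 * Real.pi * numConst s σ j.1) =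
      zeroTempValue s t ω E := by
    refine Finset.sum_congr rfl fun σ _ => ?_
    rw [← prod_coTree_loops ht fun i => 2 * Real.pi * numConst s σ i,
      Finset.prod_mul_distrib, Finset.prod_const, loops_eq ht, pow_add,
      (enumerates_coTree G t).card]
    have h1 : (1 / (2 * (Real.pi : ℂ))) ^ (nonLoops G)ᶜ.card *
        (2 * (Real.pi : ℂ)) ^ (nonLoops G)ᶜ.card = 1 := by
      rw [← mul_pow, one_div_mul_cancel (by simp), one_pow]
    linear_combination ((1 / (2 * (Real.pi : ℂ))) ^ (nonLoops G \ t).card * s.vert σ *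
      (∫ u, coTreeIntegrand s t ω E σ u) * ∏ i ∈ (nonLoops G)ᶜ, numConst s σ i) * h1
  rw [← hlim]
  refine hsum.congr fun Λ => ?_
  unfold FeynmanGraph.zeroTempPartial
  simp only [zeroTempIntegrand_eq ht s hω]
  rw [integral_finsetSum]
  · refine Finset.sum_congr rfl fun σ _ => ?_
    rw [integral_const_mul]
    congr 1
    exact (setIntegral_box_split (fun j : {i // i ∉ t} => NonLoop G j.1) Λ
      (coTreeIntegrand s t ω E σ)
      fun j => lineProp (numConst s σ j.1) (numSlope s σ j.1) (E j.1)).symm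
  · intro σ _
    -- On a bounded box continuity suffices, so Dirac self-loops need no exception here.
    refine (Continuous.continuousOn ?_).integrableOn_compact isCompact_Icc
    refine continuous_const.mul (Continuous.mul ?_ ?_)
    · refine continuous_finsetProd _ fun i _ => (continuous_lineProp _ _ (hE i)).comp ?_
      refine (continuous_coordFlow ht (enumerates_coTree G t) hω i).comp ?_
      fun_prop
    · exact continuous_finsetProd _ fun j _ => (continuous_lineProp _ _ (hE _)).comp (by fun_prop)

/-- By `hf` every self-loop is scalar, so its numerator is constant and its propagator decays
quadratically. -/
lemma zeroTempIntegrable (hG : G.IsConnected) (ht : GrownTree G Finset.univ t) (s : G.Spin)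
    {ω : V → ℝ} (hω : ∑ v, ω v = 0) {E : I → ℝ} (hE : ∀ i, 0 < E i)
    (hf : ∀ i, G.fermionic i → NonLoop G i) : FeynmanGraph.ZeroTempIntegrable s t ω E := by
  unfold FeynmanGraph.ZeroTempIntegrable
  rw [show FeynmanGraph.zeroTempIntegrand s t ω E = _ from
    funext fun x => zeroTempIntegrand_eq ht s hω E x]
  refine integrable_finsetSum _ fun σ _ => Integrable.const_mul ?_ _
  refine integrable_split (fun j : {i // i ∉ t} => NonLoop G j.1)
    (F := coTreeIntegrand s t ω E σ)
    (g := fun j => lineProp (numConst s σ j.1) (numSlope s σ j.1) (E j.1))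
    (integrable_coTreeIntegrand hG ht s hω hE σ) fun j hj => ?_
  have hj' : ¬ G.fermionic j.1 := fun h => hj (hf _ h)
  have h0 : numSlope s σ j.1 = 0 := by simp [numSlope, hj']
  rw [h0]
  exact (integral_scalar _ (hE _)).1

lemma continuousAt_zeroTempValue (hG : G.IsConnected) (ht : GrownTree G Finset.univ t)
    (s : G.Spin) {ω : V → ℝ} (hω : ∑ v, ω v = 0) {E : I → ℝ} (hE : ∀ i, 0 < E i) :
    ContinuousAt (zeroTempValue s t ω) E := by
  unfold zeroTempValue
  refine tendsto_finsetSum _ fun σ _ => ContinuousAt.mul continuousAt_const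
    (ContinuousAt.mul continuousAt_const (ContinuousAt.mul continuousAt_const ?_))
  have h := continuousAt_integral_prod_lineProp (μ := volume) (N := nonLoops G)
    (k := fun (u : CoTree G t → ℝ) (i : I) => coordFlow G t ω (fun j : CoTree G t => j.1.1) u i)
    (fun i => (continuous_coordFlow ht (enumerates_coTree G t) hω i).measurable)
    (integrable_decay_volume hG ht (enumerates_coTree G t) hω) (numConst s σ) (numSlope s σ) hE
  exact h

lemma zeroTempValue_eq (hG : G.IsConnected) (ht : GrownTree G Finset.univ t) (s : G.Spin)
    {ω : V → ℝ} (hω : ∑ v, ω v = 0) {E : I → ℝ} (hE : ∀ i, 0 < E i) (hgen : GenericEnergies E) :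
    zeroTempValue s t ω E = ∑ σ : G.SpinIndex, s.vert σ *
      signedSum G (numConst s σ) (numSlope s σ) ω E fun _ => 1 / 2 := by
  have hpi : (Real.pi : ℂ) ≠ 0 := by exact_mod_cast Real.pi_ne_zero
  refine Finset.sum_congr rfl fun σ _ => ?_
  have h := zeroTemp_signedSum hG ht (enumerates_coTree G t) hω hE hgen
    (numConst s σ) (numSlope s σ)
  simp only [coTreeIntegrand]
  rw [h, ← mul_assoc (_ ^ _), ← mul_pow, one_div_mul_cancel (by simp), one_pow, one_mul]

end

end ThermalOperator

end

/-- **Thermal Operator Representation.** -/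
theorem theorem1 {V I : Type*} [Fintype V] [Fintype I] (G : FeynmanGraph V I)
    (hG : G.IsConnected) (s : G.Spin) (t : Finset I) (ht : G.IsTree t) :
    -- the zero-temperature integral converges (absolutely, unless there are fermionic self-loops)
    (∀ ω : V → ℝ, ∑ v, ω v = 0 → ∀ E : I → ℝ, (∀ i, 0 < E i) →
      Tendsto (FeynmanGraph.zeroTempPartial s t ω E) atTop
        (𝓝 (FeynmanGraph.D₀ s t ω E)) ∧
      ((∀ i, G.fermionic i → G.src i ≠ G.tgt i) →
        FeynmanGraph.ZeroTempIntegrable s t ω E)) ∧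
    -- it extends to a rational function of the kinematic energies
    (∀ ω : V → ℝ, ∑ v, ω v = 0 →
      ∃ P Q : MvPolynomial I ℂ, IsRationalExtension (FeynmanGraph.D₀ s t ω) P Q) ∧
    ∀ (T : ℝ), 0 < T → ∀ p : V → ℝ, G.IsExternal T p → ∀ E : I → ℝ, (∀ i, 0 < E i) →
      -- the Matsubara sum converges (absolutely, unless there are fermionic self-loops)
      Tendsto (FeynmanGraph.matsubaraPartial s p E T) atTop (𝓝 (FeynmanGraph.D s p E T)) ∧
      ((∀ i, G.fermionic i → G.src i ≠ G.tgt i) →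
        Summable (FeynmanGraph.matsubaraTerm s p E T)) ∧
      -- it is given by the action of the thermal operator on the rational function, both where no
      -- reflected denominator vanishes and, by continuity, at the remaining energies
      ∀ P Q : MvPolynomial I ℂ, IsRationalExtension (FeynmanGraph.D₀ s t p) P Q →
        ∀ O : Module.End ℂ ((I → ℝ) → ℂ),
          (O = G.thermalOperator T ∨ O = G.thermalOperator' T) →
          (E ∈ regularSet Q → FeynmanGraph.D s p E T = O (ratEval P Q) E) ∧
          E ∈ closure (regularSet Q) ∧
          Tendsto (O (ratEval P Q)) (𝓝[regularSet Q] E) (𝓝 (FeynmanGraph.D s p E T)) := by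
  classical
  have ht' := ThermalOperator.grownTree_of_isTree ht
  -- `D₀` and `D` are defined by `limUnder`, so they are identified only once convergence is known.
  have hD₀ : ∀ ω : V → ℝ, ∑ v, ω v = 0 → ∀ E : I → ℝ, (∀ i, 0 < E i) →
      FeynmanGraph.D₀ s t ω E = ThermalOperator.zeroTempValue s t ω E := fun ω hω E hE =>
    (ThermalOperator.tendsto_zeroTempPartial hG ht' s hω hE).limUnder_eq
  refine ⟨fun ω hω E hE => ⟨?_, ThermalOperator.zeroTempIntegrable hG ht' s hω hE⟩,
    fun ω hω => ?_, fun T hT p hp E hE => ?_⟩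
  · rw [hD₀ ω hω E hE]
    exact ThermalOperator.tendsto_zeroTempPartial hG ht' s hω hE
  · obtain ⟨P, Q, h⟩ := ThermalOperator.exists_rationalExtension hG
      (fun E hE => ThermalOperator.continuousAt_zeroTempValue hG ht' s hω hE)
      (fun E hE hgen => ThermalOperator.zeroTempValue_eq hG ht' s hω hE hgen)
    exact ⟨P, Q, fun E hE => ⟨(h E hE).1, (hD₀ ω hω E hE).trans (h E hE).2⟩⟩
  · obtain ⟨q, hq, hpq⟩ := ThermalOperator.exists_int_divergence hT hp
    have hlim := ThermalOperator.tendsto_matsubaraPartial hG ht' s hT hq hpq hE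
    have hD : FeynmanGraph.D s p E T = ThermalOperator.thermalValue s t q T E := hlim.limUnder_eq
    rw [hD]
    refine ⟨hlim, ThermalOperator.summable_matsubaraTerm hG ht' s hT hq hpq hE,
      fun P Q hPQ O hO => ?_⟩
    have hPQ' : IsRationalExtension (ThermalOperator.zeroTempValue s t p) P Q := fun E hE =>
      ⟨(hPQ E hE).1, (hD₀ p hp.1 E hE).symm.trans (hPQ E hE).2⟩
    exact ThermalOperator.thermalOperator_ratEval hG hp.1
      (fun E hE => ThermalOperator.continuousAt_zeroTempValue hG ht' s hp.1 hE)
      (fun E hE hgen => ThermalOperator.zeroTempValue_eq hG ht' s hp.1 hE hgen) hT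
      (fun E hE => ThermalOperator.continuousAt_thermalValue hG ht' s hT hq hE)
      (fun E hE hgen => ThermalOperator.thermalValue_eq hG ht' s hT hq hpq hE hgen) hPQ' hO hE
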